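/- **Conventions.** Number the qubits of the $[\![15,7,3]\!]$ Hamming code $1,\dots,15$. The code has the $X$ stabilizers $X_S$ and the $Z$ stabilizers $Z_S$, where $S$ runs over the rows of the parity-check matrix whose $i$-th column is $i$ written in binary. The logical operators are $\overline X_j=X_{S_j}$, $\overline Z_j=Z_{S_j}$ ($j=1,\dots,7$) with $S_1=\{1,2,4,8,15\}$, $S_2=\{1,2,5,10,12\}$, $S_3=\{1,2,6,11,14\}$, $S_4=\{1,2,7,9,13\}$, $S_5=\{1,4,6,9,10\}$, $S_6=\{1,4,7,12,14\}$, $S_7=\{1,8,10,13,14\}$. Let $E:(\mathbb C^2)^{\otimes 7}\to(\mathbb C^2)^{\otimes 15}$ be the encoder $|y\rangle\mapsto\prod_j\overline X_j^{\,y_j}\cdot\frac14\sum_{X_S}X_S|0^{15}\rangle$, the sum being over all $16$ products of $X$ stabilizers. A unitary $U$ on the $15$ qubits implements the logical unitary $L$ if $UE=EL$. The Clifford group $\mathcal C_k$ on $k$ qubits is the normalizer of the Pauli group $\{i^mX^aZ^b\}$ in the unitary group. Let $$\begin{aligned}\sigma_1&=(1,2,3)(4,14,10)(5,12,9)(6,13,11)(7,15,8),\\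 \sigma_2&=(1,10,5,2,12)(3,6,4,8,9)(7,14,13,11,15),\\ \sigma_3&=(1,10,15,3,8,13)(4,6)(5,12,11)(7,14,9),\end{aligned}$$ acting as permutations of the qubits, and let the round-robin circuit be $$R=Z_4Z_8Z_{12}\prod_{j=5,6,7}\mathrm{CZ}_{4,j}\prod_{j=9,10,11}\mathrm{CZ}_{8,j}\prod_{j=13,14,15}\mathrm{CZ}_{12,j}.$$ **Two-ancilla procedure $\mathcal R$ for $R$.** There are two ancilla qubits $a_0,a_1$. The building blocks are the following. * *Flagged syndrome extraction* $\mathrm{Syn}(q_1,\dots,q_8)$, for a $Z$ stabilizer with support $\{q_1,\dots,q_8\}$. Prepare $a_0$ in $|0\rangle$ and $a_1$ in $|+\rangle$. Apply CNOTs $q_1\to a_0$, $a_1\to a_0$, $q_2\to a_0,\dots,q_7\to a_0$, $a_1\to a_0$. Measure $a_1$ in the $X$ basis. Prepare $a_1$ in $|0\rangle$. Apply CNOTs $q_8\to a_1$, $q_8\to a_0$. Measure $a_0$ in the $Z$ basis. The qubit $a_1$ stays coupled to $q_8$ as an open flag. * *$\mathrm{CZ}$ gadget* $\mathrm G_{c,t}(a)$.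 Prepare $a$ in $|+\rangle$; apply CNOT $a\to c$, $\mathrm{CZ}_{c,t}$, $\mathrm{CZ}_{a,t}$, CNOT $a\to c$; measure $a$ in the $X$ basis. * *Protected $\mathrm{CZ}$ gates* $\mathrm P(c;t_1,t_2,t_3)$, started with a flag on $c$ open on $a_1$. Perform $\mathrm G_{c,t_1}(a_0)$; prepare $a_0$ in $|0\rangle$; CNOTs $c\to a_0$, $c\to a_1$; measure $a_1$ in the $Z$ basis. Perform $\mathrm G_{c,t_2}(a_1)$; prepare $a_1$ in $|0\rangle$; CNOTs $c\to a_1$, $c\to a_0$; measure $a_0$ in the $Z$ basis. Perform $\mathrm G_{c,t_3}(a_0)$; CNOT $c\to a_1$; measure $a_1$ in the $Z$ basis. * *Error correction* (EC). Measure the four $Z$ and then the four $X$ stabilizers one at a time, using $a_0$ (CNOTs from the support to $a_0$ prepared in $|0\rangle$, respectively from $a_0$ prepared in $|+\rangle$ to the support). Then apply a Pauli correction chosen by a fixed rule from these outcomes and the two outcomes of the syndrome extraction that led to this step. Write $B_4,B_8,B_{12}$ for the unprotected blocks of three $\mathrm{CZ}$ gates from $4$, $8$, $12$. A measurement outcome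 is trivial if it is $0$ or $+$. The procedure $\mathcal R$ is as follows. 0. Apply $Z_4,Z_8,Z_{12}$. 1. Perform $\mathrm{Syn}(15,13,14,7,12,6,5,4)$. If an outcome is nontrivial, apply CNOT $4\to a_1$, EC, then $B_4,B_8,B_{12}$, and stop. 2. Perform $\mathrm P(4;5,6,7)$. If an outcome is nontrivial, apply $B_8,B_{12}$ and stop. 3. Perform $\mathrm{Syn}(15,13,14,11,12,10,9,8)$. If an outcome is nontrivial, apply CNOT $8\to a_1$, $B_4$, EC, then $B_4,B_8,B_{12}$, and stop. Otherwise perform $\mathrm P(8;9,10,11)$. If an outcome is nontrivial, apply $B_{12}$ and stop. 4. Perform $\mathrm{Syn}(11,9,10,15,8,14,13,12)$. If an outcome is nontrivial, apply CNOT $12\to a_1$, $B_{12}$, and stop. Otherwise perform $\mathrm P(12;13,14,15)$ and stop. **Fault tolerance.** A fault is either an arbitrary two-qubit Pauli operator after a two-qubit gate, on the qubits of that gate, or a one-qubit Pauli operator on any of the $17$ qubits at any time between operations. A procedure on the code block and the two ancilla qubits is a *fault-tolerant implementation of $U$* if (i) without faults it maps every encoded state $E\varphi$ to $UE\varphi$;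 and (ii) there is a rule choosing a Pauli correction from the measurement record of the procedure and the stabilizer syndrome, such that for every execution with at most one fault on an encoded state $E\varphi$, after a subsequent perfect measurement of the stabilizers and application of the correction, the code block is in exactly the state $UE\varphi$ (up to normalization and global phase) and is not entangled with the ancilla qubits. This is required for all outcomes of all measurements and for every initial state of the ancilla qubits. **Theorem.** 1. $E$ is an isometry onto the code space, with $\overline X_jE=EX_j$ and $\overline Z_jE=EZ_j$ for all $j$. 2. Each transversal operator $u^{\otimes 15}$ with $u\in\mathcal C_1$, each permutation $\sigma_1,\sigma_2,\sigma_3$, and $R$ preserve the code space and implement a logical Clifford operator. Together they generate the full seven-qubit logical Clifford group: the set of logical unitaries implemented by elements of the group that they generate is exactly $\mathcal C_7$. 3. For every $u\in\mathcal C_1$, applying $u$ to the $15$ qubits one after another is a fault-tolerant implementation of $u^{\otimes 15}$. Permuting the qubits by $\sigma_i$ (moving or relabelling them) is a fault-tolerant implementation of $\sigma_i$, for $i=1,2,3$. 4. For a suitable choice of the correction rules in its two EC steps, the two-ancilla procedure $\mathcal R$ is a fault-tolerant implementation of $R$: every single fault is correctable. -/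

import Mathlib

namespace Hamming15

open Matrix

/-! ## Qubits, Pauli operators, Clifford groups -/

/-- A classical bit. -/
abbrev Bit : Type := ZMod 2

/-- Operators from the qubits labelled by `κ` to the qubits labelled by `ι`, as matrices in the
computational bases, which are indexed by bit strings. -/
abbrev Op (ι κ : Type) : Type := Matrix (ι → Bit) (κ → Bit) ℂ

/-- The sign `(-1)^b`. -/
noncomputable def sgn (b : Bit) : ℂ := if b = 0 then 1 else -1

section Operators

variable {ι : Type} [Fintype ι] [DecidableEq ι]

/-- The Pauli operator `X^a Z^b`, which maps `|y⟩` to `(-1)^(b⬝y) |y + a⟩`. -/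
noncomputable def pauliOp (a b : ι → Bit) : Op ι ι :=
  Matrix.of fun x y => if x = y + a then sgn (b ⬝ᵥ y) else 0

/-- The one-qubit Pauli operator `X^a Z^b` acting on qubit `q`. -/
noncomputable def pauliAt (q : ι) (a b : Bit) : Op ι ι :=
  pauliOp (Pi.single q a) (Pi.single q b)

/-- The two-qubit Pauli operator `X^a Z^b` on qubit `i` times `X^a' Z^b'` on qubit `j`. -/
noncomputable def pauliAt₂ (i j : ι) (a b a' b' : Bit) : Op ι ι :=
  pauliAt i a b * pauliAt j a' b'

/-- The controlled-phase gate `CZ` between qubits `i` and `j`. -/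
noncomputable def czOp (i j : ι) : Op ι ι := Matrix.diagonal fun x => sgn (x i * x j)

/-- The `CNOT` gate with control `c` and target `t`. -/
noncomputable def cnotOp (c t : ι) : Op ι ι :=
  Matrix.of fun x y => if x = y + Pi.single t (y c) then 1 else 0

/-- The one-qubit operator `u` acting on qubit `q`. -/
noncomputable def localOp (u : Op (Fin 1) (Fin 1)) (q : ι) : Op ι ι :=
  Matrix.of fun x y => if ∀ i, i ≠ q → x i = y i then u (fun _ => x q) (fun _ => y q) else 0

/-- The permutation of qubits that moves the qubit at position `i` to position `σ i`. -/
noncomputable def permOp (σ : Equiv.Perm ι) : Op ι ι :=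
  Matrix.of fun x y => if x = y ∘ σ.symm then 1 else 0

/-- The transversal operator `u ⊗ u ⊗ ⋯ ⊗ u`. -/
noncomputable def transversalOp (u : Op (Fin 1) (Fin 1)) : Op ι ι :=
  Matrix.of fun x y => ∏ i, u (fun _ => x i) (fun _ => y i)

end Operators

/-- The Pauli group on the qubits `ι`: the operators `i^k X^a Z^b`. -/
def pauliGroup (ι : Type) [Fintype ι] [DecidableEq ι] :
    Subgroup (Matrix.unitaryGroup (ι → Bit) ℂ) :=
  Subgroup.closure {U | ∃ (c : ℂ) (a b : ι → Bit), c ^ 4 = 1 ∧ (U : Op ι ι) = c • pauliOp a b}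

/-- The Clifford group on the qubits `ι` (with all global phases): the unitaries that normalize the
Pauli group. -/
def cliffordGroup (ι : Type) [Fintype ι] [DecidableEq ι] :
    Subgroup (Matrix.unitaryGroup (ι → Bit) ℂ) :=
  Subgroup.normalizer (pauliGroup ι : Set (Matrix.unitaryGroup (ι → Bit) ℂ))

/-! ## The `[[15,7,3]]` Hamming code

The qubits of the code block are numbered `1, …, 15`, and qubit `n` is `dat n`. -/

/-- The code-block qubit with number `n`, for `1 ≤ n ≤ 15`. -/
def dat (n : ℕ) : Fin 15 := Fin.ofNat 15 (n - 1)

/-- The parity checks that define both the `X` and the `Z` stabilizers. -/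
def checks : Matrix (Fin 4) (Fin 15) Bit :=
  !![0,0,0,0,0,0,0,1,1,1,1,1,1,1,1;
     0,0,0,1,1,1,1,0,0,0,0,1,1,1,1;
     0,1,1,0,0,1,1,0,0,1,1,0,0,1,1;
     1,0,1,0,1,0,1,0,1,0,1,0,1,0,1]

/-- The supports of the logical operators: row `j` is the support of both the logical `X` and the
logical `Z` operator of the `j`-th encoded qubit. -/
def logicals : Matrix (Fin 7) (Fin 15) Bit :=
  !![1,1,0,1,0,0,0,1,0,0,0,0,0,0,1;
     1,1,0,0,1,0,0,0,0,1,0,1,0,0,0;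
     1,1,0,0,0,1,0,0,0,0,1,0,0,1,0;
     1,1,0,0,0,0,1,0,1,0,0,0,1,0,0;
     1,0,0,1,0,1,0,0,1,1,0,0,0,0,0;
     1,0,0,1,0,0,1,0,0,0,0,1,0,1,0;
     1,0,0,0,0,0,0,1,0,1,0,0,1,1,0]

/-- The `i`-th `X` stabilizer. -/
noncomputable def stabX (i : Fin 4) : Op (Fin 15) (Fin 15) := pauliOp (checks i) 0

/-- The `i`-th `Z` stabilizer. -/
noncomputable def stabZ (i : Fin 4) : Op (Fin 15) (Fin 15) := pauliOp 0 (checks i)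

/-- The code space: the joint `+1` eigenspace of the stabilizers. -/
def codeSpace : Set ((Fin 15 → Bit) → ℂ) :=
  {v | ∀ i, stabX i *ᵥ v = v ∧ stabZ i *ᵥ v = v}

/-- The encoding isometry from seven logical qubits into the code block:
`|y⟩ ↦ ∏ⱼ (logical Xⱼ)^(yⱼ) · (1/4) ∑_{X stabilizers X_S} X_S |0⟩`. -/
noncomputable def encoder : Op (Fin 15) (Fin 7) :=
  open Classical in
  Matrix.of fun x y => if ∃ c : Fin 4 → Bit, x = y ᵥ* logicals + c ᵥ* checks then 1 / 4 else 0

/-- `E` is an isometry onto the code space that takes the `X` and `Z` operators of the seven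
logical qubits to the logical operators of the code. -/
def IsEncoder (E : Op (Fin 15) (Fin 7)) : Prop :=
  Eᴴ * E = 1 ∧
  (∀ v, v ∈ codeSpace ↔ ∃ φ, v = E *ᵥ φ) ∧
  ∀ j : Fin 7, pauliOp (logicals j) 0 * E = E * pauliAt j 1 0 ∧
    pauliOp 0 (logicals j) * E = E * pauliAt j 0 1

/-! ## The generating operations -/

/-- The cyclic permutation of the listed qubits. -/
def cyc (l : List ℕ) : Equiv.Perm (Fin 15) := (l.map dat).formPerm

def σ₁ : Equiv.Perm (Fin 15) :=
  cyc [1, 2, 3] * cyc [4, 14, 10] * cyc [5, 12, 9] * cyc [6, 13, 11] * cyc [7, 15, 8]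

def σ₂ : Equiv.Perm (Fin 15) :=
  cyc [1, 10, 5, 2, 12] * cyc [3, 6, 4, 8, 9] * cyc [7, 14, 13, 11, 15]

def σ₃ : Equiv.Perm (Fin 15) :=
  cyc [1, 10, 15, 3, 8, 13] * cyc [4, 6] * cyc [5, 12, 11] * cyc [7, 14, 9]

/-- The endpoints of the nine `CZ` gates of the round-robin circuit. -/
def roundRobinPairs : List (ℕ × ℕ) :=
  [(4, 5), (4, 6), (4, 7), (8, 9), (8, 10), (8, 11), (12, 13), (12, 14), (12, 15)]

/-- The round-robin circuit: `Z` on qubits `4, 8, 12`, and `CZ` gates from `4` to `5, 6, 7`, from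
`8` to `9, 10, 11` and from `12` to `13, 14, 15`. -/
noncomputable def roundRobin : Op (Fin 15) (Fin 15) :=
  (roundRobinPairs.map fun p => czOp (dat p.1) (dat p.2)).prod *
    (pauliAt (dat 4) 0 1 * pauliAt (dat 8) 0 1 * pauliAt (dat 12) 0 1)

/-- The generators: transversal one-qubit Clifford operators `u^{⊗15}`, the code automorphisms
`σ₁, σ₂, σ₃`, and the round-robin circuit. -/
def generators : Set (Matrix.unitaryGroup (Fin 15 → Bit) ℂ) :=
  {U | (∃ u ∈ cliffordGroup (Fin 1), (U : Op (Fin 15) (Fin 15)) = transversalOp (u : Op _ _)) ∨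
    (∃ σ ∈ ({σ₁, σ₂, σ₃} : Set (Equiv.Perm (Fin 15))),
      (U : Op (Fin 15) (Fin 15)) = permOp σ) ∨
    (U : Op (Fin 15) (Fin 15)) = roundRobin}

/-! ## Adaptive procedures and their faulty executions -/

/-- The measurement and preparation bases: `Z` stands for `|0⟩, |1⟩` and `X` for `|+⟩, |-⟩`. -/
inductive Basis
  | X
  | Z

/-- Elementary unitary operations. -/
inductive Gate (ι : Type)
  | cz (i j : ι)
  | cnot (c t : ι)
  | pauli (q : ι) (a b : Bit)
  | loc (u : Op (Fin 1) (Fin 1)) (q : ι)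
  | relabel (σ : Equiv.Perm ι)

/-- An adaptive procedure: a sequence of gates, preparations (of `|0⟩` or `|+⟩`) and measurements,
in which the continuation after a measurement may depend on its outcome. Outcome `0` means `|0⟩` or
`|+⟩`, and outcome `1` means `|1⟩` or `|-⟩`. -/
inductive Proc (ι : Type)
  | done : Proc ι
  | gate (g : Gate ι) (k : Proc ι) : Proc ι
  | prep (b : Basis) (q : ι) (k : Proc ι) : Proc ι
  | meas (b : Basis) (q : ι) (k : Bit → Proc ι) : Proc ι

section Execution

variable {ι : Type} [Fintype ι] [DecidableEq ι]

/-- The unitary operator of a gate. -/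
noncomputable def Gate.op : Gate ι → Op ι ι
  | .cz i j => czOp i j
  | .cnot c t => cnotOp c t
  | .pauli q a b => pauliAt q a b
  | .loc u q => localOp u q
  | .relabel σ => permOp σ

/-- The Pauli faults that can follow a gate: arbitrary two-qubit Pauli operators on the two qubits
of a two-qubit gate. (One-qubit faults are allowed at all times on all qubits, see `Run`.) -/
inductive Gate.Fault : Gate ι → Op ι ι → Prop
  | cz (i j : ι) (a b a' b' : Bit) : Gate.Fault (.cz i j) (pauliAt₂ i j a b a' b')
  | cnot (c t : ι) (a b a' b' : Bit) : Gate.Fault (.cnot c t) (pauliAt₂ c t a b a' b')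

/-- The projector for outcome `m` of the measurement of qubit `q` in a basis. -/
noncomputable def measOp : Basis → ι → Bit → Op ι ι
  | .Z, q, m => (1 / 2 : ℂ) • (1 + sgn m • pauliAt q 0 1)
  | .X, q, m => (1 / 2 : ℂ) • (1 + sgn m • pauliAt q 1 0)

/-- The Kraus operators `|0⟩⟨m|` (basis `Z`) or `|+⟩⟨±|` (basis `X`) of the preparation of qubit `q`
in `|0⟩` or `|+⟩`; the outcome `m` is not recorded. -/
noncomputable def prepOp : Basis → ι → Bit → Op ι ι
  | .Z, q, m => pauliAt q m 0 * measOp .Z q m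
  | .X, q, m => pauliAt q 0 m * measOp .X q m

/-- `Run n p r K`: one of the possible executions of the procedure `p` has `n` faults and the
measurement record `r`, and acts on the state by the Kraus operator `K`. A fault is a two-qubit
Pauli operator after a two-qubit gate, or a one-qubit Pauli operator on any qubit at any time
(including directly before or after every gate, preparation and measurement). -/
inductive Run : ℕ → Proc ι → List Bit → Op ι ι → Prop
  | done : Run 0 .done [] 1
  | gate {n : ℕ} {g : Gate ι} {k : Proc ι} {r : List Bit} {K : Op ι ι} :
      Run n k r K → Run n (.gate g k) r (K * g.op)
  | prep {n : ℕ} {b : Basis} {q : ι} {k : Proc ι} {r : List Bit} {K : Op ι ι} (m : Bit) :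
      Run n k r K → Run n (.prep b q k) r (K * prepOp b q m)
  | meas {n : ℕ} {b : Basis} {q : ι} {k : Bit → Proc ι} {r : List Bit} {K : Op ι ι} (m : Bit) :
      Run n (k m) r K → Run n (.meas b q k) (m :: r) (K * measOp b q m)
  | gateFault {n : ℕ} {g : Gate ι} {k : Proc ι} {r : List Bit} {K P : Op ι ι} :
      g.Fault P → Run n k r K → Run (n + 1) (.gate g k) r (K * (P * g.op))
  | restFault {n : ℕ} {p : Proc ι} {r : List Bit} {K : Op ι ι} (q : ι) (a b : Bit) :
      Run n p r K → Run (n + 1) p r (K * pauliAt q a b)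

end Execution

/-! ## Fault tolerance with two ancilla qubits -/

/-- The `17` physical qubits: the `15` qubits of the code block, and two ancilla qubits. -/
abbrev Qubit : Type := Fin 15 ⊕ Fin 2

/-- The tensor product of an operator into the code block and an operator on the ancilla qubits. -/
def tensorAnc {κ : Type} (M : Op (Fin 15) κ) (A : Op (Fin 2) (Fin 2)) :
    Matrix (Qubit → Bit) ((κ → Bit) × (Fin 2 → Bit)) ℂ :=
  Matrix.of fun x y => M (x ∘ Sum.inl) y.1 * A (x ∘ Sum.inr) y.2

/-- An operator on the code block, extended by the identity on the ancilla qubits. -/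
def onData (M : Op (Fin 15) (Fin 15)) : Op Qubit Qubit :=
  Matrix.of fun x y =>
    M (x ∘ Sum.inl) (y ∘ Sum.inl) * (1 : Op (Fin 2) (Fin 2)) (x ∘ Sum.inr) (y ∘ Sum.inr)

/-- The outcomes of the measurements of the four `X` and of the four `Z` stabilizers. -/
abbrev Syndrome : Type := (Fin 4 → Bit) × (Fin 4 → Bit)

/-- The `X` part `a` and the `Z` part `b` of a Pauli operator `X^a Z^b` on the code block. -/
abbrev Recovery : Type := (Fin 15 → Bit) × (Fin 15 → Bit)

/-- The projector onto the subspace on which the stabilizers have the eigenvalues `(-1)^s`. -/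
noncomputable def syndromeProj (s : Syndrome) : Op (Fin 15) (Fin 15) :=
  (List.ofFn fun i => (1 / 2 : ℂ) • (1 + sgn (s.1 i) • stabX i)).prod *
    (List.ofFn fun i => (1 / 2 : ℂ) • (1 + sgn (s.2 i) • stabZ i)).prod

/-- The procedure `p` is a fault-tolerant implementation of the operation `U` on the code block:

* without faults, it applies `U` to every encoded state;
* there is a rule `D`, by which a Pauli correction is chosen from the measurement record of `p` and
  the syndrome, such that for every execution of `p` on an encoded state with at most one fault,
  when the stabilizers are then measured perfectly and the correction is applied, the result is
  exactly the encoded state transformed by `U`.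

The statements are equalities of operators, with an operator `A` on the ancilla qubits, so they hold
for all encoded states (also when these are entangled with other systems) and for all initial states
of the ancilla qubits, for every outcome of every measurement. -/
def FaultTolerant (p : Proc Qubit) (U : Op (Fin 15) (Fin 15)) : Prop :=
  (∀ (r : List Bit) (K : Op Qubit Qubit), Run 0 p r K →
    ∃ A, K * tensorAnc encoder 1 = tensorAnc (U * encoder) A) ∧
  ∃ D : List Bit → Syndrome → Recovery,
    ∀ (n : ℕ) (r : List Bit) (K : Op Qubit Qubit), n ≤ 1 → Run n p r K →
      ∀ s : Syndrome, ∃ A,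
        onData (pauliOp (D r s).1 (D r s).2) * onData (syndromeProj s) * K * tensorAnc encoder 1 =
          tensorAnc (U * encoder) A

/-! ## The procedures -/

/-- Perform a list of gates, then continue with `k`. -/
def gates {ι : Type} (l : List (Gate ι)) (k : Proc ι) : Proc ι := l.foldr .gate k

/-- Transversal `u`: the operator `u` is applied to the code-block qubits one after the other. -/
noncomputable def transversalProc (u : Op (Fin 1) (Fin 1)) : Proc Qubit :=
  gates ((List.finRange 15).map fun q => .loc u (.inl q)) .done

/-- A permutation of the code-block qubits, by moving or relabelling them. -/
def permProc (σ : Equiv.Perm (Fin 15)) : Proc Qubit :=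
  gates [.relabel (Equiv.sumCongr σ (Equiv.refl (Fin 2)))] .done

/-- Code-block qubit number `n`, for `1 ≤ n ≤ 15`, among the `17` qubits. -/
def d (n : ℕ) : Qubit := .inl (dat n)

/-- The two ancilla qubits. -/
def anc (i : Fin 2) : Qubit := .inr i

/-- Unprotected `CZ` gates from `c` to the qubits `ts`. -/
def czGates (c : ℕ) (ts : List ℕ) : List (Gate Qubit) := ts.map fun t => .cz (d c) (d t)

/-- Flagged extraction of the syndrome of the `Z` stabilizer supported on the eight qubits
`q₁, …, q₈`. Ancilla `0`, prepared in `|0⟩`, collects the parity. Ancilla `1`, prepared in `|+⟩`, is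
first the flag for `Z` faults on ancilla `0`, coupled after the first and before the last `CNOT`
gate of the extraction and measured in the `X` basis. Before the last `CNOT` gate, ancilla `1` is
prepared again, in `|0⟩`, and coupled to `q₈` as a flag for `X` faults on `q₈`. That flag is left
open at the end. The continuation gets the outcome `f` of the `X` measurement and the syndrome
`m`. -/
def flaggedSyndrome (q₁ q₂ q₃ q₄ q₅ q₆ q₇ q₈ : ℕ) (k : Bit → Bit → Proc Qubit) : Proc Qubit :=
  .prep .Z (anc 0) <| .prep .X (anc 1) <|
  gates [.cnot (d q₁) (anc 0), .cnot (anc 1) (anc 0), .cnot (d q₂) (anc 0), .cnot (d q₃) (anc 0),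
    .cnot (d q₄) (anc 0), .cnot (d q₅) (anc 0), .cnot (d q₆) (anc 0), .cnot (d q₇) (anc 0),
    .cnot (anc 1) (anc 0)] <|
  .meas .X (anc 1) fun f =>
  .prep .Z (anc 1) <|
  gates [.cnot (d q₈) (anc 1), .cnot (d q₈) (anc 0)] <|
  .meas .Z (anc 0) fun m => k f m

/-- The gadget for a `CZ` gate between `c` and `t` that catches `ZZ` faults, with the ancilla `a`
prepared in `|+⟩` and measured in the `X` basis. -/
def czGadget (c t : ℕ) (a : Fin 2) (k : Bit → Proc Qubit) : Proc Qubit :=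
  .prep .X (anc a) <|
  gates [.cnot (anc a) (d c), .cz (d c) (d t), .cz (anc a) (d t), .cnot (anc a) (d c)] <|
  .meas .X (anc a) k

/-- Protected `CZ` gates from `c` to `t₁, t₂, t₃`. Each `CZ` gate is replaced by the gadget that
catches `ZZ` faults and is wrapped by a flag that catches `X` faults on `c`. The three flags
overlap, and the first of them has already been opened on ancilla `1`. The procedure continues with
`ok` if all six measurements are trivial, and with `bad` otherwise. -/
def protectedCZ (c t₁ t₂ t₃ : ℕ) (ok bad : Proc Qubit) : Proc Qubit :=
  czGadget c t₁ 0 fun m₁ =>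
  .prep .Z (anc 0) <| gates [.cnot (d c) (anc 0), .cnot (d c) (anc 1)] <|
  .meas .Z (anc 1) fun f₁ =>
  czGadget c t₂ 1 fun m₂ =>
  .prep .Z (anc 1) <| gates [.cnot (d c) (anc 1), .cnot (d c) (anc 0)] <|
  .meas .Z (anc 0) fun f₂ =>
  czGadget c t₃ 0 fun m₃ =>
  gates [.cnot (d c) (anc 1)] <|
  .meas .Z (anc 1) fun f₃ =>
  if m₁ = 0 ∧ f₁ = 0 ∧ m₂ = 0 ∧ f₂ = 0 ∧ m₃ = 0 ∧ f₃ = 0 then ok else bad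

/-- The code-block qubits in the support of check number `i`. -/
def checkSupport (i : Fin 4) : List (Fin 15) := (List.finRange 15).filter fun q => checks i q = 1

/-- Measure the listed `Z` stabilizers one after the other with ancilla `0`. -/
def measureStabZ : List (Fin 4) → (List Bit → Proc Qubit) → Proc Qubit
  | [], k => k []
  | i :: l, k =>
      .prep .Z (anc 0) <| gates ((checkSupport i).map fun q => .cnot (.inl q) (anc 0)) <|
      .meas .Z (anc 0) fun m => measureStabZ l fun ms => k (m :: ms)

/-- Measure the listed `X` stabilizers one after the other with ancilla `0`. -/
def measureStabX : List (Fin 4) → (List Bit → Proc Qubit) → Proc Qubit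
  | [], k => k []
  | i :: l, k =>
      .prep .X (anc 0) <| gates ((checkSupport i).map fun q => .cnot (anc 0) (.inl q)) <|
      .meas .X (anc 0) fun m => measureStabX l fun ms => k (m :: ms)

/-- Error correction: measure all stabilizers, then apply the Pauli correction that the rule `D`
chooses from the outcomes (those of the `Z` stabilizers first). -/
def errorCorrection (D : List Bit → Recovery) (k : Proc Qubit) : Proc Qubit :=
  measureStabZ (List.finRange 4) fun mz =>
  measureStabX (List.finRange 4) fun mx =>
  gates ((List.finRange 15).map fun q =>
    .pauli (.inl q) ((D (mz ++ mx)).1 q) ((D (mz ++ mx)).2 q)) k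

/-- The two-ancilla procedure for the round-robin circuit. The rules `D₁` and `D₂` choose the
corrections in the two places where error correction is applied inside the procedure, from the two
measurement outcomes that led there and the outcomes of the error correction itself. -/
def roundRobinProc (D₁ D₂ : Bit → Bit → List Bit → Recovery) : Proc Qubit :=
  gates [.pauli (d 4) 0 1, .pauli (d 8) 0 1, .pauli (d 12) 0 1] <|
  flaggedSyndrome 15 13 14 7 12 6 5 4 fun f m =>
  if ¬ (f = 0 ∧ m = 0) then
    gates [.cnot (d 4) (anc 1)] <|
    errorCorrection (D₁ f m) <|
    gates (czGates 4 [5, 6, 7] ++ czGates 8 [9, 10, 11] ++ czGates 12 [13, 14, 15]) .done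
  else
  protectedCZ 4 5 6 7
    (bad := gates (czGates 8 [9, 10, 11] ++ czGates 12 [13, 14, 15]) .done) <|
  flaggedSyndrome 15 13 14 11 12 10 9 8 fun f m =>
  if ¬ (f = 0 ∧ m = 0) then
    gates ([.cnot (d 8) (anc 1)] ++ czGates 4 [5, 6, 7]) <|
    errorCorrection (D₂ f m) <|
    gates (czGates 4 [5, 6, 7] ++ czGates 8 [9, 10, 11] ++ czGates 12 [13, 14, 15]) .done
  else
  protectedCZ 8 9 10 11
    (bad := gates (czGates 12 [13, 14, 15]) .done) <|
  flaggedSyndrome 11 9 10 15 8 14 13 12 fun f m =>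
  if ¬ (f = 0 ∧ m = 0) then
    gates ([.cnot (d 12) (anc 1)] ++ czGates 12 [13, 14, 15]) .done
  else
  protectedCZ 12 13 14 15 .done .done

end Hamming15

open Hamming15

namespace Hamming15

open Matrix

set_option linter.unusedSectionVars false
set_option linter.constructorNameAsVariable false

/-! ## Pauli algebra -/

/-! Up to a scalar, a Pauli operator on `n` qubits is a vector of `F₂^{2n}`, its frame, and
conjugation by a Clifford operator is a symplectic map of frames. Both the statement about the
logical group and the statement about faults become linear algebra over `F₂` in this way.

The encoder. The rows of `checks` are orthogonal to themselves and to the rows of `logicals`, and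
the latter are orthonormal. Hence the encoder has the entry `1/4` exactly at the strings that
satisfy all checks and have the prescribed logical parities (`encoder_apply`). A Pauli operator that
commutes with the stabilizers therefore acts as the logical Pauli operator given by its parities
with `logicals` (`pauli_mul_encoder`).

The logical group. A Clifford operator with trivial action on frames is a Pauli operator up to a
phase (`mem_logicalGroup_of_acts_self`); phases come from scalar transversal gates and Pauli
operators from `X^{⊗15}` moved around by transvections. The symplectic group is generated by
transvections (`mem_logicalGroup_of_acts`), so it is enough to realize every transvection. The set
of frames whose transvection is realized is invariant under all realized maps, and it contains `u +
v` whenever it contains anticommuting `u` and `v`. The transversal phase gate times conjugates of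
the round-robin circuit is the transvection along `Z^{⊗7}` (`allOnes_mem_transvections`). The orbit
of that frame contains a single `Z` and a pair `ZZ`, hence all of these by permutation, and an
induction on the weight gives every nonzero frame (`mem_transvections_of_ne_zero`).

Fault tolerance. A correction rule exists as soon as any two possible errors with equal record and
equal syndrome differ by a stabilizer (`faultTolerant_of_errors`). For transversal gates and
permutations one fault leaves a one-qubit error, and the columns of `checks` are distinct and
nonzero. For the round-robin procedure the state is kept in the form "Pauli error times ideal
state". When Pauli gates are counted as errors, all measurements of the ideal state are
deterministic with outcome `0`, and every branch applies the same `CZ` gates in total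
(`det_roundRobinProc`). The outcomes are thus functions of the error alone, and an execution is
simulated by propagating a frame (`run_zero_sound`, `run_one_sound`). What remains is a finite list
of executions with one fault, and `consistent_results` checks it by evaluation. -/

/-- The `X` part and the `Z` part of a Pauli operator. -/
abbrev Frame (ι : Type) : Type := (ι → Bit) × (ι → Bit)

@[simp] theorem sgn_zero : sgn 0 = 1 := by simp [sgn]

@[simp] theorem sgn_one : sgn 1 = -1 := by simp [sgn]

theorem bit_cases (a : Bit) : a = 0 ∨ a = 1 := by revert a; decide

theorem sgn_add (a b : Bit) : sgn (a + b) = sgn a * sgn b := by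
  have h : (1 : Bit) + 1 = 0 := by decide
  rcases bit_cases a with rfl | rfl <;> rcases bit_cases b with rfl | rfl <;> simp [h]

@[simp] theorem sgn_mul_self (a : Bit) : sgn a * sgn a = 1 := by
  rcases bit_cases a with rfl | rfl <;> simp

@[simp] theorem sgn_ne_zero (a : Bit) : sgn a ≠ 0 := by
  rcases bit_cases a with rfl | rfl <;> simp

@[simp] theorem star_sgn (a : Bit) : star (sgn a) = sgn a := by
  rcases bit_cases a with rfl | rfl <;> simp

theorem sgn_injective : Function.Injective sgn := by
  intro a b h
  rcases bit_cases a with rfl | rfl <;> rcases bit_cases b with rfl | rfl <;>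
    first | rfl | (norm_num at h)

@[simp] theorem bit_add_self (a : Bit) : a + a = 0 := CharTwo.add_self_eq_zero a

@[simp] theorem bits_add_self {κ : Type} (a : κ → Bit) : a + a = 0 :=
  funext fun i => bit_add_self (a i)

@[simp] theorem bits_add_add_cancel {κ : Type} (a b : κ → Bit) : a + b + b = a := by
  rw [add_assoc, bits_add_self, add_zero]

@[simp] theorem frame_add_self {κ : Type} (v : Frame κ) : v + v = 0 :=
  Prod.ext (bits_add_self _) (bits_add_self _)

@[simp] theorem frame_add_add_cancel {κ : Type} (v w : Frame κ) : v + w + w = v := by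
  rw [add_assoc, frame_add_self, add_zero]

theorem bits_eq_add_iff {κ : Type} {x y a : κ → Bit} : x = y + a ↔ y = x + a := by
  constructor <;> rintro rfl <;> simp

theorem frame_eq_of_add_eq_zero {κ : Type} {v w : Frame κ} (h : v + w = 0) : v = w := by
  rw [← frame_add_add_cancel v w, h, zero_add]

section Pauli

variable {ι : Type} [Fintype ι] [DecidableEq ι] {κ : Type}

/-- The Pauli operator of a frame. -/
noncomputable def pauli (v : Frame ι) : Op ι ι := pauliOp v.1 v.2

theorem pauliOp_eq_pauli (a b : ι → Bit) : pauliOp a b = pauli (a, b) := rfl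

/-- The symplectic form, which tells whether two Pauli operators anticommute. -/
def symp (v w : Frame ι) : Bit := v.1 ⬝ᵥ w.2 + v.2 ⬝ᵥ w.1

theorem pauli_mul_apply {m : Type} (v : Frame ι) (M : Matrix (ι → Bit) m ℂ) (x : ι → Bit) (y : m) :
    (pauli v * M) x y = sgn (v.2 ⬝ᵥ (x + v.1)) * M (x + v.1) y := by
  rw [Matrix.mul_apply, Finset.sum_eq_single (x + v.1)]
  · simp [pauli, pauliOp]
  · intro z _ hz
    have : ¬ x = z + v.1 := fun h => hz (bits_eq_add_iff.1 h)
    simp [pauli, pauliOp, this]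
  · simp

theorem mul_pauli_apply {m : Type} (v : Frame ι) (M : Matrix m (ι → Bit) ℂ) (x : m) (y : ι → Bit) :
    (M * pauli v) x y = M x (y + v.1) * sgn (v.2 ⬝ᵥ y) := by
  rw [Matrix.mul_apply, Finset.sum_eq_single (y + v.1)]
  · simp [pauli, pauliOp]
  · intro z _ hz
    simp [pauli, pauliOp, hz]
  · simp

theorem pauli_apply (v : Frame ι) (x y : ι → Bit) :
    pauli v x y = if x = y + v.1 then sgn (v.2 ⬝ᵥ y) else 0 := rfl

@[simp] theorem pauli_zero : pauli (0 : Frame ι) = 1 := by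
  ext x y
  simp [pauli_apply, Matrix.one_apply]

theorem pauli_mul (v w : Frame ι) : pauli v * pauli w = sgn (v.2 ⬝ᵥ w.1) • pauli (v + w) := by
  ext x y
  rw [pauli_mul_apply, Matrix.smul_apply, pauli_apply, pauli_apply]
  have e : (x + v.1 = y + w.1) ↔ (x = y + (v + w).1) := by
    rw [Prod.fst_add, add_comm v.1, ← add_assoc]
    exact ⟨fun h => by rw [← h]; simp, fun h => by rw [h]; simp⟩
  by_cases h : x + v.1 = y + w.1
  · rw [if_pos h, if_pos (e.1 h), h]
    simp only [Prod.snd_add, dotProduct_add, add_dotProduct, sgn_add, smul_eq_mul]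
    ring
  · rw [if_neg h, if_neg (fun h' => h (e.2 h'))]
    simp

theorem symp_add_left (u v w : Frame ι) : symp (u + v) w = symp u w + symp v w := by
  simp only [symp, Prod.fst_add, Prod.snd_add, add_dotProduct]; ring

theorem symp_comm (v w : Frame ι) : symp v w = symp w v := by
  simp only [symp, dotProduct_comm v.1, dotProduct_comm v.2]; ring

theorem symp_add_right (u v w : Frame ι) : symp u (v + w) = symp u v + symp u w := by
  rw [symp_comm, symp_add_left, symp_comm v, symp_comm w]

@[simp] theorem symp_self (v : Frame ι) : symp v v = 0 := by
  simp [symp, dotProduct_comm v.1]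

@[simp] theorem symp_zero_left (v : Frame ι) : symp 0 v = 0 := by simp [symp]

theorem pauli_comm (v w : Frame ι) : pauli v * pauli w = sgn (symp v w) • (pauli w * pauli v) := by
  rw [pauli_mul, pauli_mul, smul_smul, add_comm w, symp, sgn_add, mul_assoc, mul_comm,
    dotProduct_comm v.1, mul_assoc, sgn_mul_self, mul_one]

theorem pauli_mul_self (v : Frame ι) : pauli v * pauli v = sgn (v.2 ⬝ᵥ v.1) • 1 := by
  rw [pauli_mul, frame_add_self, pauli_zero]

/-- The inverse of a Pauli operator. -/
theorem smul_pauli_mul_self (v : Frame ι) : (sgn (v.2 ⬝ᵥ v.1) • pauli v) * pauli v = 1 := by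
  rw [Matrix.smul_mul, pauli_mul_self, smul_smul, sgn_mul_self, one_smul]

theorem conjTranspose_pauli (v : Frame ι) : (pauli v)ᴴ = sgn (v.2 ⬝ᵥ v.1) • pauli v := by
  ext x y
  rw [conjTranspose_apply, Matrix.smul_apply, pauli_apply, pauli_apply]
  by_cases h : y = x + v.1
  · rw [if_pos h, if_pos (bits_eq_add_iff.1 h), h, star_sgn, dotProduct_add, sgn_add, smul_eq_mul,
      mul_comm (sgn (v.2 ⬝ᵥ x)), ← mul_assoc, sgn_mul_self, one_mul]
  · rw [if_neg h, if_neg (fun h' => h (bits_eq_add_iff.1 h'))]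
    simp

theorem pauli_mem_unitary (v : Frame ι) : pauli v ∈ Matrix.unitaryGroup (ι → Bit) ℂ := by
  rw [Matrix.mem_unitaryGroup_iff', star_eq_conjTranspose, conjTranspose_pauli]
  exact smul_pauli_mul_self v

/-- Column `0` of the matrix shows the `X` part and the scalar; the column of the `i`-th unit vector
shows the `i`-th bit of the `Z` part as a sign. This makes the frame of a conjugated Pauli operator
well defined. -/
theorem pauli_smul_injective {c c' : ℂ} {v w : Frame ι} (hc : c ≠ 0)
    (h : c • pauli v = c' • pauli w) : v = w ∧ c = c' := by
  have h1 : v.1 = w.1 := by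
    by_contra hne
    have := congrFun (congrFun h v.1) 0
    simp [pauli_apply, hne, hc] at this
  have h0 : c = c' := by
    have := congrFun (congrFun h v.1) 0
    simpa [pauli_apply, h1] using this
  refine ⟨Prod.ext h1 (funext fun i => ?_), h0⟩
  have := congrFun (congrFun h (Pi.single i 1 + v.1)) (Pi.single i 1)
  simp only [Matrix.smul_apply, pauli_apply, h1, if_true, smul_eq_mul, dotProduct_single,
    mul_one, ← h0] at this
  exact sgn_injective (mul_left_cancel₀ hc this)

theorem pauliAt_eq (q : ι) (a b : Bit) :
    pauliAt q a b = pauli (Pi.single q a, Pi.single q b) := rfl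

end Pauli

/-! ## The code space and the encoder -/

/-- `stabCoord *ᵥ x` are the coordinates of `x` along the stabilizers. -/
def stabCoord : Matrix (Fin 4) (Fin 15) Bit :=
  !![0,0,1,0,1,0,0,0,1,1,0,0,1,0,0;
     0,0,0,0,1,0,1,0,1,1,1,0,0,1,0;
     0,0,1,0,0,1,1,0,0,1,1,1,1,0,0;
     0,0,0,0,0,1,1,0,0,1,1,1,1,0,0]

/-- A right inverse of the transposed parity checks, orthogonal to the logical operators. -/
def destab : Matrix (Fin 4) (Fin 15) Bit :=
  !![0,1,0,1,0,0,0,1,0,1,0,0,1,1,1;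
     1,1,0,0,0,1,1,1,1,1,0,1,0,1,1;
     0,1,0,1,1,1,1,1,1,1,1,1,1,1,1;
     0,0,0,1,1,0,0,0,0,1,1,0,0,1,1]

/-- The supports have odd size and overlap evenly. This is why the same supports serve for `X` and
`Z`, and why transversal gates act on every logical qubit alike. -/
theorem logicals_mul_transpose : logicals * logicalsᵀ = 1 := by decide +kernel

theorem checks_mul_logicals : checks * logicalsᵀ = 0 := by decide +kernel

theorem logicals_mul_checks : logicals * checksᵀ = 0 := by decide +kernel

theorem checks_mul_transpose : checks * checksᵀ = 0 := by decide +kernel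

theorem destab_mul_logicals : destab * logicalsᵀ = 0 := by decide +kernel

theorem destab_mul_checks : destab * checksᵀ = 1 := by decide +kernel

/-- The `7 + 4 + 4` rows of `logicals`, `checks` and `destab` form a basis of `F₂^15`. The three
summands are the projections to the logical part, the stabilizer part and the part that carries the
syndrome. -/
theorem bits_decomposition :
    logicalsᵀ * logicals + checksᵀ * stabCoord + destabᵀ * checks = 1 := by decide +kernel

@[simp] theorem logicals_mulVec_vecMul (y : Fin 7 → Bit) : logicals *ᵥ (y ᵥ* logicals) = y := by
  rw [← mulVec_transpose, mulVec_mulVec, logicals_mul_transpose, one_mulVec]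

@[simp] theorem logicals_mulVec_checks (c : Fin 4 → Bit) : logicals *ᵥ (c ᵥ* checks) = 0 := by
  rw [← mulVec_transpose, mulVec_mulVec, logicals_mul_checks, zero_mulVec]

@[simp] theorem checks_mulVec_vecMul (y : Fin 7 → Bit) : checks *ᵥ (y ᵥ* logicals) = 0 := by
  rw [← mulVec_transpose, mulVec_mulVec, checks_mul_logicals, zero_mulVec]

@[simp] theorem checks_mulVec_checks (c : Fin 4 → Bit) : checks *ᵥ (c ᵥ* checks) = 0 := by
  rw [← mulVec_transpose, mulVec_mulVec, checks_mul_transpose, zero_mulVec]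

theorem destab_mulVec (y : Fin 7 → Bit) (c : Fin 4 → Bit) :
    destab *ᵥ (y ᵥ* logicals + c ᵥ* checks) = c := by
  rw [mulVec_add, ← mulVec_transpose, ← mulVec_transpose, mulVec_mulVec, mulVec_mulVec,
    destab_mul_logicals, destab_mul_checks, zero_mulVec, one_mulVec, zero_add]

/-- A codeword is determined by its logical part up to stabilizers. -/
theorem eq_of_checks_mulVec_eq_zero {x : Fin 15 → Bit} (hx : checks *ᵥ x = 0) :
    x = (logicals *ᵥ x) ᵥ* logicals + (stabCoord *ᵥ x) ᵥ* checks := by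
  conv_lhs => rw [← one_mulVec x, ← bits_decomposition]
  rw [add_mulVec, add_mulVec, ← mulVec_mulVec, ← mulVec_mulVec, ← mulVec_mulVec, hx, mulVec_zero,
    add_zero, mulVec_transpose, mulVec_transpose]

/-- Trades the existential quantifier in the encoder for linear equations, which behave well under
translation by the `X` part of a Pauli operator. -/
theorem exists_stab_iff {x : Fin 15 → Bit} {y : Fin 7 → Bit} :
    (∃ c : Fin 4 → Bit, x = y ᵥ* logicals + c ᵥ* checks) ↔
      checks *ᵥ x = 0 ∧ logicals *ᵥ x = y := by
  constructor
  · rintro ⟨c, rfl⟩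
    simp [mulVec_add]
  · rintro ⟨hx, rfl⟩
    exact ⟨_, eq_of_checks_mulVec_eq_zero hx⟩

theorem encoder_apply (x : Fin 15 → Bit) (y : Fin 7 → Bit) :
    encoder x y = if checks *ᵥ x = 0 ∧ logicals *ᵥ x = y then 1 / 4 else 0 := by
  simp only [encoder, of_apply, exists_stab_iff]

theorem dotProduct_of_mem {b x : Fin 15 → Bit} (hb : checks *ᵥ b = 0) (hx : checks *ᵥ x = 0) :
    b ⬝ᵥ x = (logicals *ᵥ b) ⬝ᵥ (logicals *ᵥ x) := by
  conv_lhs => rw [eq_of_checks_mulVec_eq_zero hb]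
  rw [add_dotProduct, ← dotProduct_mulVec, ← dotProduct_mulVec, hx, dotProduct_zero, add_zero]

/-- The `X` part translates codewords, which changes only their logical parities. The `Z` part
contributes a sign that on codewords depends only on these parities, by `dotProduct_of_mem`. -/
theorem pauli_mul_encoder {v : Frame (Fin 15)} (h1 : checks *ᵥ v.1 = 0) (h2 : checks *ᵥ v.2 = 0) :
    pauli v * encoder = encoder * pauli (logicals *ᵥ v.1, logicals *ᵥ v.2) := by
  ext x y
  rw [pauli_mul_apply, mul_pauli_apply, encoder_apply, encoder_apply, mulVec_add, mulVec_add, h1,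
    add_zero]
  by_cases hx : checks *ᵥ x = 0
  · by_cases hy : logicals *ᵥ x + logicals *ᵥ v.1 = y
    · have hy' : logicals *ᵥ x = y + logicals *ᵥ v.1 := by rw [← hy]; simp
      have hd : v.2 ⬝ᵥ (x + v.1) = (logicals *ᵥ v.2) ⬝ᵥ y := by
        rw [dotProduct_of_mem h2 (by rw [mulVec_add, hx, h1, add_zero]), mulVec_add, hy]
      rw [if_pos ⟨hx, hy⟩, if_pos ⟨hx, hy'⟩, hd, mul_comm]
    · have hy' : ¬ logicals *ᵥ x = y + logicals *ᵥ v.1 := fun h => hy (by rw [h]; simp)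
      rw [if_neg (fun h => hy h.2), if_neg (fun h => hy' h.2), mul_zero, zero_mul]
  · rw [if_neg (fun h => hx h.1), if_neg (fun h => hx h.1), mul_zero, zero_mul]

theorem pauli_vecMul_mul_encoder (v : Frame (Fin 7)) :
    pauli (v.1 ᵥ* logicals, v.2 ᵥ* logicals) * encoder = encoder * pauli v := by
  rw [pauli_mul_encoder (by simp) (by simp)]
  simp

theorem pauli_stab_mul_encoder (c c' : Fin 4 → Bit) :
    pauli (c ᵥ* checks, c' ᵥ* checks) * encoder = encoder := by
  rw [pauli_mul_encoder (by simp) (by simp)]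
  simp only [logicals_mulVec_checks]
  exact (congrArg (encoder * ·) pauli_zero).trans (Matrix.mul_one _)

/-- Different columns are supported on disjoint cosets of the row space of `checks`. Each coset has
16 elements, distinguished by `destab`, and each entry is `1/4`. -/
theorem encoder_isometry : encoderᴴ * encoder = 1 := by
  ext y y'
  rw [Matrix.mul_apply, Matrix.one_apply]
  simp only [conjTranspose_apply, encoder_apply]
  by_cases h : y = y'
  · subst h
    rw [if_pos rfl]
    have hcard : (Finset.univ.filter fun x : Fin 15 → Bit =>
        checks *ᵥ x = 0 ∧ logicals *ᵥ x = y).card = 16 := by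
      have himg : (Finset.univ.filter fun x : Fin 15 → Bit =>
          checks *ᵥ x = 0 ∧ logicals *ᵥ x = y) =
          Finset.univ.image fun c : Fin 4 → Bit => y ᵥ* logicals + c ᵥ* checks := by
        ext x
        rw [Finset.mem_filter, ← exists_stab_iff]
        simp [eq_comm]
      rw [himg, Finset.card_image_of_injective]
      · simp
      · intro c c' hcc
        have := congrArg (destab *ᵥ ·) hcc
        simpa only [destab_mulVec] using this
    have : ∀ x : Fin 15 → Bit,
        star (if checks *ᵥ x = 0 ∧ logicals *ᵥ x = y then (1 / 4 : ℂ) else 0) *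
          (if checks *ᵥ x = 0 ∧ logicals *ᵥ x = y then (1 / 4 : ℂ) else 0) =
        if checks *ᵥ x = 0 ∧ logicals *ᵥ x = y then (1 / 16 : ℂ) else 0 := by
      intro x
      split_ifs <;> norm_num
    simp only [this]
    rw [← Finset.sum_filter, Finset.sum_const, hcard]
    norm_num
  · rw [if_neg h]
    refine Finset.sum_eq_zero fun x _ => ?_
    by_cases hx : checks *ᵥ x = 0 ∧ logicals *ᵥ x = y
    · rw [if_neg (c := checks *ᵥ x = 0 ∧ logicals *ᵥ x = y') (fun h' => h (hx.2.symm.trans h'.2)),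
        mul_zero]
    · rw [if_neg hx, star_zero, zero_mul]

theorem encoder_mul_left_cancel {κ : Type} {M N : Matrix (Fin 7 → Bit) κ ℂ}
    (h : encoder * M = encoder * N) : M = N := by
  have := congrArg (encoderᴴ * ·) h
  simpa only [← Matrix.mul_assoc, encoder_isometry, Matrix.one_mul] using this

theorem pauli_mulVec_apply (v : Frame (Fin 15)) (ψ : (Fin 15 → Bit) → ℂ) (x : Fin 15 → Bit) :
    (pauli v *ᵥ ψ) x = sgn (v.2 ⬝ᵥ (x + v.1)) * ψ (x + v.1) :=
  pauli_mul_apply v (Matrix.of fun x (_ : Unit) => ψ x) x ()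

/-- The `X` stabilizers make `ψ` constant on cosets of the row space of `checks`; the `Z`
stabilizers make it vanish where a check fails. So `ψ` is determined by its values at the
combinations of the logical rows. -/
theorem mem_codeSpace_iff {ψ : (Fin 15 → Bit) → ℂ} :
    ψ ∈ codeSpace ↔ ∃ φ, ψ = encoder *ᵥ φ := by
  constructor
  · intro h
    have hX : ∀ (c : Fin 4 → Bit) x, ψ (x + c ᵥ* checks) = ψ x := by
      intro c
      have key : ∀ s : Finset (Fin 4), ∀ x, ψ (x + ∑ i ∈ s, c i • checks i) = ψ x := by
        intro s
        induction s using Finset.induction_on with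
        | empty => simp
        | insert i s hi ih =>
          intro x
          rw [Finset.sum_insert hi, add_comm (c i • checks i), ← add_assoc, ← ih x]
          rcases bit_cases (c i) with h0 | h0
          · simp [h0]
          · have := congrFun (h i).1 (x + ∑ i ∈ s, c i • checks i)
            rw [stabX, pauliOp_eq_pauli, pauli_mulVec_apply] at this
            simpa [h0] using this
      intro x
      rw [vecMul_eq_sum]
      exact key _ x
    have hZ : ∀ x, checks *ᵥ x ≠ 0 → ψ x = 0 := by
      intro x hx
      obtain ⟨i, hi⟩ := Function.ne_iff.1 hx
      have := congrFun (h i).2 x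
      rw [stabZ, pauliOp_eq_pauli, pauli_mulVec_apply] at this
      have hi' : checks i ⬝ᵥ x = 1 := (bit_cases _).resolve_left hi
      simp only [add_zero, hi', sgn_one] at this
      have h2 : (2 : ℂ) * ψ x = 0 := by linear_combination -this
      simpa using h2
    -- The factor 4 cancels the normalization `1/4` of the encoder.
    refine ⟨fun y => 4 * ψ (y ᵥ* logicals), funext fun x => ?_⟩
    rw [mulVec, dotProduct]
    simp only [encoder_apply]
    by_cases hx : checks *ᵥ x = 0
    · rw [Finset.sum_eq_single (logicals *ᵥ x)]
      · rw [if_pos ⟨hx, rfl⟩]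
        conv_lhs => rw [eq_of_checks_mulVec_eq_zero hx, hX]
        ring
      · intro y _ hy
        rw [if_neg (fun h' => hy h'.2.symm), zero_mul]
      · simp
    · rw [hZ x hx, Finset.sum_eq_zero]
      intro y _
      rw [if_neg (fun h' => hx h'.1), zero_mul]
  · rintro ⟨φ, rfl⟩ i
    have hX := pauli_stab_mul_encoder (Pi.single i 1) 0
    have hZ := pauli_stab_mul_encoder 0 (Pi.single i 1)
    rw [single_one_vecMul, zero_vecMul] at hX hZ
    rw [stabX, stabZ, pauliOp_eq_pauli, pauliOp_eq_pauli, mulVec_mulVec, mulVec_mulVec]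
    exact ⟨congrArg (· *ᵥ φ) hX, congrArg (· *ᵥ φ) hZ⟩

theorem isEncoder_encoder : IsEncoder encoder := by
  refine ⟨encoder_isometry, fun v => mem_codeSpace_iff, fun j => ?_⟩
  have hX := pauli_vecMul_mul_encoder (Pi.single j 1, 0)
  have hZ := pauli_vecMul_mul_encoder (0, Pi.single j 1)
  simp only [single_one_vecMul, zero_vecMul] at hX hZ
  rw [pauliOp_eq_pauli, pauliOp_eq_pauli, pauliAt_eq, pauliAt_eq, Pi.single_zero]
  exact ⟨hX, hZ⟩

/-! ## Clifford operators and their action on Pauli operators -/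

section Acts

variable {ι : Type} [Fintype ι] [DecidableEq ι]

/-- Conjugation by `L` takes the Pauli operator of `v` to that of `w`, up to a scalar. -/
def Acts (L : Op ι ι) (v w : Frame ι) : Prop := ∃ c : ℂ, L * pauli v = c • (pauli w * L)

theorem unitary_mul_star (U : Matrix.unitaryGroup (ι → Bit) ℂ) :
    (U : Op ι ι) * (U⁻¹ : Matrix.unitaryGroup (ι → Bit) ℂ) = 1 := by
  rw [← Matrix.UnitaryGroup.mul_val, mul_inv_cancel, Matrix.UnitaryGroup.one_val]

theorem unitary_star_mul (U : Matrix.unitaryGroup (ι → Bit) ℂ) :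
    ((U⁻¹ : Matrix.unitaryGroup (ι → Bit) ℂ) : Op ι ι) * (U : Op ι ι) = 1 := by
  rw [← Matrix.UnitaryGroup.mul_val, inv_mul_cancel, Matrix.UnitaryGroup.one_val]

/-- Conjugation form of an equation `U M = c N U`. -/
theorem unitary_conj_eq {U : Matrix.unitaryGroup (ι → Bit) ℂ} {M N : Op ι ι} {c : ℂ}
    (h : (U : Op ι ι) * M = c • (N * (U : Op ι ι))) :
    (U : Op ι ι) * M * (U⁻¹ : Matrix.unitaryGroup (ι → Bit) ℂ) = c • N := by
  rw [h, Matrix.smul_mul, Matrix.mul_assoc, unitary_mul_star, Matrix.mul_one]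

theorem unitary_mul_eq {U : Matrix.unitaryGroup (ι → Bit) ℂ} {M N : Op ι ι} {c : ℂ}
    (h : (U : Op ι ι) * M * (U⁻¹ : Matrix.unitaryGroup (ι → Bit) ℂ) = c • N) :
    (U : Op ι ι) * M = c • (N * (U : Op ι ι)) := by
  rw [← Matrix.smul_mul, ← h, Matrix.mul_assoc _ _ (U : Op ι ι), unitary_star_mul, Matrix.mul_one]

theorem pauli_pow_four (v : Frame ι) : pauli v * pauli v * (pauli v * pauli v) = 1 := by
  rw [pauli_mul_self, Matrix.smul_mul, Matrix.mul_smul, smul_smul, sgn_mul_self, one_smul,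
    Matrix.one_mul]

theorem mul_pauli_mul_pauli {L : Op ι ι} {v w v' w' : Frame ι} {c c' : ℂ}
    (h : L * pauli v = c • (pauli w * L)) (h' : L * pauli v' = c' • (pauli w' * L)) :
    L * (pauli v * pauli v') = (c * c') • (pauli w * pauli w' * L) := by
  rw [← Matrix.mul_assoc, h, Matrix.smul_mul, Matrix.mul_assoc, h', Matrix.mul_smul, smul_smul,
    Matrix.mul_assoc]

/-- The fourth power of every Pauli operator is the identity, so the fourth power of the relation
forces `c ^ 4 = 1`. In particular conjugation stays inside the Pauli group, whose phases are exactly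
these. -/
theorem scalar_pow_four {U : Matrix.unitaryGroup (ι → Bit) ℂ} {v w : Frame ι} {c : ℂ}
    (h : (U : Op ι ι) * pauli v = c • (pauli w * (U : Op ι ι))) : c ^ 4 = 1 := by
  have h2 := mul_pauli_mul_pauli h h
  have h4 : (U : Op ι ι) * (pauli v * pauli v * (pauli v * pauli v)) =
      (c ^ 4) • (pauli w * pauli w * (pauli w * pauli w) * (U : Op ι ι)) := by
    rw [← Matrix.mul_assoc, h2, Matrix.smul_mul, Matrix.mul_assoc, h2, Matrix.mul_smul, smul_smul,
      ← Matrix.mul_assoc (pauli w * pauli w)]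
    congr 1
    ring
  rw [pauli_pow_four, pauli_pow_four, Matrix.one_mul, Matrix.mul_one] at h4
  have h5 := congrArg (· * ((U⁻¹ : Matrix.unitaryGroup (ι → Bit) ℂ) : Op ι ι)) h4
  simp only [Matrix.smul_mul, unitary_mul_star] at h5
  have := congrFun (congrFun h5 0) 0
  simpa using this.symm

theorem acts_one (v : Frame ι) : Acts (1 : Op ι ι) v v := ⟨1, by simp⟩

theorem Acts.mul {A B : Op ι ι} {u v w : Frame ι} (hB : Acts B v w) (hA : Acts A u v) :
    Acts (B * A) u w := by
  obtain ⟨c, hc⟩ := hA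
  obtain ⟨c', hc'⟩ := hB
  exact ⟨c * c', by rw [Matrix.mul_assoc, hc, Matrix.mul_smul, ← Matrix.mul_assoc, hc',
    Matrix.smul_mul, smul_smul, Matrix.mul_assoc]⟩

theorem Acts.add {L : Op ι ι} {v w v' w' : Frame ι} (h : Acts L v w) (h' : Acts L v' w') :
    Acts L (v + v') (w + w') := by
  obtain ⟨c, hc⟩ := h
  obtain ⟨c', hc'⟩ := h'
  have e := mul_pauli_mul_pauli hc hc'
  rw [pauli_mul, pauli_mul, Matrix.mul_smul, Matrix.smul_mul] at e
  refine ⟨sgn (v.2 ⬝ᵥ v'.1) * (c * c') * sgn (w.2 ⬝ᵥ w'.1), ?_⟩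
  have := congrArg (sgn (v.2 ⬝ᵥ v'.1) • ·) e
  simp only [smul_smul, sgn_mul_self, one_smul] at this
  rw [this]
  congr 1
  ring

theorem Acts.scalar_ne_zero {L : Matrix.unitaryGroup (ι → Bit) ℂ} {v w : Frame ι} {c : ℂ}
    (h : (L : Op ι ι) * pauli v = c • (pauli w * (L : Op ι ι))) : c ≠ 0 := by
  rintro rfl
  simpa using scalar_pow_four h

theorem Acts.unique {L : Matrix.unitaryGroup (ι → Bit) ℂ} {v w w' : Frame ι}
    (h : Acts (L : Op ι ι) v w) (h' : Acts (L : Op ι ι) v w') : w = w' := by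
  obtain ⟨c, hc⟩ := h
  obtain ⟨c', hc'⟩ := h'
  refine (pauli_smul_injective (c' := c') (Acts.scalar_ne_zero hc) ?_).1
  rw [← unitary_conj_eq hc, ← unitary_conj_eq hc']

theorem Acts.inv {L : Matrix.unitaryGroup (ι → Bit) ℂ} {v w : Frame ι}
    (h : Acts (L : Op ι ι) v w) : Acts ((L⁻¹ : Matrix.unitaryGroup (ι → Bit) ℂ) : Op ι ι) w v := by
  obtain ⟨c, hc⟩ := h
  refine ⟨c⁻¹, ?_⟩
  have h1 := unitary_conj_eq hc
  have h2 : pauli w = c⁻¹ • ((L : Op ι ι) * pauli v *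
      (L⁻¹ : Matrix.unitaryGroup (ι → Bit) ℂ)) := by
    rw [h1, smul_smul, inv_mul_cancel₀ (Acts.scalar_ne_zero hc), one_smul]
  rw [h2, Matrix.mul_smul, ← Matrix.mul_assoc, ← Matrix.mul_assoc, unitary_star_mul,
    Matrix.one_mul]

/-- Conjugation preserves whether two operators commute: the images of the two products in either
order carry the same scalar `c * c'`, so the commutation signs agree. -/
theorem Acts.symp_eq {L : Matrix.unitaryGroup (ι → Bit) ℂ} {v w v' w' : Frame ι}
    (h : Acts (L : Op ι ι) v w) (h' : Acts (L : Op ι ι) v' w') : symp w w' = symp v v' := by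
  obtain ⟨c, hc⟩ := h
  obtain ⟨c', hc'⟩ := h'
  have e1 := mul_pauli_mul_pauli hc hc'
  have e2 := mul_pauli_mul_pauli hc' hc
  rw [pauli_comm, Matrix.mul_smul, e2, pauli_comm w] at e1
  have e3 := congrArg (· * ((L⁻¹ : Matrix.unitaryGroup (ι → Bit) ℂ) : Op ι ι)) e1
  simp only [Matrix.smul_mul, Matrix.mul_assoc, unitary_mul_star, Matrix.mul_one] at e3
  rw [pauli_mul] at e3
  simp only [smul_smul] at e3
  have hne : c * c' ≠ 0 := mul_ne_zero (Acts.scalar_ne_zero hc) (Acts.scalar_ne_zero hc')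
  have e4 := (pauli_smul_injective (by
    simp [Acts.scalar_ne_zero hc, Acts.scalar_ne_zero hc']) e3).2
  generalize symp v v' = s at e4 ⊢
  generalize symp w w' = t at e4 ⊢
  generalize w'.2 ⬝ᵥ w.1 = r at e4
  refine (sgn_injective (mul_right_cancel₀ (mul_ne_zero hne (sgn_ne_zero r)) ?_)).symm
  linear_combination e4

theorem mem_pauliGroup_iff {U : Matrix.unitaryGroup (ι → Bit) ℂ} :
    U ∈ pauliGroup ι ↔ ∃ (c : ℂ) (v : Frame ι), c ^ 4 = 1 ∧ (U : Op ι ι) = c • pauli v := by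
  constructor
  · intro h
    induction h using Subgroup.closure_induction with
    | mem U hU =>
      obtain ⟨c, a, b, hc, h⟩ := hU
      exact ⟨c, (a, b), hc, h⟩
    | one => exact ⟨1, 0, by simp, by simp⟩
    | mul U V _ _ hU hV =>
      obtain ⟨c, v, hc, h⟩ := hU
      obtain ⟨c', v', hc', h'⟩ := hV
      have hs (a : Bit) : sgn a ^ 4 = 1 := by rcases bit_cases a with rfl | rfl <;> norm_num
      refine ⟨c * c' * sgn (v.2 ⬝ᵥ v'.1), v + v', by rw [mul_pow, mul_pow, hc, hc', hs]; simp, ?_⟩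
      rw [Matrix.UnitaryGroup.mul_val, h, h', Matrix.smul_mul, Matrix.mul_smul, pauli_mul,
        smul_smul, smul_smul, mul_assoc]
    | inv U _ hU =>
      obtain ⟨c, v, hc, h⟩ := hU
      have hs (a : Bit) : sgn a ^ 4 = 1 := by rcases bit_cases a with rfl | rfl <;> norm_num
      refine ⟨star c * sgn (v.2 ⬝ᵥ v.1), v, by
        rw [mul_pow, ← star_pow, hc, hs]; simp, ?_⟩
      rw [Matrix.UnitaryGroup.inv_val, h, star_eq_conjTranspose, conjTranspose_smul,
        conjTranspose_pauli, smul_smul]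
  · rintro ⟨c, v, hc, h⟩
    exact Subgroup.subset_closure ⟨c, v.1, v.2, hc, h⟩

/-- For a finite subgroup, conjugating it into itself already means normalizing it, so
`mem_cliffordGroup_iff` needs only one inclusion. -/
instance finite_pauliGroup :
    Finite (pauliGroup ι : Set (Matrix.unitaryGroup (ι → Bit) ℂ)) := by
  have hfin : (Set.image2 (fun (c : ℂ) (v : Frame ι) => c • pauli v) {c | c ^ 4 = 1}
      Set.univ).Finite := by
    refine Set.Finite.image2 _ ?_ Set.finite_univ
    refine ((Polynomial.nthRootsFinset 4 (1 : ℂ)).finite_toSet).subset fun c hc => ?_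
    simpa [Polynomial.mem_nthRootsFinset] using hc
  refine Set.Finite.to_subtype (Set.Finite.of_finite_image (f := Subtype.val) ?_
    Subtype.val_injective.injOn)
  refine hfin.subset ?_
  rintro _ ⟨U, hU, rfl⟩
  obtain ⟨c, v, hc, h⟩ := mem_pauliGroup_iff.1 hU
  exact ⟨c, hc, v, Set.mem_univ _, h.symm⟩

theorem mem_cliffordGroup_iff {L : Matrix.unitaryGroup (ι → Bit) ℂ} :
    L ∈ cliffordGroup ι ↔ ∀ v, ∃ w, Acts (L : Op ι ι) v w := by
  constructor
  · intro h v
    have hv : (⟨pauli v, pauli_mem_unitary v⟩ : Matrix.unitaryGroup (ι → Bit) ℂ) ∈ pauliGroup ι :=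
      mem_pauliGroup_iff.2 ⟨1, v, by simp, by simp⟩
    obtain ⟨c, w, -, hw⟩ := mem_pauliGroup_iff.1 ((Subgroup.mem_normalizer_iff.1 h _).1 hv)
    exact ⟨w, c, unitary_mul_eq hw⟩
  · intro h
    refine Subgroup.mem_normalizer_fintype fun U hU => ?_
    obtain ⟨c, v, hc, hv⟩ := mem_pauliGroup_iff.1 hU
    obtain ⟨w, c', hw⟩ := h v
    refine mem_pauliGroup_iff.2 ⟨c * c', w, by rw [mul_pow, hc, scalar_pow_four hw, one_mul], ?_⟩
    rw [Matrix.UnitaryGroup.mul_val, Matrix.UnitaryGroup.mul_val, hv, Matrix.mul_smul,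
      Matrix.smul_mul, unitary_conj_eq hw, smul_smul]

end Acts

/-! ## Logical operators of physical operators -/

/-- A stabilizer moved through `U` becomes an operator that fixes encoded states, so `U` maps the
code space into itself. The logical operator is read off column by column and is unitary because the
encoder is an isometry. -/
theorem exists_logical (U : Matrix.unitaryGroup (Fin 15 → Bit) ℂ)
    (h : ∀ i, (∃ W : Op (Fin 15) (Fin 15),
        stabX i * (U : Op (Fin 15) (Fin 15)) = (U : Op (Fin 15) (Fin 15)) * W ∧
          W * encoder = encoder) ∧
      ∃ W : Op (Fin 15) (Fin 15),
        stabZ i * (U : Op (Fin 15) (Fin 15)) = (U : Op (Fin 15) (Fin 15)) * W ∧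
          W * encoder = encoder) :
    ∃ L : Matrix.unitaryGroup (Fin 7 → Bit) ℂ,
      (U : Op (Fin 15) (Fin 15)) * encoder = encoder * (L : Op (Fin 7) (Fin 7)) := by
  have hcol : ∀ y, ∃ φ, (fun x => ((U : Op (Fin 15) (Fin 15)) * encoder) x y) = encoder *ᵥ φ := by
    intro y
    rw [← mem_codeSpace_iff]
    have e : (fun x => ((U : Op (Fin 15) (Fin 15)) * encoder) x y) =
        ((U : Op (Fin 15) (Fin 15)) * encoder) *ᵥ Pi.single y 1 := by
      funext x; simp
    intro i
    obtain ⟨⟨W, hW, hWE⟩, W', hW', hWE'⟩ := h i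
    rw [e, mulVec_mulVec, mulVec_mulVec, ← Matrix.mul_assoc, ← Matrix.mul_assoc, hW, hW',
      Matrix.mul_assoc, hWE, Matrix.mul_assoc, hWE']
    exact ⟨rfl, rfl⟩
  choose φ hφ using hcol
  let M : Op (Fin 7) (Fin 7) := Matrix.of fun x y => φ y x
  have hM : (U : Op (Fin 15) (Fin 15)) * encoder = encoder * M := by
    ext x y
    exact congrFun (hφ y) x
  refine ⟨⟨M, ?_⟩, hM⟩
  rw [Matrix.mem_unitaryGroup_iff', star_eq_conjTranspose]
  have h1 : (encoder * M)ᴴ * (encoder * M) = Mᴴ * M := by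
    rw [conjTranspose_mul, Matrix.mul_assoc, ← Matrix.mul_assoc encoderᴴ, encoder_isometry,
      Matrix.one_mul]
  rw [← h1, ← hM, conjTranspose_mul, Matrix.mul_assoc, ← Matrix.mul_assoc _ (U : Op (Fin 15) (Fin 15)),
    ← star_eq_conjTranspose (U : Op (Fin 15) (Fin 15)), Matrix.UnitaryGroup.star_mul_self,
    Matrix.one_mul, encoder_isometry]

/-- The relation for `U` is transported through the encoder, which can then be cancelled on the
left. The two parity conditions say that the image of a logical Pauli operator is again one. -/
theorem acts_logical {U : Op (Fin 15) (Fin 15)} {L : Op (Fin 7) (Fin 7)}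
    (hL : U * encoder = encoder * L) {v : Frame (Fin 7)} {w : Frame (Fin 15)}
    (h : Acts U (v.1 ᵥ* logicals, v.2 ᵥ* logicals) w)
    (h1 : checks *ᵥ w.1 = 0) (h2 : checks *ᵥ w.2 = 0) :
    Acts L v (logicals *ᵥ w.1, logicals *ᵥ w.2) := by
  obtain ⟨c, hc⟩ := h
  refine ⟨c, encoder_mul_left_cancel ?_⟩
  rw [← Matrix.mul_assoc, ← hL, Matrix.mul_assoc, ← pauli_vecMul_mul_encoder, ← Matrix.mul_assoc,
    hc, Matrix.smul_mul, Matrix.mul_assoc, hL, ← Matrix.mul_assoc, pauli_mul_encoder h1 h2,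
    Matrix.mul_smul, Matrix.mul_assoc]

/-! ## Transversal operators -/

section Transversal

variable {ι : Type} [Fintype ι] [DecidableEq ι]

theorem sgn_sum {κ : Type} (s : Finset κ) (f : κ → Bit) :
    sgn (∑ i ∈ s, f i) = ∏ i ∈ s, sgn (f i) := by
  classical
  induction s using Finset.induction_on with
  | empty => simp
  | insert i s hi ih => rw [Finset.sum_insert hi, Finset.prod_insert hi, sgn_add, ih]

theorem transversalOp_mul_pauli {u : Op (Fin 1) (Fin 1)} {v w : Frame ι} {c : ι → ℂ}
    (h : ∀ i, u * pauli (fun _ => v.1 i, fun _ => v.2 i) =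
      c i • (pauli (fun _ => w.1 i, fun _ => w.2 i) * u)) :
    transversalOp u * pauli v = (∏ i, c i) • (pauli w * transversalOp u) := by
  ext x y
  rw [mul_pauli_apply, Matrix.smul_apply, pauli_mul_apply]
  simp only [transversalOp, of_apply, dotProduct, sgn_sum, smul_eq_mul]
  rw [← Finset.prod_mul_distrib, ← Finset.prod_mul_distrib, ← Finset.prod_mul_distrib]
  refine Finset.prod_congr rfl fun i _ => ?_
  have := congrFun (congrFun (h i) fun _ => x i) fun _ => y i
  rw [mul_pauli_apply, Matrix.smul_apply, pauli_mul_apply] at this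
  simpa [dotProduct, Pi.add_def] using this

theorem transversalOp_mul (u u' : Op (Fin 1) (Fin 1)) :
    (transversalOp (u * u') : Op ι ι) = transversalOp u * transversalOp u' := by
  ext x y
  simp only [transversalOp, of_apply, Matrix.mul_apply, ← Finset.prod_mul_distrib]
  have hs : ∀ f : (Fin 1 → Bit) → ℂ, ∑ z, f z = ∑ b : Bit, f fun _ => b := fun f =>
    Fintype.sum_equiv (Equiv.funUnique (Fin 1) Bit) _ _ fun z => by
      congr 1; funext i; rw [Subsingleton.elim i 0]; rfl
  simp only [hs]
  rw [Finset.prod_univ_sum, Fintype.piFinset_univ]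

theorem transversalOp_smul_one (z : ℂ) :
    (transversalOp (z • (1 : Op (Fin 1) (Fin 1))) : Op ι ι) = z ^ Fintype.card ι • 1 := by
  ext x y
  simp only [transversalOp, of_apply, Matrix.smul_apply, Matrix.one_apply, smul_eq_mul]
  by_cases h : x = y
  · subst h
    simp
  · obtain ⟨i, hi⟩ := Function.ne_iff.1 h
    rw [if_neg h, mul_zero]
    refine Finset.prod_eq_zero (Finset.mem_univ i) ?_
    rw [if_neg fun h' => hi (congrFun h' 0), mul_zero]

theorem transversalOp_one : (transversalOp (1 : Op (Fin 1) (Fin 1)) : Op ι ι) = 1 := by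
  have := transversalOp_smul_one (ι := ι) 1
  simpa using this

/-- The Pauli operator of the one-qubit frame `v` on all qubits of the support of `s`. -/
def spread (s : ι → Bit) (v : Frame (Fin 1)) : Frame ι :=
  (fun i => s i * v.1 0, fun i => s i * v.2 0)

/-- Each qubit of the support contributes the scalar `c` once. For stabilizers the weight matters,
because there the total scalar must be `1`. -/
theorem transversalOp_mul_spread {u : Op (Fin 1) (Fin 1)} {v w : Frame (Fin 1)} {c : ℂ}
    (h : u * pauli v = c • (pauli w * u)) (s : ι → Bit) :
    transversalOp u * pauli (spread s v) =
      c ^ (Finset.univ.filter fun i => s i = 1).card •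
        (pauli (spread s w) * transversalOp u) := by
  have hv : ∀ v : Frame (Fin 1), ((fun _ => v.1 0, fun _ => v.2 0) : Frame (Fin 1)) = v := by
    intro v
    refine Prod.ext (funext fun i => ?_) (funext fun i => ?_) <;>
      · rw [Subsingleton.elim i 0]
  have := transversalOp_mul_pauli (u := u) (v := spread s v) (w := spread s w)
    (c := fun i => if s i = 1 then c else 1) (by
      intro i
      rcases bit_cases (s i) with h0 | h0
      · simp only [spread, h0, zero_mul]
        have hz : pauli ((fun _ => 0, fun _ => 0) : Frame (Fin 1)) = 1 := pauli_zero
        simp [hz]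
      · simp only [spread, h0, one_mul, if_true, hv, h])
  rw [this, Finset.prod_ite]
  simp

end Transversal

/-! ## Logical actions of the generators -/

theorem pauli_mul_encoder_of_stab {w : Frame (Fin 15)}
    (h1 : checks *ᵥ w.1 = 0 ∧ logicals *ᵥ w.1 = 0) (h2 : checks *ᵥ w.2 = 0 ∧ logicals *ᵥ w.2 = 0) :
    pauli w * encoder = encoder := by
  rw [pauli_mul_encoder h1.1 h2.1, h1.2, h2.2]
  exact (congrArg (encoder * ·) pauli_zero).trans (Matrix.mul_one _)

theorem checks_row (i : Fin 4) : checks *ᵥ checks i = 0 ∧ logicals *ᵥ checks i = 0 := by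
  have h1 := checks_mulVec_checks (Pi.single i 1)
  have h2 := logicals_mulVec_checks (Pi.single i 1)
  rw [single_one_vecMul] at h1 h2
  exact ⟨h1, h2⟩

/-- `f` describes a logical operator that `U` implements. -/
def Implements (U : Matrix.unitaryGroup (Fin 15 → Bit) ℂ) (f : Frame (Fin 7) → Frame (Fin 7)) :
    Prop :=
  ∃ L : Matrix.unitaryGroup (Fin 7 → Bit) ℂ,
    (U : Op (Fin 15) (Fin 15)) * encoder = encoder * (L : Op (Fin 7) (Fin 7)) ∧
      ∀ v, Acts (L : Op (Fin 7) (Fin 7)) v (f v)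

/-- Stabilizers must go to stabilizers exactly, including the sign; for logical operators a scalar
is harmless, since only the action on frames is recorded. -/
theorem implements_of {U : Matrix.unitaryGroup (Fin 15 → Bit) ℂ}
    {f : Frame (Fin 7) → Frame (Fin 7)}
    (hX : ∀ i, ∃ w : Frame (Fin 15),
      stabX i * (U : Op (Fin 15) (Fin 15)) = (U : Op (Fin 15) (Fin 15)) * pauli w ∧
      (checks *ᵥ w.1 = 0 ∧ logicals *ᵥ w.1 = 0) ∧ (checks *ᵥ w.2 = 0 ∧ logicals *ᵥ w.2 = 0))
    (hZ : ∀ i, ∃ w : Frame (Fin 15),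
      stabZ i * (U : Op (Fin 15) (Fin 15)) = (U : Op (Fin 15) (Fin 15)) * pauli w ∧
      (checks *ᵥ w.1 = 0 ∧ logicals *ᵥ w.1 = 0) ∧ (checks *ᵥ w.2 = 0 ∧ logicals *ᵥ w.2 = 0))
    (hf : ∀ v : Frame (Fin 7), ∃ w : Frame (Fin 15),
      Acts (U : Op (Fin 15) (Fin 15)) (v.1 ᵥ* logicals, v.2 ᵥ* logicals) w ∧
      checks *ᵥ w.1 = 0 ∧ checks *ᵥ w.2 = 0 ∧ (logicals *ᵥ w.1, logicals *ᵥ w.2) = f v) :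
    Implements U f := by
  obtain ⟨L, hL⟩ := exists_logical U fun i => by
    obtain ⟨w, h, h1, h2⟩ := hX i
    obtain ⟨w', h', h1', h2'⟩ := hZ i
    exact ⟨⟨_, h, pauli_mul_encoder_of_stab h1 h2⟩, ⟨_, h', pauli_mul_encoder_of_stab h1' h2'⟩⟩
  refine ⟨L, hL, fun v => ?_⟩
  obtain ⟨w, h, h1, h2, h3⟩ := hf v
  exact h3 ▸ acts_logical hL h h1 h2

/-! ### Transversal operators -/

/-- The frame of `X` on one qubit. -/
def frameX : Frame (Fin 1) := (fun _ => 1, fun _ => 0)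

/-- The frame of `Z` on one qubit. -/
def frameZ : Frame (Fin 1) := (fun _ => 0, fun _ => 1)

/-- The linear map on frames that is `X ↦ w`, `Z ↦ w'` on each qubit. -/
def spreadMap {ι : Type} (w w' : Frame (Fin 1)) (v : Frame ι) : Frame ι :=
  spread v.1 w + spread v.2 w'

theorem spread_frameX {ι : Type} (s : ι → Bit) : spread s frameX = (s, 0) := by
  ext i <;> simp [spread, frameX]

theorem spread_frameZ {ι : Type} (s : ι → Bit) : spread s frameZ = (0, s) := by
  ext i <;> simp [spread, frameZ]

theorem acts_transversalOp {ι : Type} [Fintype ι] [DecidableEq ι] {u : Op (Fin 1) (Fin 1)}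
    {w w' : Frame (Fin 1)} (hX : Acts u frameX w) (hZ : Acts u frameZ w') (v : Frame ι) :
    Acts (transversalOp u) v (spreadMap w w' v) := by
  obtain ⟨c, hc⟩ := hX
  obtain ⟨c', hc'⟩ := hZ
  have h1 : Acts (transversalOp u) (spread v.1 frameX) (spread v.1 w) :=
    ⟨_, transversalOp_mul_spread hc v.1⟩
  have h2 : Acts (transversalOp u) (spread v.2 frameZ) (spread v.2 w') :=
    ⟨_, transversalOp_mul_spread hc' v.2⟩
  have := h1.add h2
  rw [spread_frameX, spread_frameZ, Prod.mk_add_mk, add_zero, zero_add] at this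
  exact this

theorem transversalOp_mem_unitary {ι : Type} [Fintype ι] [DecidableEq ι]
    (u : Matrix.unitaryGroup (Fin 1 → Bit) ℂ) :
    (transversalOp (u : Op (Fin 1) (Fin 1)) : Op ι ι) ∈ Matrix.unitaryGroup (ι → Bit) ℂ := by
  have : star (transversalOp (u : Op (Fin 1) (Fin 1)) : Op ι ι) =
      transversalOp (star (u : Op (Fin 1) (Fin 1))) := by
    ext x y
    simp [transversalOp, star_apply]
  rw [Matrix.mem_unitaryGroup_iff, this, ← transversalOp_mul,
    Matrix.mem_unitaryGroup_iff.1 u.2, transversalOp_one]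

theorem spread_eq_smul {ι : Type} (s : ι → Bit) (w : Frame (Fin 1)) :
    spread s w = (w.1 0 • s, w.2 0 • s) := by
  ext i <;> simp [spread, mul_comm]

theorem spread_stab (i : Fin 4) (w : Frame (Fin 1)) :
    (checks *ᵥ (spread (checks i) w).1 = 0 ∧ logicals *ᵥ (spread (checks i) w).1 = 0) ∧
      (checks *ᵥ (spread (checks i) w).2 = 0 ∧ logicals *ᵥ (spread (checks i) w).2 = 0) := by
  simp [spread_eq_smul, mulVec_smul, checks_row]

/-- All checks have weight 8 and the scalar of a one-qubit Clifford operator satisfies `c ^ 4 = 1`,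
so the signs on a stabilizer cancel. -/
theorem stab_mul_transversalOp (u : Matrix.unitaryGroup (Fin 1 → Bit) ℂ) {v w : Frame (Fin 1)}
    (h : Acts ((u⁻¹ : Matrix.unitaryGroup (Fin 1 → Bit) ℂ) : Op (Fin 1) (Fin 1)) v w)
    (i : Fin 4) :
    pauli (spread (checks i) v) * (transversalOp (u : Op (Fin 1) (Fin 1)) : Op (Fin 15) (Fin 15)) =
      transversalOp (u : Op (Fin 1) (Fin 1)) * pauli (spread (checks i) w) := by
  obtain ⟨c, hc⟩ := h
  have h1 := transversalOp_mul_spread hc (checks i)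
  have hcard : (Finset.univ.filter fun j => checks i j = 1).card = 8 := by
    clear * -
    revert i
    decide +kernel
  have hc8 : c ^ 8 = 1 := by
    rw [show (8 : ℕ) = 4 * 2 from rfl, pow_mul, scalar_pow_four hc, one_pow]
  rw [hcard, hc8, one_smul] at h1
  have e1 : (transversalOp (u : Op (Fin 1) (Fin 1)) : Op (Fin 15) (Fin 15)) *
      transversalOp ((u⁻¹ : Matrix.unitaryGroup (Fin 1 → Bit) ℂ) : Op (Fin 1) (Fin 1)) = 1 := by
    rw [← transversalOp_mul, unitary_mul_star, transversalOp_one]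
  have e2 : (transversalOp ((u⁻¹ : Matrix.unitaryGroup (Fin 1 → Bit) ℂ) : Op (Fin 1) (Fin 1)) :
      Op (Fin 15) (Fin 15)) * transversalOp (u : Op (Fin 1) (Fin 1)) = 1 := by
    rw [← transversalOp_mul, unitary_star_mul, transversalOp_one]
  have h2 := congrArg (fun M : Op (Fin 15) (Fin 15) =>
    transversalOp (u : Op (Fin 1) (Fin 1)) * M * transversalOp (u : Op (Fin 1) (Fin 1))) h1
  simp only [← Matrix.mul_assoc, e1, Matrix.one_mul] at h2
  rw [h2, Matrix.mul_assoc, e2, Matrix.mul_one]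

theorem implements_transversalOp {u : Matrix.unitaryGroup (Fin 1 → Bit) ℂ}
    (hu : u ∈ cliffordGroup (Fin 1)) {w w' : Frame (Fin 1)}
    (hX : Acts (u : Op (Fin 1) (Fin 1)) frameX w) (hZ : Acts (u : Op (Fin 1) (Fin 1)) frameZ w')
    {U : Matrix.unitaryGroup (Fin 15 → Bit) ℂ}
    (hU : (U : Op (Fin 15) (Fin 15)) = transversalOp (u : Op (Fin 1) (Fin 1))) :
    Implements U (spreadMap w w') := by
  have hinv := mem_cliffordGroup_iff.1 (inv_mem hu)
  refine implements_of (fun i => ?_) (fun i => ?_) fun v => ?_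
  · obtain ⟨x, hx⟩ := hinv frameX
    refine ⟨spread (checks i) x, ?_, spread_stab i x⟩
    rw [hU, ← stab_mul_transversalOp u hx i, spread_frameX]
    rfl
  · obtain ⟨x, hx⟩ := hinv frameZ
    refine ⟨spread (checks i) x, ?_, spread_stab i x⟩
    rw [hU, ← stab_mul_transversalOp u hx i, spread_frameZ]
    rfl
  · refine ⟨_, hU ▸ acts_transversalOp hX hZ _, ?_⟩
    simp [spreadMap, spread_eq_smul, mulVec_smul, mulVec_add]

/-! ### Permutations -/

theorem permOp_mul_pauli {ι : Type} [Fintype ι] [DecidableEq ι] (σ : Equiv.Perm ι) (v : Frame ι) :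
    permOp σ * pauli v = pauli (v.1 ∘ σ.symm, v.2 ∘ σ.symm) * permOp σ := by
  ext x y
  rw [mul_pauli_apply, pauli_mul_apply]
  simp only [permOp, of_apply]
  have e : x = (y + v.1) ∘ σ.symm ↔ x + v.1 ∘ σ.symm = y ∘ σ.symm := by
    constructor
    · rintro rfl
      funext i
      simp [add_assoc]
    · intro h
      funext i
      have := congrFun h i
      simp only [Pi.add_apply, Function.comp_apply] at this ⊢
      rw [← this, add_assoc, bit_add_self, add_zero]
  by_cases h : x = (y + v.1) ∘ σ.symm
  · rw [if_pos h, if_pos (e.1 h), e.1 h]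
    rw [one_mul, mul_one, dotProduct_comp_equiv_symm]
    congr 2
    funext i
    simp
  · rw [if_neg h, if_neg fun h' => h (e.2 h'), mul_zero, zero_mul]

theorem permOp_mul {ι : Type} [Fintype ι] [DecidableEq ι] (σ τ : Equiv.Perm ι) :
    permOp σ * permOp τ = permOp (σ * τ) := by
  ext x y
  rw [Matrix.mul_apply, Finset.sum_eq_single (y ∘ τ.symm)]
  · simp [permOp, Function.comp_assoc]
    rfl
  · intro z _ hz
    simp [permOp, hz]
  · simp

theorem permOp_one {ι : Type} [Fintype ι] [DecidableEq ι] : permOp (1 : Equiv.Perm ι) = 1 := by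
  ext x y
  simp only [permOp, of_apply, Matrix.one_apply]
  rfl

theorem permOp_mem_unitary {ι : Type} [Fintype ι] [DecidableEq ι] (σ : Equiv.Perm ι) :
    permOp σ ∈ Matrix.unitaryGroup (ι → Bit) ℂ := by
  have : star (permOp σ) = permOp σ⁻¹ := by
    ext x y
    have e : y = x ∘ σ.symm ↔ x = y ∘ σ := by
      constructor <;> rintro rfl <;> funext i <;> simp
    simp only [star_apply, permOp, of_apply, e]
    rw [apply_ite star, star_one, star_zero]
    rfl
  rw [Matrix.mem_unitaryGroup_iff, this, permOp_mul, mul_inv_cancel, permOp_one]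

theorem vecMul_comp {m n : Type} [Fintype m] (x : m → Bit) (A : Matrix m n Bit) (e : n → n) :
    (x ᵥ* A) ∘ e = x ᵥ* A.submatrix id e := rfl

/-- The action of a code automorphism on the logical qubits. -/
def logicalPerm (σ : Equiv.Perm (Fin 15)) : Matrix (Fin 7) (Fin 7) Bit :=
  logicals * (logicals.submatrix id σ.symm)ᵀ

/-- By `h1` and `h2` the pulled-back checks have trivial syndrome and trivial logical parities,
hence are stabilizers. By `h3` the permuted logical operators still commute with the stabilizers. -/
theorem implements_permOp {σ : Equiv.Perm (Fin 15)}
    (h1 : checks * (checks.submatrix id σ)ᵀ = 0) (h2 : logicals * (checks.submatrix id σ)ᵀ = 0)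
    (h3 : checks * (logicals.submatrix id σ.symm)ᵀ = 0)
    {U : Matrix.unitaryGroup (Fin 15 → Bit) ℂ} (hU : (U : Op (Fin 15) (Fin 15)) = permOp σ) :
    Implements U fun v => (logicalPerm σ *ᵥ v.1, logicalPerm σ *ᵥ v.2) := by
  have hs : ∀ i, checks *ᵥ (checks i ∘ σ) = 0 ∧ logicals *ᵥ (checks i ∘ σ) = 0 := by
    intro i
    have e : checks i ∘ σ = (checks.submatrix id σ)ᵀ *ᵥ Pi.single i 1 := by
      rw [mulVec_single_one]; rfl
    rw [e, mulVec_mulVec, mulVec_mulVec, h1, h2, zero_mulVec, zero_mulVec]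
    exact ⟨rfl, rfl⟩
  have hc : ∀ a : Fin 15 → Bit, (a ∘ σ) ∘ σ.symm = a := fun a => by
    rw [Function.comp_assoc, Equiv.self_comp_symm, Function.comp_id]
  refine implements_of (fun i => ?_) (fun i => ?_) fun v => ?_
  · refine ⟨(checks i ∘ σ, 0), ?_, hs i, by simp⟩
    rw [hU, permOp_mul_pauli, hc]
    rfl
  · refine ⟨(0, checks i ∘ σ), ?_, by simp, hs i⟩
    rw [hU, permOp_mul_pauli, hc]
    rfl
  · have hv : ∀ x : Fin 7 → Bit,
        (x ᵥ* logicals) ∘ σ.symm = (logicals.submatrix id σ.symm)ᵀ *ᵥ x := fun x => by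
      rw [vecMul_comp, mulVec_transpose]
    have hchk : ∀ x : Fin 7 → Bit,
        checks *ᵥ ((logicals.submatrix id σ.symm)ᵀ *ᵥ x) = 0 := fun x => by
      rw [mulVec_mulVec, h3, zero_mulVec]
    refine ⟨((logicals.submatrix id σ.symm)ᵀ *ᵥ v.1, (logicals.submatrix id σ.symm)ᵀ *ᵥ v.2),
      ⟨1, ?_⟩, hchk _, hchk _, ?_⟩
    · rw [hU, permOp_mul_pauli, one_smul, hv, hv]
    · simp only [mulVec_mulVec, logicalPerm]

/-! ### The round-robin circuit -/

/-- The phase polynomial of a diagonal circuit of `CZ` gates. -/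
def czPhase (l : List (ℕ × ℕ)) (x : Fin 15 → Bit) : Bit :=
  (l.map fun p => x (dat p.1) * x (dat p.2)).sum

/-- The change of the `Z` part of a Pauli operator under a circuit of `CZ` gates. -/
def czShift (l : List (ℕ × ℕ)) (a : Fin 15 → Bit) : Fin 15 → Bit :=
  (l.map fun p => Pi.single (dat p.2) (a (dat p.1)) + Pi.single (dat p.1) (a (dat p.2))).sum

theorem czPhase_cons (p : ℕ × ℕ) (l : List (ℕ × ℕ)) (x : Fin 15 → Bit) :
    czPhase (p :: l) x = x (dat p.1) * x (dat p.2) + czPhase l x := by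
  rw [czPhase, List.map_cons, List.sum_cons]
  rfl

theorem czShift_cons (p : ℕ × ℕ) (l : List (ℕ × ℕ)) (a : Fin 15 → Bit) :
    czShift (p :: l) a =
      Pi.single (dat p.2) (a (dat p.1)) + Pi.single (dat p.1) (a (dat p.2)) + czShift l a := by
  rw [czShift, List.map_cons, List.sum_cons]
  rfl

/-- Polarization of the quadratic form: its bilinear form gives the `Z` operators that a circuit of
`CZ` gates attaches to an `X` operator, and its value at `a` gives the sign. -/
theorem czPhase_add (l : List (ℕ × ℕ)) (x a : Fin 15 → Bit) :
    czPhase l (x + a) = czPhase l x + czPhase l a + czShift l a ⬝ᵥ x := by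
  induction l with
  | nil => simp [czPhase, czShift]
  | cons p l ih =>
    simp only [czPhase_cons, czShift_cons, ih, add_dotProduct, single_dotProduct, Pi.add_apply]
    ring

/-- The phase polynomial of the round-robin circuit. -/
def roundRobinPhase (x : Fin 15 → Bit) : Bit :=
  czPhase roundRobinPairs x + (x (dat 4) + x (dat 8) + x (dat 12))

/-- The operator of the `CZ` gates of the list. -/
noncomputable def czCircuit (l : List (ℕ × ℕ)) : Op (Fin 15) (Fin 15) :=
  (l.map fun p => czOp (dat p.1) (dat p.2)).prod

theorem czCircuit_eq (l : List (ℕ × ℕ)) :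
    czCircuit l = Matrix.diagonal fun x => sgn (czPhase l x) := by
  induction l with
  | nil => simp [czCircuit, czPhase]
  | cons p l ih =>
    have h : czCircuit (p :: l) = czOp (dat p.1) (dat p.2) * czCircuit l := by
      rw [czCircuit, List.map_cons, List.prod_cons]
      rfl
    rw [h, ih, czOp, Matrix.diagonal_mul_diagonal]
    simp only [czPhase_cons, sgn_add]

theorem pauli_diagonal {ι : Type} [Fintype ι] [DecidableEq ι] (b : ι → Bit) :
    pauli (0, b) = Matrix.diagonal fun x => sgn (b ⬝ᵥ x) := by
  ext x y
  rw [pauli_apply, Matrix.diagonal_apply, add_zero]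
  by_cases h : x = y
  · rw [if_pos h, if_pos h, h]
  · rw [if_neg h, if_neg h]

theorem roundRobin_eq : roundRobin = Matrix.diagonal fun x => sgn (roundRobinPhase x) := by
  have h : roundRobin = czCircuit roundRobinPairs *
    (pauliAt (dat 4) 0 1 * pauliAt (dat 8) 0 1 * pauliAt (dat 12) 0 1) := rfl
  rw [h, czCircuit_eq, pauliAt_eq, pauliAt_eq, pauliAt_eq, Pi.single_zero, Pi.single_zero,
    Pi.single_zero, pauli_diagonal, pauli_diagonal, pauli_diagonal,
    Matrix.diagonal_mul_diagonal, Matrix.diagonal_mul_diagonal, Matrix.diagonal_mul_diagonal]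
  congr 1
  funext x
  simp [roundRobinPhase, sgn_add]

theorem roundRobin_mul_pauli (v : Frame (Fin 15)) :
    roundRobin * pauli v = sgn (roundRobinPhase v.1) •
      (pauli (v.1, v.2 + czShift roundRobinPairs v.1) * roundRobin) := by
  ext x y
  rw [roundRobin_eq, Matrix.smul_apply, Matrix.diagonal_mul, Matrix.mul_diagonal, pauli_apply,
    pauli_apply]
  by_cases h : x = y + v.1
  · rw [if_pos h, if_pos h, h]
    simp only [roundRobinPhase, czPhase_add, add_dotProduct, sgn_add, Pi.add_apply, smul_eq_mul]
    ring
  · simp [h]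

theorem roundRobin_mem_unitary : roundRobin ∈ Matrix.unitaryGroup (Fin 15 → Bit) ℂ := by
  rw [Matrix.mem_unitaryGroup_iff, roundRobin_eq, star_eq_conjTranspose,
    Matrix.diagonal_conjTranspose, Matrix.diagonal_mul_diagonal, ← Matrix.diagonal_one]
  congr 1
  funext x
  simp

theorem czShift_smul (l : List (ℕ × ℕ)) (c : Bit) (a : Fin 15 → Bit) :
    czShift l (c • a) = c • czShift l a := by
  induction l with
  | nil => simp [czShift]
  | cons p l ih =>
    simp only [czShift_cons, ih, Pi.smul_apply, Pi.single_smul, smul_add]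

theorem czShift_add (l : List (ℕ × ℕ)) (a b : Fin 15 → Bit) :
    czShift l (a + b) = czShift l a + czShift l b := by
  induction l with
  | nil => simp [czShift]
  | cons p l ih =>
    simp only [czShift_cons, ih, Pi.add_apply, Pi.single_add]
    abel

/-- The matrix of `czShift` on the logical operators. -/
def czShiftMatrix (l : List (ℕ × ℕ)) : Matrix (Fin 7) (Fin 15) Bit :=
  Matrix.of fun i => czShift l (logicals i)

theorem czShift_vecMul (l : List (ℕ × ℕ)) (x : Fin 7 → Bit) :
    czShift l (x ᵥ* logicals) = x ᵥ* czShiftMatrix l := by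
  rw [vecMul_eq_sum, vecMul_eq_sum]
  have : ∀ s : Finset (Fin 7), czShift l (∑ i ∈ s, x i • logicals i) =
      ∑ i ∈ s, x i • czShiftMatrix l i := by
    intro s
    induction s using Finset.induction_on with
    | empty => simpa using czShift_smul l 0 0
    | insert i s hi ih =>
      rw [Finset.sum_insert hi, Finset.sum_insert hi, czShift_add, ih, czShift_smul]
      rfl
  exact this _

/-- The action of the round-robin circuit on the logical qubits. -/
def logicalRoundRobin : Matrix (Fin 7) (Fin 7) Bit :=
  logicals * (czShiftMatrix roundRobinPairs)ᵀ

theorem implements_roundRobin {U : Matrix.unitaryGroup (Fin 15 → Bit) ℂ}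
    (hU : (U : Op (Fin 15) (Fin 15)) = roundRobin) :
    Implements U fun v => (v.1, v.2 + logicalRoundRobin *ᵥ v.1) := by
  -- The phase at a row of `checks` is the sign that the conjugated `X` stabilizer acquires; it has
  -- to be trivial.
  have hq : ∀ i, roundRobinPhase (checks i) = 0 := by decide +kernel
  have hs : ∀ i, checks *ᵥ czShift roundRobinPairs (checks i) = 0 ∧
      logicals *ᵥ czShift roundRobinPairs (checks i) = 0 := by decide +kernel
  have hm : checks * (czShiftMatrix roundRobinPairs)ᵀ = 0 := by decide +kernel
  refine implements_of (fun i => ?_) (fun i => ?_) fun v => ?_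
  · refine ⟨(checks i, czShift roundRobinPairs (checks i)), ?_, checks_row i, hs i⟩
    rw [hU, roundRobin_mul_pauli, hq, sgn_zero, one_smul, bits_add_self]
    rfl
  · refine ⟨(0, checks i), ?_, by simp, checks_row i⟩
    have h0 : czShift roundRobinPairs 0 = 0 := by
      simpa using czShift_smul roundRobinPairs 0 0
    rw [hU, roundRobin_mul_pauli, h0, add_zero]
    have h1 : roundRobinPhase 0 = 0 := by decide +kernel
    rw [h1, sgn_zero, one_smul]
    rfl
  · refine ⟨_, ⟨_, by rw [hU]; exact roundRobin_mul_pauli _⟩, by simp, ?_, ?_⟩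
    · rw [mulVec_add, checks_mulVec_vecMul, czShift_vecMul, ← mulVec_transpose, mulVec_mulVec, hm,
        zero_mulVec, zero_add]
    · rw [mulVec_add, logicals_mulVec_vecMul, logicals_mulVec_vecMul, czShift_vecMul,
        ← mulVec_transpose, mulVec_mulVec]
      rfl

/-! ## The logical group -/

/-- The group of the logical operators that the generators implement. -/
def logicalGroup : Subgroup (Matrix.unitaryGroup (Fin 7 → Bit) ℂ) where
  carrier := {L | ∃ U ∈ Subgroup.closure generators,
    (U : Op (Fin 15) (Fin 15)) * encoder = encoder * (L : Op (Fin 7) (Fin 7))}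
  one_mem' := ⟨1, one_mem _, by
    rw [Matrix.UnitaryGroup.one_val, Matrix.UnitaryGroup.one_val, Matrix.one_mul, Matrix.mul_one]⟩
  mul_mem' := by
    rintro L L' ⟨U, hU, h⟩ ⟨U', hU', h'⟩
    refine ⟨U * U', mul_mem hU hU', ?_⟩
    rw [Matrix.UnitaryGroup.mul_val, Matrix.UnitaryGroup.mul_val, Matrix.mul_assoc, h',
      ← Matrix.mul_assoc, h, Matrix.mul_assoc]
  inv_mem' := by
    rintro L ⟨U, hU, h⟩
    refine ⟨U⁻¹, inv_mem hU, ?_⟩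
    have := congrArg (fun M : Op (Fin 15) (Fin 7) =>
      ((U⁻¹ : Matrix.unitaryGroup (Fin 15 → Bit) ℂ) : Op (Fin 15) (Fin 15)) * M *
        ((L⁻¹ : Matrix.unitaryGroup (Fin 7 → Bit) ℂ) : Op (Fin 7) (Fin 7))) h
    simp only [← Matrix.mul_assoc, unitary_star_mul, Matrix.one_mul] at this
    rw [this, Matrix.mul_assoc, Matrix.mul_assoc, unitary_mul_star, Matrix.mul_one]

/-- The logical group realizes the map `f` on frames. -/
def Realized (f : Frame (Fin 7) → Frame (Fin 7)) : Prop :=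
  ∃ L ∈ logicalGroup, ∀ v, Acts (L : Op (Fin 7) (Fin 7)) v (f v)

theorem Implements.realized {U : Matrix.unitaryGroup (Fin 15 → Bit) ℂ}
    {f : Frame (Fin 7) → Frame (Fin 7)} (h : Implements U f) (hU : U ∈ generators) :
    Realized f := by
  obtain ⟨L, hL, hf⟩ := h
  exact ⟨L, ⟨U, Subgroup.subset_closure hU, hL⟩, hf⟩

theorem Realized.comp {f g : Frame (Fin 7) → Frame (Fin 7)} (hf : Realized f) (hg : Realized g) :
    Realized fun v => f (g v) := by
  obtain ⟨L, hL, h⟩ := hf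
  obtain ⟨M, hM, h'⟩ := hg
  exact ⟨L * M, mul_mem hL hM, fun v => (h _).mul (h' v)⟩

theorem Realized.add {f : Frame (Fin 7) → Frame (Fin 7)} (hf : Realized f) (v w : Frame (Fin 7)) :
    f (v + w) = f v + f w := by
  obtain ⟨L, -, h⟩ := hf
  exact (h _).unique ((h v).add (h w))

theorem Realized.symp_eq {f : Frame (Fin 7) → Frame (Fin 7)} (hf : Realized f)
    (v w : Frame (Fin 7)) : symp (f v) (f w) = symp v w := by
  obtain ⟨L, -, h⟩ := hf
  exact (h v).symp_eq (h w)

/-- The induced map is injective on a finite set, hence bijective, and its inverse is the action of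
the inverse unitary. -/
theorem Realized.inverse {f : Frame (Fin 7) → Frame (Fin 7)} (hf : Realized f) :
    ∃ g, Realized g ∧ (∀ v, g (f v) = v) ∧ ∀ v, f (g v) = v := by
  obtain ⟨L, hL, h⟩ := hf
  have hinj : Function.Injective f := by
    intro v w hvw
    exact (h v).inv.unique (hvw ▸ (h w).inv)
  let e := Equiv.ofBijective f (Finite.injective_iff_bijective.1 hinj)
  refine ⟨e.symm, ⟨L⁻¹, inv_mem hL, fun v => ?_⟩, fun v => e.symm_apply_apply v,
    fun v => e.apply_symm_apply v⟩
  have := (h (e.symm v)).inv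
  rwa [show f (e.symm v) = v from e.apply_symm_apply v] at this

/-- The symplectic transvection along `u`. -/
def transvection {ι : Type} [Fintype ι] (u v : Frame ι) : Frame ι := v + symp v u • u

/-- The frames whose transvection is realized. -/
def transvections : Set (Frame (Fin 7)) := {u | Realized (transvection u)}

theorem map_smul_of_add {f : Frame (Fin 7) → Frame (Fin 7)}
    (hf : ∀ v w, f (v + w) = f v + f w) (c : Bit) (v : Frame (Fin 7)) : f (c • v) = c • f v := by
  rcases bit_cases c with rfl | rfl
  · have := hf 0 0
    simp only [add_zero] at this
    simpa using this
  · simp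

/-- Conjugating the transvection along `u` by a symplectic map `f` gives the transvection along `f
u`. -/
theorem Realized.mem_transvections {f : Frame (Fin 7) → Frame (Fin 7)} (hf : Realized f)
    {u : Frame (Fin 7)} (hu : u ∈ transvections) : f u ∈ transvections := by
  obtain ⟨g, hg, -, hfg⟩ := hf.inverse
  have h : (fun v => f (transvection u (g v))) = transvection (f u) := by
    funext v
    rw [transvection, hf.add, map_smul_of_add hf.add, hfg, transvection, ← hf.symp_eq, hfg]
  show Realized (transvection (f u))
  rw [← h]
  exact hf.comp (hu.comp hg)

/-- For anticommuting `u` and `v`, the transvection along `v` takes `u` to `u + v`. -/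
theorem add_mem_transvections {u v : Frame (Fin 7)} (hu : u ∈ transvections)
    (hv : v ∈ transvections) (h : symp u v = 1) : u + v ∈ transvections := by
  have h1 := Realized.mem_transvections (f := transvection v) hv hu
  rwa [transvection, h, one_smul] at h1

/-! ### The generators -/

theorem realized_transversal {u : Matrix.unitaryGroup (Fin 1 → Bit) ℂ}
    (hu : u ∈ cliffordGroup (Fin 1)) {w w' : Frame (Fin 1)}
    (hX : Acts (u : Op (Fin 1) (Fin 1)) frameX w)
    (hZ : Acts (u : Op (Fin 1) (Fin 1)) frameZ w') : Realized (spreadMap w w') :=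
  (implements_transversalOp hu hX hZ (U := ⟨_, transversalOp_mem_unitary u⟩) rfl).realized
    (Or.inl ⟨u, hu, rfl⟩)

theorem frame_eq_span (v : Frame (Fin 1)) : v = v.1 0 • frameX + v.2 0 • frameZ := by
  refine Prod.ext (funext fun i => ?_) (funext fun i => ?_) <;>
    simp [frameX, frameZ, Subsingleton.elim i 0]

theorem smul_acts {ι : Type} [Fintype ι] [DecidableEq ι] {L : Op ι ι} {v w : Frame ι} (c : Bit)
    (h : Acts L v w) : Acts L (c • v) (c • w) := by
  rcases bit_cases c with rfl | rfl
  · rw [zero_smul, zero_smul]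
    exact ⟨1, by simp⟩
  · simpa using h

theorem mem_clifford_one {u : Matrix.unitaryGroup (Fin 1 → Bit) ℂ} {w w' : Frame (Fin 1)}
    (hX : Acts (u : Op (Fin 1) (Fin 1)) frameX w)
    (hZ : Acts (u : Op (Fin 1) (Fin 1)) frameZ w') : u ∈ cliffordGroup (Fin 1) := by
  refine mem_cliffordGroup_iff.2 fun v => ?_
  rw [frame_eq_span v]
  exact ⟨_, (smul_acts _ hX).add (smul_acts _ hZ)⟩

/-- The Hadamard gate. -/
noncomputable def hadamard : Op (Fin 1) (Fin 1) :=
  Matrix.of fun x y => ((Real.sqrt 2 : ℝ) : ℂ)⁻¹ * sgn (x 0 * y 0)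

/-- The phase gate. -/
noncomputable def phaseGate : Op (Fin 1) (Fin 1) :=
  Matrix.diagonal fun x => if x 0 = 0 then 1 else Complex.I

theorem sum_one_qubit (f : (Fin 1 → Bit) → ℂ) : ∑ z, f z = f (fun _ => 0) + f (fun _ => 1) := by
  have h := Fintype.sum_equiv (Equiv.funUnique (Fin 1) Bit) f (fun b => f fun _ => b) fun z => by
    congr 1; funext i; rw [Subsingleton.elim i 0]; rfl
  rw [h]
  exact Fin.sum_univ_two _

theorem hadamard_mem_unitary : hadamard ∈ Matrix.unitaryGroup (Fin 1 → Bit) ℂ := by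
  rw [Matrix.mem_unitaryGroup_iff]
  ext x y
  have h2 : ((Real.sqrt 2 : ℝ) : ℂ)⁻¹ * ((Real.sqrt 2 : ℝ) : ℂ)⁻¹ = 1 / 2 := by
    rw [← mul_inv, ← Complex.ofReal_mul, Real.mul_self_sqrt (by norm_num)]
    norm_num
  have hz : ∀ z, hadamard x z * star hadamard z y =
      1 / 2 * (sgn (x 0 * z 0) * sgn (y 0 * z 0)) := by
    intro z
    simp only [hadamard, of_apply, star_apply, star_mul', star_sgn, star_inv₀, Complex.star_def,
      Complex.conj_ofReal]
    linear_combination (sgn (x 0 * z 0) * sgn (y 0 * z 0)) * h2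
  rw [Matrix.mul_apply, sum_one_qubit, Matrix.one_apply, hz, hz]
  by_cases h : x = y
  · subst h
    norm_num
  · have h0 : x 0 ≠ y 0 := fun h0 => h (funext fun i => by rw [Subsingleton.elim i 0, h0])
    rw [if_neg h]
    rcases bit_cases (x 0) with hx | hx <;> rcases bit_cases (y 0) with hy | hy <;>
      simp_all

theorem acts_hadamard_X : Acts hadamard frameX frameZ := by
  refine ⟨1, ?_⟩
  ext x y
  rw [one_smul, mul_pauli_apply, pauli_mul_apply]
  simp [hadamard, frameX, frameZ, dotProduct, mul_add, sgn_add]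
  ring

theorem acts_hadamard_Z : Acts hadamard frameZ frameX := by
  refine ⟨1, ?_⟩
  ext x y
  rw [one_smul, mul_pauli_apply, pauli_mul_apply]
  simp [hadamard, frameX, frameZ, dotProduct, add_mul, sgn_add]
  ring

theorem phaseGate_mem_unitary : phaseGate ∈ Matrix.unitaryGroup (Fin 1 → Bit) ℂ := by
  rw [Matrix.mem_unitaryGroup_iff, phaseGate, star_eq_conjTranspose,
    Matrix.diagonal_conjTranspose, Matrix.diagonal_mul_diagonal, ← Matrix.diagonal_one]
  congr 1
  funext x
  simp only [Pi.star_apply]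
  split_ifs <;> simp

theorem acts_phaseGate_X : Acts phaseGate frameX (frameX + frameZ) := by
  refine ⟨Complex.I, ?_⟩
  ext x y
  have hy : x = y ∨ x = y + frameX.1 := by
    rcases bit_cases (x 0) with hx | hx <;> rcases bit_cases (y 0) with hy | hy
    all_goals first
      | (left; funext i; rw [Subsingleton.elim i 0, hx, hy]; done)
      | (right; funext i; rw [Subsingleton.elim i 0, Pi.add_apply, hx, hy]; decide)
  rw [phaseGate, Matrix.smul_apply, Matrix.diagonal_mul, Matrix.mul_diagonal, pauli_apply,
    pauli_apply]
  have hne : ¬ (y = y + frameX.1) := fun h => by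
    have := congrFun h 0
    simp [frameX] at this
  rcases hy with rfl | rfl
  · have e : (frameX + frameZ).1 = frameX.1 := by
      funext i
      simp [frameZ]
    rw [e, if_neg hne, if_neg hne]
    simp
  · rcases bit_cases (y 0) with hy | hy <;>
      simp [frameX, frameZ, hy, dotProduct, funext_iff]

theorem acts_phaseGate_Z : Acts phaseGate frameZ frameZ := by
  refine ⟨1, ?_⟩
  rw [one_smul, phaseGate]
  have : pauli frameZ = Matrix.diagonal fun x => sgn (frameZ.2 ⬝ᵥ x) := pauli_diagonal _
  rw [this, Matrix.diagonal_mul_diagonal, Matrix.diagonal_mul_diagonal]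
  congr 1
  funext x
  rw [mul_comm]

theorem realized_hadamard : Realized fun v => (v.2, v.1) := by
  have := realized_transversal (u := ⟨hadamard, hadamard_mem_unitary⟩)
    (mem_clifford_one acts_hadamard_X acts_hadamard_Z) acts_hadamard_X acts_hadamard_Z
  convert this using 2 with v
  simp [spreadMap, spread_frameX, spread_frameZ]

theorem realized_phase : Realized fun v => (v.1, v.2 + v.1) := by
  have := realized_transversal (u := ⟨phaseGate, phaseGate_mem_unitary⟩)
    (mem_clifford_one acts_phaseGate_X acts_phaseGate_Z) acts_phaseGate_X acts_phaseGate_Z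
  convert this using 2 with v
  simp [spreadMap, spread_eq_smul, frameX, frameZ, add_comm]

/-- The action of `σ₁` on the logical qubits. -/
def perm₁ : Matrix (Fin 7) (Fin 7) Bit :=
  !![0,0,1,0,0,0,0; 1,0,0,0,0,0,0; 0,1,0,0,0,0,0; 0,0,0,1,0,0,0; 0,0,0,0,1,0,0; 0,0,0,0,0,1,0;
     0,0,0,0,0,0,1]

/-- The action of `σ₂` on the logical qubits. -/
def perm₂ : Matrix (Fin 7) (Fin 7) Bit :=
  !![1,0,0,0,0,0,0; 0,1,0,0,0,0,0; 0,0,0,0,0,0,1; 0,0,1,0,0,0,0; 0,0,0,1,0,0,0; 0,0,0,0,1,0,0;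
     0,0,0,0,0,1,0]

/-- The action of `σ₃` on the logical qubits. -/
def perm₃ : Matrix (Fin 7) (Fin 7) Bit :=
  !![1,0,0,0,0,0,0; 0,1,1,1,1,1,0; 0,0,1,1,1,1,1; 0,1,0,1,1,1,1; 0,1,1,0,1,1,1; 0,1,1,1,0,1,1;
     0,1,1,1,1,0,1]

/-- The phases of the round-robin circuit on the logical qubits. -/
def roundRobinMatrix : Matrix (Fin 7) (Fin 7) Bit :=
  !![0,1,0,0,1,0,1; 1,0,1,1,1,0,1; 0,1,0,0,1,0,1; 0,1,0,0,1,0,1; 1,1,1,1,0,0,0; 0,0,0,0,0,0,0;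
     1,1,1,1,0,0,0]

theorem implements_perm₁ {U : Matrix.unitaryGroup (Fin 15 → Bit) ℂ}
    (hU : (U : Op (Fin 15) (Fin 15)) = permOp σ₁) :
    Implements U fun v => (perm₁ *ᵥ v.1, perm₁ *ᵥ v.2) := by
  have h : logicalPerm σ₁ = perm₁ := by decide +kernel
  rw [← h]
  exact implements_permOp (by decide +kernel) (by decide +kernel) (by decide +kernel) hU

theorem implements_perm₂ {U : Matrix.unitaryGroup (Fin 15 → Bit) ℂ}
    (hU : (U : Op (Fin 15) (Fin 15)) = permOp σ₂) :
    Implements U fun v => (perm₂ *ᵥ v.1, perm₂ *ᵥ v.2) := by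
  have h : logicalPerm σ₂ = perm₂ := by decide +kernel
  rw [← h]
  exact implements_permOp (by decide +kernel) (by decide +kernel) (by decide +kernel) hU

theorem implements_perm₃ {U : Matrix.unitaryGroup (Fin 15 → Bit) ℂ}
    (hU : (U : Op (Fin 15) (Fin 15)) = permOp σ₃) :
    Implements U fun v => (perm₃ *ᵥ v.1, perm₃ *ᵥ v.2) := by
  have h : logicalPerm σ₃ = perm₃ := by decide +kernel
  rw [← h]
  exact implements_permOp (by decide +kernel) (by decide +kernel) (by decide +kernel) hU

theorem realized_perm₁ : Realized fun v => (perm₁ *ᵥ v.1, perm₁ *ᵥ v.2) :=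
  (implements_perm₁ (U := ⟨_, permOp_mem_unitary σ₁⟩) rfl).realized
    (Or.inr (Or.inl ⟨σ₁, by simp, rfl⟩))

theorem realized_perm₂ : Realized fun v => (perm₂ *ᵥ v.1, perm₂ *ᵥ v.2) :=
  (implements_perm₂ (U := ⟨_, permOp_mem_unitary σ₂⟩) rfl).realized
    (Or.inr (Or.inl ⟨σ₂, by simp, rfl⟩))

theorem realized_perm₃ : Realized fun v => (perm₃ *ᵥ v.1, perm₃ *ᵥ v.2) :=
  (implements_perm₃ (U := ⟨_, permOp_mem_unitary σ₃⟩) rfl).realized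
    (Or.inr (Or.inl ⟨σ₃, by simp, rfl⟩))

theorem realized_roundRobin : Realized fun v => (v.1, v.2 + roundRobinMatrix *ᵥ v.1) := by
  have h : logicalRoundRobin = roundRobinMatrix := by decide +kernel
  rw [← h]
  exact (implements_roundRobin (U := ⟨_, roundRobin_mem_unitary⟩) rfl).realized
    (Or.inr (Or.inr rfl))

/-! ### A transvection -/

/-- The diagonal logical operators with the phases of `M` are realized. -/
def RealizedPhases (M : Matrix (Fin 7) (Fin 7) Bit) : Prop :=
  Realized fun v => (v.1, v.2 + M *ᵥ v.1)

theorem RealizedPhases.add {M N : Matrix (Fin 7) (Fin 7) Bit} (hM : RealizedPhases M)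
    (hN : RealizedPhases N) : RealizedPhases (M + N) := by
  have := hN.comp hM
  simpa only [RealizedPhases, add_mulVec, ← add_assoc] using this

/-- Orthogonality of `P` makes the same matrix act on the `X` and `Z` parts compatibly, so
conjugation turns the phase matrix `M` into a congruent one. -/
theorem RealizedPhases.conj {M P : Matrix (Fin 7) (Fin 7) Bit} (hM : RealizedPhases M)
    (hP : Realized fun v => (P *ᵥ v.1, P *ᵥ v.2)) (hPP : Pᵀ * P = 1) :
    RealizedPhases (P * M * Pᵀ) := by
  obtain ⟨g, hg, -, hfg⟩ := hP.inverse
  have hgv : ∀ v, g v = (Pᵀ *ᵥ v.1, Pᵀ *ᵥ v.2) := by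
    intro v
    conv_rhs => rw [← hfg v]
    simp only [mulVec_mulVec, hPP, one_mulVec]
  have hPP' : P * Pᵀ = 1 := mul_eq_one_comm.1 hPP
  have := hP.comp (hM.comp hg)
  simpa only [RealizedPhases, hgv, mulVec_add, mulVec_mulVec, hPP', one_mulVec,
    ← Matrix.mul_assoc] using this

theorem allOnes_mem_transvections : ((0, 1) : Frame (Fin 7)) ∈ transvections := by
  have h₁ : perm₁ᵀ * perm₁ = 1 := by decide +kernel
  have h₂ : perm₂ᵀ * perm₂ = 1 := by decide +kernel
  have h₃ : perm₃ᵀ * perm₃ = 1 := by decide +kernel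
  have hS : RealizedPhases 1 := by simpa only [RealizedPhases, one_mulVec] using realized_phase
  have hR : RealizedPhases roundRobinMatrix := realized_roundRobin
  have c₁ := fun {M} (h : RealizedPhases M) => h.conj realized_perm₁ h₁
  have c₂ := fun {M} (h : RealizedPhases M) => h.conj realized_perm₂ h₂
  have c₃ := fun {M} (h : RealizedPhases M) => h.conj realized_perm₃ h₃
  -- Phase matrices add under composition. This particular sum of the identity, the round-robin
  -- matrix and four of its conjugates is the all-ones matrix.
  have h := hS.add (hR.add ((c₂ hR).add ((c₃ hR).add ((c₃ (c₂ (c₂ (c₂ hR)))).add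
    (c₃ (c₁ (c₃ (c₁ (c₁ hR)))))))))
  have e : (1 + (roundRobinMatrix + (perm₂ * roundRobinMatrix * perm₂ᵀ +
      (perm₃ * roundRobinMatrix * perm₃ᵀ + (perm₃ * (perm₂ * (perm₂ * (perm₂ * roundRobinMatrix *
      perm₂ᵀ) * perm₂ᵀ) * perm₂ᵀ) * perm₃ᵀ + perm₃ * (perm₁ * (perm₃ * (perm₁ * (perm₁ *
      roundRobinMatrix * perm₁ᵀ) * perm₁ᵀ) * perm₃ᵀ) * perm₁ᵀ) * perm₃ᵀ))))) =
      Matrix.of fun _ _ => 1 := by decide +kernel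
  rw [e] at h
  -- The transvection along `Z^{⊗7}` adds the sum of all `X` bits to every `Z` bit, so its phase
  -- matrix has all entries `1`.
  have ht : transvection ((0, 1) : Frame (Fin 7)) =
      fun v => (v.1, v.2 + (Matrix.of fun _ _ => 1 : Matrix (Fin 7) (Fin 7) Bit) *ᵥ v.1) := by
    funext v
    apply Prod.ext
    · simp [transvection]
    · funext i
      simp [transvection, symp, mulVec, dotProduct]
  show Realized _
  rw [ht]
  exact h

/-! ### All transvections -/

theorem hadamard_mem {v : Frame (Fin 7)} (h : v ∈ transvections) : (v.2, v.1) ∈ transvections :=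
  realized_hadamard.mem_transvections h

theorem phase_mem {v : Frame (Fin 7)} (h : v ∈ transvections) :
    (v.1, v.2 + v.1) ∈ transvections :=
  realized_phase.mem_transvections h

theorem roundRobin_mem {v : Frame (Fin 7)} (h : v ∈ transvections) :
    (v.1, v.2 + roundRobinMatrix *ᵥ v.1) ∈ transvections :=
  realized_roundRobin.mem_transvections h

theorem perm₁_mem {v : Frame (Fin 7)} (h : v ∈ transvections) :
    (perm₁ *ᵥ v.1, perm₁ *ᵥ v.2) ∈ transvections :=
  realized_perm₁.mem_transvections h

theorem perm₂_mem {v : Frame (Fin 7)} (h : v ∈ transvections) :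
    (perm₂ *ᵥ v.1, perm₂ *ᵥ v.2) ∈ transvections :=
  realized_perm₂.mem_transvections h

theorem perm₃_mem {v : Frame (Fin 7)} (h : v ∈ transvections) :
    (perm₃ *ᵥ v.1, perm₃ *ᵥ v.2) ∈ transvections :=
  realized_perm₃.mem_transvections h

/-- An explicit word in the realized maps, read from right to left, carries `Z^{⊗7}` to a single
`Z`. The next lemma does the same for a pair. -/
theorem single_four_mem : ((0, Pi.single 4 1) : Frame (Fin 7)) ∈ transvections := by
  have h := hadamard_mem <| roundRobin_mem <| perm₃_mem <| perm₂_mem <| perm₁_mem <|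
    hadamard_mem <| roundRobin_mem <| perm₁_mem <| roundRobin_mem <| perm₂_mem <|
    hadamard_mem <| roundRobin_mem <| hadamard_mem <| allOnes_mem_transvections
  convert h using 1
  decide +kernel

theorem pair_one_five_mem :
    ((0, Pi.single 1 1 + Pi.single 5 1) : Frame (Fin 7)) ∈ transvections := by
  have h := hadamard_mem <| roundRobin_mem <| perm₂_mem <| perm₁_mem <| perm₁_mem <|
    phase_mem <| hadamard_mem <| roundRobin_mem <| perm₂_mem <| roundRobin_mem <|
    hadamard_mem <| allOnes_mem_transvections
  convert h using 1
  decide +kernel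

/-- The permutation of the logical qubits by `σ₁`. -/
def index₁ : Fin 7 → Fin 7 := ![1, 2, 0, 3, 4, 5, 6]

/-- The permutation of the logical qubits by `σ₂`. -/
def index₂ : Fin 7 → Fin 7 := ![0, 1, 3, 4, 5, 6, 2]

theorem perm₁_mulVec_single (i : Fin 7) : perm₁ *ᵥ Pi.single i 1 = Pi.single (index₁ i) 1 := by
  revert i
  decide +kernel

theorem perm₂_mulVec_single (i : Fin 7) : perm₂ *ᵥ Pi.single i 1 = Pi.single (index₂ i) 1 := by
  revert i
  decide +kernel

/-- The predicate has two arguments so that it covers single qubits, where the second argument is a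
dummy, as well as pairs. -/
theorem iterate_mem {P : Fin 7 → Fin 7 → Prop} {f : Fin 7 → Fin 7}
    (h : ∀ i j, P i j → P (f i) (f j)) (n : ℕ) {i j : Fin 7} (hij : P i j) :
    P (f^[n] i) (f^[n] j) := by
  induction n with
  | zero => exact hij
  | succ n ih =>
    rw [Function.iterate_succ_apply', Function.iterate_succ_apply']
    exact h _ _ ih

theorem single_Z_mem (i : Fin 7) : ((0, Pi.single i 1) : Frame (Fin 7)) ∈ transvections := by
  let P : Fin 7 → Fin 7 → Prop := fun i _ => ((0, Pi.single i 1) : Frame (Fin 7)) ∈ transvections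
  have h₁ : ∀ i j, P i j → P (index₁ i) (index₁ j) := fun i _ h => by
    have := perm₁_mem h
    rwa [mulVec_zero, perm₁_mulVec_single] at this
  have h₂ : ∀ i j, P i j → P (index₂ i) (index₂ j) := fun i _ h => by
    have := perm₂_mem h
    rwa [mulVec_zero, perm₂_mulVec_single] at this
  -- `index₁` is a 3-cycle on `0, 1, 2` and `index₂` a 5-cycle on `2, …, 6`. They share the point
  -- `2`, so short words reach every qubit from `4`.
  have hi : ∃ a b : Fin 5, index₁^[a] (index₂^[b] 4) = i := by
    revert i
    decide +kernel
  obtain ⟨a, b, rfl⟩ := hi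
  have h := iterate_mem (j := 4) h₂ b (single_four_mem : P 4 4)
  exact iterate_mem (j := index₂^[b] 4) h₁ a h

theorem pair_ZZ_mem {i j : Fin 7} (hij : i ≠ j) :
    ((0, Pi.single i 1 + Pi.single j 1) : Frame (Fin 7)) ∈ transvections := by
  let P : Fin 7 → Fin 7 → Prop :=
    fun i j => ((0, Pi.single i 1 + Pi.single j 1) : Frame (Fin 7)) ∈ transvections
  have h₁ : ∀ i j, P i j → P (index₁ i) (index₁ j) := fun i _ h => by
    have := perm₁_mem h
    rwa [mulVec_zero, mulVec_add, perm₁_mulVec_single, perm₁_mulVec_single] at this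
  have h₂ : ∀ i j, P i j → P (index₂ i) (index₂ j) := fun i _ h => by
    have := perm₂_mem h
    rwa [mulVec_zero, mulVec_add, perm₂_mulVec_single, perm₂_mulVec_single] at this
  -- Words of this shape already carry the ordered pair `(1, 5)` to every ordered pair of distinct
  -- qubits.
  have hw : ∃ a b c d : Fin 5,
      index₁^[a] (index₂^[b] (index₁^[c] (index₂^[d] 1))) = i ∧
        index₁^[a] (index₂^[b] (index₁^[c] (index₂^[d] 5))) = j := by
    revert i j
    decide +kernel
  obtain ⟨a, b, c, d, rfl, rfl⟩ := hw
  exact iterate_mem h₁ a (iterate_mem h₂ b (iterate_mem h₁ c (iterate_mem h₂ d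
    (pair_one_five_mem : P 1 5))))

theorem single_mem {i : Fin 7} {a b : Bit} (hab : (a, b) ≠ 0) :
    ((Pi.single i a, Pi.single i b) : Frame (Fin 7)) ∈ transvections := by
  have hX := hadamard_mem (single_Z_mem i)
  rcases bit_cases a with rfl | rfl <;> rcases bit_cases b with rfl | rfl
  · exact absurd rfl hab
  · rw [Pi.single_zero]
    exact single_Z_mem i
  · rw [Pi.single_zero]
    exact hX
  · have := phase_mem hX
    rwa [zero_add] at this

theorem symp_single {ι : Type} [Fintype ι] [DecidableEq ι] (v : Frame ι) (i : ι) (a b : Bit) :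
    symp v (Pi.single i a, Pi.single i b) = v.1 i * b + v.2 i * a := by
  simp [symp]

/-- The descending form of `add_mem_transvections`: adding an anticommuting realized frame may be
undone, so `v` may be replaced by the simpler `v + u`. -/
theorem mem_of_add_mem_transvections {u v : Frame (Fin 7)} (hu : u ∈ transvections)
    (h : symp v u = 1) (hv : v + u ∈ transvections) : v ∈ transvections := by
  have := add_mem_transvections hv hu (by rw [symp_add_left, symp_self, add_zero, h])
  rwa [frame_add_add_cancel] at this

/-- The qubits on which a frame acts. -/
def frameSupport (v : Frame (Fin 7)) : Finset (Fin 7) :=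
  Finset.univ.filter fun i => (v.1 i, v.2 i) ≠ 0

/-- If `v` does not vanish at `i`, its value there may be replaced by any other nonzero `(a, b)`. -/
theorem mem_of_change {v : Frame (Fin 7)} {i : Fin 7} (hi : (v.1 i, v.2 i) ≠ 0) {a b : Bit}
    (hab : (a, b) ≠ 0)
    (h : v + (Pi.single i (v.1 i + a), Pi.single i (v.2 i + b)) ∈ transvections) :
    v ∈ transvections := by
  by_cases he : (v.1 i + a, v.2 i + b) = 0
  · obtain ⟨h1, h2⟩ := Prod.mk_eq_zero.1 he
    have e : v + ((0, 0) : Frame (Fin 7)) = v := add_zero v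
    rwa [h1, h2, Pi.single_zero, e] at h
  · refine mem_of_add_mem_transvections (single_mem he) ?_ h
    have key : ∀ p q a b : Bit, (p, q) ≠ 0 → (a, b) ≠ 0 → (p + a, q + b) ≠ 0 →
        p * (q + b) + q * (p + a) = 1 := by decide
    rw [symp_single]
    exact key _ _ _ _ hi hab he

theorem mem_transvections_of_ne_zero (v : Frame (Fin 7)) (hv : v ≠ 0) : v ∈ transvections := by
  induction hn : (frameSupport v).card using Nat.strong_induction_on generalizing v with
  | _ n ih =>
  subst hn
  have hex : ∃ i, (v.1 i, v.2 i) ≠ 0 := by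
    by_contra hcon
    push Not at hcon
    exact hv (Prod.ext (funext fun i => (Prod.mk_eq_zero.1 (hcon i)).1)
      (funext fun i => (Prod.mk_eq_zero.1 (hcon i)).2))
  obtain ⟨i, hi⟩ := hex
  by_cases hj : ∃ j, j ≠ i ∧ (v.1 j, v.2 j) ≠ 0
  · obtain ⟨j, hji, hj⟩ := hj
    -- One-qubit transvections normalize the frame to `X` at `i` and `Z` at `j`. This anticommutes
    -- with `Z_i Z_j`, and adding that pair gives `Y` at `i` and the identity at `j`, so the support
    -- loses `j` but does not become empty.
    refine mem_of_change hi (a := 1) (b := 0) (by decide) ?_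
    set v' := v + (Pi.single i (v.1 i + 1), Pi.single i (v.2 i + 0)) with hv'
    have e1 : v'.1 j = v.1 j := by simp [hv', hji]
    have e2 : v'.2 j = v.2 j := by simp [hv', hji]
    refine mem_of_change (i := j) (by rwa [e1, e2]) (a := 0) (b := 1) (by decide) ?_
    set w := v' + (Pi.single j (v'.1 j + 0), Pi.single j (v'.2 j + 1)) with hw
    have f1 : w.1 i = 1 := by simp [hw, hv', hji.symm, ← add_assoc]
    have f2 : w.2 i = 0 := by simp [hw, hv', hji.symm]
    have f3 : w.1 j = 0 := by simp [hw]
    have f4 : w.2 j = 1 := by simp [hw, ← add_assoc]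
    have f5 : ∀ k, k ≠ i → k ≠ j → w.1 k = v.1 k ∧ w.2 k = v.2 k := by
      intro k hki hkj
      simp [hw, hv', hki, hkj]
    refine mem_of_add_mem_transvections (pair_ZZ_mem hji) ?_ ?_
    · simp [symp, f1, f3]
    · refine ih _ (Finset.card_lt_card ?_) _ ?_ rfl
      · refine Finset.ssubset_iff_subset_ne.2 ⟨fun k hk => ?_, fun heq => ?_⟩
        · by_cases hkj : k = j
          · subst hkj
            simpa [frameSupport] using hj
          · by_cases hki : k = i
            · subst hki
              simpa [frameSupport] using hi
            · have := f5 k hki hkj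
              simpa [frameSupport, hkj, hki, this.1, this.2] using hk
        · have : j ∈ frameSupport v := by simpa [frameSupport] using hj
          rw [← heq] at this
          simp [frameSupport, f3, f4, hji] at this
      · intro h0
        have := congrFun (congrArg Prod.fst h0) i
        simp [f1] at this
  · push Not at hj
    have e : v = (Pi.single i (v.1 i), Pi.single i (v.2 i)) := by
      refine Prod.ext (funext fun k => ?_) (funext fun k => ?_)
      · by_cases hk : k = i
        · subst hk; simp
        · simpa [hk] using (Prod.mk_eq_zero.1 (hj k hk)).1
      · by_cases hk : k = i
        · subst hk; simp
        · simpa [hk] using (Prod.mk_eq_zero.1 (hj k hk)).2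
    rw [e]
    exact single_mem hi

theorem realized_transvection (u : Frame (Fin 7)) : Realized (transvection u) := by
  by_cases hu : u = 0
  · refine ⟨1, one_mem _, fun v => ?_⟩
    rw [hu, transvection, smul_zero, add_zero]
    exact acts_one v
  · exact mem_transvections_of_ne_zero u hu

/-! ### Scalars and Pauli operators -/

theorem scalar_mem_logicalGroup {L : Matrix.unitaryGroup (Fin 7 → Bit) ℂ} {z : ℂ}
    (h : (L : Op (Fin 7) (Fin 7)) = z • 1) : L ∈ logicalGroup := by
  have hz : star z * z = 1 := by
    have h1 := Matrix.UnitaryGroup.star_mul_self L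
    rw [h, star_smul, star_one, Matrix.smul_mul, Matrix.mul_smul, Matrix.one_mul, smul_smul] at h1
    have := congrFun (congrFun h1 0) 0
    simpa using this
  -- The scalar `ζ` applied to each of the 15 qubits is the global phase `ζ ^ 15`, so a 15th root of
  -- `z` is needed; it has modulus 1 because `z` has.
  obtain ⟨ζ, hζ⟩ := IsAlgClosed.exists_pow_nat_eq z (n := 15) (by norm_num)
  have hnz : ‖z‖ = 1 := by
    have h2 : ‖z‖ * ‖z‖ = 1 := by
      have := congrArg norm hz
      rwa [norm_mul, norm_star, norm_one] at this
    nlinarith [norm_nonneg z]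
  have hnζ : ‖ζ‖ = 1 := by
    have := congrArg norm hζ
    rw [norm_pow, hnz] at this
    exact (pow_eq_one_iff_of_nonneg (norm_nonneg ζ) (by norm_num)).1 this
  have hu : (ζ • 1 : Op (Fin 1) (Fin 1)) ∈ Matrix.unitaryGroup (Fin 1 → Bit) ℂ := by
    rw [Matrix.mem_unitaryGroup_iff, star_smul, star_one, Matrix.smul_mul, Matrix.mul_smul,
      Matrix.one_mul, smul_smul, Complex.star_def, Complex.mul_conj, Complex.normSq_eq_norm_sq,
      hnζ]
    simp
  have hc : (⟨ζ • 1, hu⟩ : Matrix.unitaryGroup (Fin 1 → Bit) ℂ) ∈ cliffordGroup (Fin 1) :=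
    mem_cliffordGroup_iff.2 fun v => ⟨v, 1, by simp⟩
  refine ⟨⟨transversalOp (ζ • 1), transversalOp_mem_unitary ⟨ζ • 1, hu⟩⟩,
    Subgroup.subset_closure (Or.inl ⟨_, hc, rfl⟩), ?_⟩
  show transversalOp (ζ • 1) * encoder = _
  rw [transversalOp_smul_one, h, Fintype.card_fin, hζ, Matrix.smul_mul, Matrix.mul_smul,
    Matrix.one_mul, Matrix.mul_one]

/-- The logical group contains the Pauli operator of `v` up to a scalar. -/
def RealizedPauli (v : Frame (Fin 7)) : Prop :=
  ∃ L ∈ logicalGroup, ∃ c : ℂ, (L : Op (Fin 7) (Fin 7)) = c • pauli v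

theorem RealizedPauli.add {v w : Frame (Fin 7)} (hv : RealizedPauli v) (hw : RealizedPauli w) :
    RealizedPauli (v + w) := by
  obtain ⟨L, hL, c, h⟩ := hv
  obtain ⟨M, hM, c', h'⟩ := hw
  refine ⟨L * M, mul_mem hL hM, c * c' * sgn (v.2 ⬝ᵥ w.1), ?_⟩
  rw [Matrix.UnitaryGroup.mul_val, h, h', Matrix.smul_mul, Matrix.mul_smul, pauli_mul, smul_smul,
    smul_smul, mul_assoc]

theorem RealizedPauli.map {v : Frame (Fin 7)} (hv : RealizedPauli v)
    {f : Frame (Fin 7) → Frame (Fin 7)} (hf : Realized f) : RealizedPauli (f v) := by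
  obtain ⟨L, hL, c, h⟩ := hv
  obtain ⟨M, hM, hM'⟩ := hf
  obtain ⟨c', hc'⟩ := hM' v
  refine ⟨M * L * M⁻¹, mul_mem (mul_mem hM hL) (inv_mem hM), c * c', ?_⟩
  rw [Matrix.UnitaryGroup.mul_val, Matrix.UnitaryGroup.mul_val, h, Matrix.mul_smul,
    Matrix.smul_mul, unitary_conj_eq hc', smul_smul]

theorem transversalOp_frameX {ι : Type} [Fintype ι] [DecidableEq ι] :
    (transversalOp (pauli frameX) : Op ι ι) = pauli (1, 0) := by
  ext x y
  have hf : ∀ a b : Bit, ((fun _ : Fin 1 => a) = (fun _ => b) + frameX.1) ↔ a = b + 1 := fun a b =>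
    ⟨fun h => congrFun h 0, fun h => funext fun _ => h⟩
  simp only [transversalOp, of_apply, pauli_apply, hf]
  by_cases h : x = y + 1
  · rw [if_pos h]
    simp [h, frameX]
  · rw [if_neg h]
    obtain ⟨i, hi⟩ := Function.ne_iff.1 h
    exact Finset.prod_eq_zero (Finset.mem_univ i) (if_neg hi)

/-- Checks have even weight and logical supports have odd weight, so `X` on all physical qubits is
`X` on all logical qubits. -/
theorem pauliX_all_mul_encoder :
    pauli ((1, 0) : Frame (Fin 15)) * encoder = encoder * pauli ((1, 0) : Frame (Fin 7)) := by
  have h1 : checks *ᵥ (1 : Fin 15 → Bit) = 0 := by decide +kernel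
  have h2 : logicals *ᵥ (1 : Fin 15 → Bit) = 1 := by decide +kernel
  have h := pauli_mul_encoder (v := (1, 0)) h1 (mulVec_zero _)
  rw [h2, mulVec_zero] at h
  exact h

theorem realizedPauli_X : RealizedPauli (1, 0) := by
  have hc : (⟨pauli frameX, pauli_mem_unitary _⟩ : Matrix.unitaryGroup (Fin 1 → Bit) ℂ) ∈
      cliffordGroup (Fin 1) :=
    mem_cliffordGroup_iff.2 fun v => ⟨v, sgn (symp frameX v), pauli_comm _ _⟩
  have hg : (⟨pauli (1, 0), pauli_mem_unitary _⟩ : Matrix.unitaryGroup (Fin 15 → Bit) ℂ) ∈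
      generators := Or.inl ⟨_, hc, transversalOp_frameX.symm⟩
  exact ⟨⟨pauli (1, 0), pauli_mem_unitary _⟩, ⟨_, Subgroup.subset_closure hg,
    pauliX_all_mul_encoder⟩, 1, (one_smul _ _).symm⟩

theorem exists_symp_eq_one {ι : Type} [Fintype ι] [DecidableEq ι] {v : Frame ι} (hv : v ≠ 0) :
    ∃ y, symp y v = 1 := by
  by_contra hcon
  push Not at hcon
  have h0 : ∀ y, symp y v = 0 := fun y => (bit_cases _).resolve_right (hcon y)
  refine hv (Prod.ext (funext fun i => ?_) (funext fun i => ?_))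
  · have := h0 (0, Pi.single i 1)
    simpa [symp] using this
  · have := h0 (Pi.single i 1, 0)
    simpa [symp] using this

/-- If `u` anticommutes with `x = X^{⊗7}`, the transvection along `u` takes `x` to `x + u`, so `u`
is a sum of two realized frames. A frame that commutes with `x` is a sum of two frames that
anticommute with it. -/
theorem realizedPauli (v : Frame (Fin 7)) : RealizedPauli v := by
  have h1 : ∀ u : Frame (Fin 7), symp (1, 0) u = 1 → RealizedPauli u := by
    intro u hu
    have := (realizedPauli_X.map (realized_transvection u)).add realizedPauli_X
    rw [transvection, hu, one_smul, add_comm _ u, frame_add_add_cancel] at this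
    exact this
  rcases bit_cases (symp (1, 0) v) with h | h
  · obtain ⟨u, hu⟩ := exists_symp_eq_one (v := ((1, 0) : Frame (Fin 7)))
      (by intro h0; simpa using congrFun (congrArg Prod.fst h0) 0)
    rw [symp_comm] at hu
    have := (h1 (v + u) (by rw [symp_add_right, h, hu, zero_add])).add (h1 u hu)
    rwa [frame_add_add_cancel] at this
  · exact h1 v h

/-- Schur's lemma for the Pauli operators: commuting with every `Z` forces a diagonal matrix, and
commuting with every `X` makes the diagonal constant. -/
theorem eq_scalar_of_commute {ι : Type} [Fintype ι] [DecidableEq ι] {M : Op ι ι}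
    (hX : ∀ i, M * pauli (Pi.single i 1, 0) = pauli (Pi.single i 1, 0) * M)
    (hZ : ∀ i, M * pauli (0, Pi.single i 1) = pauli (0, Pi.single i 1) * M) :
    M = M 0 0 • 1 := by
  have hoff : ∀ x y, x ≠ y → M x y = 0 := by
    intro x y hxy
    obtain ⟨i, hi⟩ := Function.ne_iff.1 hxy
    have := congrFun (congrFun (hZ i) x) y
    rw [mul_pauli_apply, pauli_mul_apply] at this
    simp only [add_zero, single_dotProduct, one_mul] at this
    have hne : sgn (y i) - sgn (x i) ≠ 0 := sub_ne_zero.2 fun h => hi (sgn_injective h).symm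
    have h0 : (sgn (y i) - sgn (x i)) * M x y = 0 := by linear_combination this
    exact (mul_eq_zero.1 h0).resolve_left hne
  have hshift : ∀ i x, M (x + Pi.single i 1) (x + Pi.single i 1) = M x x := by
    intro i x
    have := congrFun (congrFun (hX i) x) (x + Pi.single i 1)
    rw [mul_pauli_apply, pauli_mul_apply] at this
    simpa using this.symm
  have hdiag : ∀ x, M x x = M 0 0 := by
    intro x
    have key : ∀ s : Finset ι, M (∑ i ∈ s, Pi.single i (x i)) (∑ i ∈ s, Pi.single i (x i)) =
        M 0 0 := by
      intro s
      induction s using Finset.induction_on with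
      | empty => simp
      | insert i s hi ih =>
        rw [Finset.sum_insert hi, add_comm]
        rcases bit_cases (x i) with h | h
        · rw [h, Pi.single_zero, add_zero, ih]
        · rw [h, hshift, ih]
    have := key Finset.univ
    rwa [Finset.univ_sum_single] at this
  ext x y
  rw [Matrix.smul_apply, Matrix.one_apply]
  by_cases h : x = y
  · subst h
    simp [hdiag]
  · simp [h, hoff x y h]

/-- Conjugation by `L` only changes signs of Pauli operators. A suitable Pauli operator produces the
same signs on the one-qubit `X` and `Z`, so its product with `L` is a scalar. -/
theorem mem_logicalGroup_of_acts_self {L : Matrix.unitaryGroup (Fin 7 → Bit) ℂ}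
    (h : ∀ v, Acts (L : Op (Fin 7) (Fin 7)) v v) : L ∈ logicalGroup := by
  have hs : ∀ v, ∃ s : Bit, (L : Op (Fin 7) (Fin 7)) * pauli v =
      sgn s • (pauli v * (L : Op (Fin 7) (Fin 7))) := by
    intro v
    obtain ⟨c, hc⟩ := h v
    have h2 := mul_pauli_mul_pauli hc hc
    rw [pauli_mul_self, Matrix.mul_smul, Matrix.smul_mul, Matrix.mul_one, Matrix.one_mul,
      smul_comm] at h2
    have h3 := congrArg (· * ((L⁻¹ : Matrix.unitaryGroup (Fin 7 → Bit) ℂ) : Op (Fin 7) (Fin 7))) h2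
    simp only [Matrix.smul_mul, unitary_mul_star] at h3
    have h4 := congrFun (congrFun h3 0) 0
    simp only [Matrix.smul_apply, Matrix.one_apply_eq, smul_eq_mul, mul_one] at h4
    have h5 : c * c = 1 := by
      refine mul_right_cancel₀ (sgn_ne_zero (v.2 ⬝ᵥ v.1)) ?_
      rw [one_mul]
      rw [mul_comm]
      exact h4.symm
    rcases mul_self_eq_one_iff.1 h5 with rfl | rfl
    · exact ⟨0, by rw [sgn_zero, hc]⟩
    · exact ⟨1, by rw [sgn_one, hc]⟩
  choose s hs using hs
  -- The `X` part of `t` detects the signs of the `Z` operators and its `Z` part those of the `X`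
  -- operators, hence the exchange.
  let t : Frame (Fin 7) := (fun i => s (0, Pi.single i 1), fun i => s (Pi.single i 1, 0))
  obtain ⟨T, hT, c, hc⟩ := realizedPauli t
  have hcomm : ∀ x, symp t x = s x → (L : Op (Fin 7) (Fin 7)) * pauli t * pauli x =
      pauli x * ((L : Op (Fin 7) (Fin 7)) * pauli t) := by
    intro x hx
    rw [Matrix.mul_assoc, pauli_comm t x, Matrix.mul_smul, ← Matrix.mul_assoc, hs x,
      Matrix.smul_mul, smul_smul, hx, sgn_mul_self, one_smul, Matrix.mul_assoc]
  have hscal := eq_scalar_of_commute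
    (fun i => hcomm (Pi.single i 1, 0) (by simp [symp, t]))
    (fun i => hcomm (0, Pi.single i 1) (by simp [symp, t]))
  have hLT : L * T ∈ logicalGroup := by
    refine scalar_mem_logicalGroup (z := c * ((L : Op (Fin 7) (Fin 7)) * pauli t) 0 0) ?_
    rw [Matrix.UnitaryGroup.mul_val, hc, Matrix.mul_smul]
    conv_lhs => rw [hscal]
    rw [smul_smul]
  have := mul_mem hLT (inv_mem hT)
  rwa [mul_assoc, mul_inv_cancel, mul_one] at this

/-! ### Reduction of a Clifford operator by transvections -/

section Reduction

variable {ι : Type} [Fintype ι] [DecidableEq ι] {g : Frame ι → Frame ι}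

/-- If `v` and `g v` anticommute, the transvection along `v + g v` takes `g v` back to `v`. A fixed
point `f` of `g` pairs equally with `v` and `g v`, so it commutes with the sum and remains fixed. -/
theorem transvection_increases_fixed (hs : ∀ v w, symp (g v) (g w) = symp v w) {v : Frame ι}
    (hv : symp v (g v) = 1) :
    (∀ f, g f = f → transvection (v + g v) (g f) = f) ∧ transvection (v + g v) (g v) = v := by
  constructor
  · intro f hf
    have : symp f (v + g v) = 0 := by
      rw [symp_add_right]
      conv_lhs => rw [← hs f v, hf]
      exact bit_add_self _
    rw [hf, transvection, this, zero_smul, add_zero]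
  · rw [transvection, symp_add_right, symp_self, add_zero, symp_comm, hv, one_smul, add_comm v,
      ← add_assoc, frame_add_self, zero_add]

theorem transvection_symp_eq (u v w : Frame ι) :
    symp (transvection u v) (transvection u w) = symp v w := by
  have hsl : ∀ (c : Bit) (x y : Frame ι), symp (c • x) y = c * symp x y := fun c x y => by
    rcases bit_cases c with rfl | rfl <;> simp
  have hsr : ∀ (c : Bit) (x y : Frame ι), symp x (c • y) = c * symp x y := fun c x y => by
    rw [symp_comm, hsl, symp_comm]
  simp only [transvection, symp_add_left, symp_add_right, hsl, hsr, symp_self]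
  rw [symp_comm u w]
  generalize symp v w = p
  generalize symp v u = q
  generalize symp w u = r
  revert p q r
  decide

/-- The remaining case, where every `v` commutes with its image: one preliminary transvection, along
`g y + y` with `y` chosen to anticommute with `v + g v`, keeps the fixed points and makes the
previous lemma applicable. -/
theorem exists_transvection (ha : ∀ v w, g (v + w) = g v + g w)
    (hs : ∀ v w, symp (g v) (g w) = symp v w) (h0 : ∀ v, symp v (g v) = 0) {v : Frame ι}
    (hv : g v ≠ v) :
    ∃ u, (∀ f, g f = f → transvection u (g f) = f) ∧ symp v (transvection u (g v)) = 1 := by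
  obtain ⟨y, hy⟩ := exists_symp_eq_one (v := v + g v)
    (fun h => hv (frame_eq_of_add_eq_zero h).symm)
  rw [symp_add_right] at hy
  refine ⟨g y + y, fun f hf => ?_, ?_⟩
  · have : symp f (g y + y) = 0 := by
      rw [symp_add_right]
      conv_lhs =>
        arg 2
        rw [← hs f y, hf]
      exact bit_add_self _
    rw [hf, transvection, this, zero_smul, add_zero]
  -- Polarizing `symp v (g v) = 0` gives `symp v (g y) = symp y (g v)`, so the new pairing equals
  -- `symp y (v + g v) = 1`.
  · have hpol := h0 (v + y)
    rw [ha, symp_add_left, symp_add_right, symp_add_right, h0, h0, zero_add, add_zero] at hpol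
    have h1 : symp (g v) (g y + y) = 1 := by
      rw [symp_add_right, hs, symp_comm v y, symp_comm (g v) y, hy]
    rw [transvection, h1, one_smul, symp_add_right, h0, zero_add, symp_add_right, ← hy,
      symp_comm v y]
    rw [add_comm (symp y v)]
    congr 1
    exact (CharTwo.add_eq_zero.1 hpol)

end Reduction

/-- Strong induction on the number of frames that are moved: one or two realized transvections fix a
further frame without losing any fixed one. When nothing is moved, only signs and a phase are left.
-/
theorem mem_logicalGroup_of_acts (n : ℕ) : ∀ (L : Matrix.unitaryGroup (Fin 7 → Bit) ℂ)
    (g : Frame (Fin 7) → Frame (Fin 7)), (∀ v, Acts (L : Op (Fin 7) (Fin 7)) v (g v)) →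
    (Finset.univ.filter fun v => g v ≠ v).card = n → L ∈ logicalGroup := by
  induction n using Nat.strong_induction_on with
  | _ n ih =>
  intro L g hg hn
  have ha : ∀ v w, g (v + w) = g v + g w := fun v w => (hg _).unique ((hg v).add (hg w))
  have hs : ∀ v w, symp (g v) (g w) = symp v w := fun v w => (hg v).symp_eq (hg w)
  by_cases hfix : ∀ v, g v = v
  · exact mem_logicalGroup_of_acts_self fun v => by simpa only [hfix] using hg v
  have hstep : ∀ h : Frame (Fin 7) → Frame (Fin 7), Realized h →
      (∀ f, g f = f → h (g f) = f) → (∃ v, g v ≠ v ∧ h (g v) = v) → L ∈ logicalGroup := by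
    rintro h ⟨M, hM, hMh⟩ h1 ⟨v, hv1, hv2⟩
    have hlt : (Finset.univ.filter fun v => h (g v) ≠ v).card < n := by
      rw [← hn]
      refine Finset.card_lt_card (Finset.ssubset_iff_subset_ne.2 ⟨fun f hf => ?_, fun heq => ?_⟩)
      · simp only [Finset.mem_filter, Finset.mem_univ, true_and] at hf ⊢
        exact fun hgf => hf (h1 f hgf)
      · have : v ∈ Finset.univ.filter fun v => g v ≠ v := by simpa using hv1
        rw [← heq] at this
        simp [hv2] at this
    have := ih _ hlt (M * L) (fun v => h (g v)) (fun v => (hMh _).mul (hg v)) rfl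
    have h2 := mul_mem (inv_mem hM) this
    rwa [← mul_assoc, inv_mul_cancel, one_mul] at h2
  by_cases hne : ∃ v, symp v (g v) = 1
  · obtain ⟨v, hv⟩ := hne
    obtain ⟨h1, h2⟩ := transvection_increases_fixed hs hv
    refine hstep _ (realized_transvection _) h1 ⟨v, fun h => ?_, h2⟩
    rw [h, symp_self] at hv
    exact zero_ne_one hv
  · push Not at hne hfix
    obtain ⟨v, hv⟩ := hfix
    have h0 : ∀ v, symp v (g v) = 0 := fun v => (bit_cases _).resolve_right (hne v)
    obtain ⟨u, hu1, hu2⟩ := exists_transvection ha hs h0 hv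
    obtain ⟨h1, h2⟩ := transvection_increases_fixed (g := fun v => transvection u (g v))
      (fun v w => by rw [transvection_symp_eq, hs]) hu2
    exact hstep _ ((realized_transvection _).comp (realized_transvection u))
      (fun f hf => h1 f (hu1 f hf)) ⟨v, hv, h2⟩

/-! ### The logical Clifford group -/

theorem implements_generator {U : Matrix.unitaryGroup (Fin 15 → Bit) ℂ} (hU : U ∈ generators) :
    ∃ f, Implements U f := by
  rcases hU with ⟨u, hu, h⟩ | ⟨σ, hσ, h⟩ | h
  · obtain ⟨w, hw⟩ := mem_cliffordGroup_iff.1 hu frameX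
    obtain ⟨w', hw'⟩ := mem_cliffordGroup_iff.1 hu frameZ
    exact ⟨_, implements_transversalOp hu hw hw' h⟩
  · rcases hσ with rfl | rfl | rfl
    · exact ⟨_, implements_perm₁ h⟩
    · exact ⟨_, implements_perm₂ h⟩
    · exact ⟨_, implements_perm₃ h⟩
  · exact ⟨_, implements_roundRobin h⟩

theorem exists_logical_clifford {U : Matrix.unitaryGroup (Fin 15 → Bit) ℂ}
    (hU : U ∈ generators) : ∃ L ∈ cliffordGroup (Fin 7),
      (U : Op (Fin 15) (Fin 15)) * encoder = encoder * (L : Op (Fin 7) (Fin 7)) := by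
  obtain ⟨f, L, hL, h⟩ := implements_generator hU
  exact ⟨L, mem_cliffordGroup_iff.2 fun v => ⟨_, h v⟩, hL⟩

theorem logicalGroup_eq : logicalGroup = cliffordGroup (Fin 7) := by
  refine le_antisymm ?_ fun L hL => ?_
  · rintro L ⟨U, hU, hL⟩
    have : ∃ L' ∈ cliffordGroup (Fin 7),
        (U : Op (Fin 15) (Fin 15)) * encoder = encoder * (L' : Op (Fin 7) (Fin 7)) := by
      clear hL
      induction hU using Subgroup.closure_induction with
      | mem U hU => exact exists_logical_clifford hU
      | one => exact ⟨1, one_mem _, by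
          rw [Matrix.UnitaryGroup.one_val, Matrix.UnitaryGroup.one_val, Matrix.one_mul,
            Matrix.mul_one]⟩
      | mul U V _ _ hU hV =>
        obtain ⟨M, hM, h⟩ := hU
        obtain ⟨N, hN, h'⟩ := hV
        refine ⟨M * N, mul_mem hM hN, ?_⟩
        rw [Matrix.UnitaryGroup.mul_val, Matrix.UnitaryGroup.mul_val, Matrix.mul_assoc, h',
          ← Matrix.mul_assoc, h, Matrix.mul_assoc]
      | inv U _ hU =>
        obtain ⟨M, hM, h⟩ := hU
        refine ⟨M⁻¹, inv_mem hM, ?_⟩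
        have := congrArg (fun N : Op (Fin 15) (Fin 7) =>
          ((U⁻¹ : Matrix.unitaryGroup (Fin 15 → Bit) ℂ) : Op (Fin 15) (Fin 15)) * N *
            ((M⁻¹ : Matrix.unitaryGroup (Fin 7 → Bit) ℂ) : Op (Fin 7) (Fin 7))) h
        simp only [← Matrix.mul_assoc, unitary_star_mul, Matrix.one_mul] at this
        rw [this, Matrix.mul_assoc, Matrix.mul_assoc, unitary_mul_star, Matrix.mul_one]
    obtain ⟨L', hL', h'⟩ := this
    -- The encoder can be cancelled, so the logical operator of `U` is unique.
    have e : L = L' := Subtype.ext (encoder_mul_left_cancel (hL.symm.trans h'))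
    exact e ▸ hL'
  · choose g hg using mem_cliffordGroup_iff.1 hL
    exact mem_logicalGroup_of_acts _ L g hg rfl

/-! ## The code block and the ancilla qubits -/

/-- The tensor product of an operator on the code block and an operator on the ancilla qubits. -/
def tensorOp (D : Op (Fin 15) (Fin 15)) (C : Op (Fin 2) (Fin 2)) : Op Qubit Qubit :=
  Matrix.of fun x y => D (x ∘ Sum.inl) (y ∘ Sum.inl) * C (x ∘ Sum.inr) (y ∘ Sum.inr)

theorem onData_eq (D : Op (Fin 15) (Fin 15)) : onData D = tensorOp D 1 := rfl

theorem sum_qubit (f : (Qubit → Bit) → ℂ) :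
    ∑ x, f x = ∑ x : Fin 15 → Bit, ∑ y : Fin 2 → Bit, f (Sum.elim x y) := by
  rw [← Fintype.sum_prod_type' (f := fun x y => f (Sum.elim x y))]
  exact Fintype.sum_equiv (Equiv.sumArrowEquivProdArrow (Fin 15) (Fin 2) Bit) _ _ fun x => by
    congr 1
    exact (Sum.elim_comp_inl_inr x).symm

theorem tensorOp_mul_tensorAnc {κ : Type} (D : Op (Fin 15) (Fin 15)) (C : Op (Fin 2) (Fin 2))
    (M : Op (Fin 15) κ) (A : Op (Fin 2) (Fin 2)) :
    tensorOp D C * tensorAnc M A = tensorAnc (D * M) (C * A) := by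
  ext x y
  simp only [Matrix.mul_apply, tensorOp, tensorAnc, of_apply, sum_qubit, Sum.elim_comp_inl,
    Sum.elim_comp_inr]
  rw [Finset.sum_mul_sum]
  exact Finset.sum_congr rfl fun _ _ => Finset.sum_congr rfl fun _ _ => by ring

theorem tensorOp_mul (D D' : Op (Fin 15) (Fin 15)) (C C' : Op (Fin 2) (Fin 2)) :
    tensorOp D C * tensorOp D' C' = tensorOp (D * D') (C * C') := by
  ext x y
  simp only [Matrix.mul_apply, tensorOp, of_apply, sum_qubit, Sum.elim_comp_inl,
    Sum.elim_comp_inr]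
  rw [Finset.sum_mul_sum]
  exact Finset.sum_congr rfl fun _ _ => Finset.sum_congr rfl fun _ _ => by ring

theorem onData_mul_tensorAnc {κ : Type} (D : Op (Fin 15) (Fin 15)) (M : Op (Fin 15) κ)
    (A : Op (Fin 2) (Fin 2)) : onData D * tensorAnc M A = tensorAnc (D * M) A := by
  rw [onData_eq, tensorOp_mul_tensorAnc, Matrix.one_mul]

theorem onData_mul (D D' : Op (Fin 15) (Fin 15)) : onData D * onData D' = onData (D * D') := by
  rw [onData_eq, onData_eq, tensorOp_mul, Matrix.one_mul]
  rfl

theorem tensorAnc_smul {κ : Type} (c : ℂ) (M : Op (Fin 15) κ) (A : Op (Fin 2) (Fin 2)) :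
    c • tensorAnc M A = tensorAnc M (c • A) := by
  ext x y
  simp only [tensorAnc, Matrix.smul_apply, of_apply, smul_eq_mul]
  ring

theorem smul_tensorAnc {κ : Type} (c : ℂ) (M : Op (Fin 15) κ) (A : Op (Fin 2) (Fin 2)) :
    tensorAnc (c • M) A = tensorAnc M (c • A) := by
  ext x y
  simp only [tensorAnc, Matrix.smul_apply, of_apply, smul_eq_mul]
  ring

theorem tensorAnc_zero {κ : Type} (M : Op (Fin 15) κ) : tensorAnc M 0 = 0 := by
  ext x y
  simp [tensorAnc]

/-- The part of a frame on the code block. -/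
def dataFrame (v : Frame Qubit) : Frame (Fin 15) := (v.1 ∘ Sum.inl, v.2 ∘ Sum.inl)

/-- The part of a frame on the ancilla qubits. -/
def ancFrame (v : Frame Qubit) : Frame (Fin 2) := (v.1 ∘ Sum.inr, v.2 ∘ Sum.inr)

theorem qubit_ext_iff {x y : Qubit → Bit} :
    x = y ↔ x ∘ Sum.inl = y ∘ Sum.inl ∧ x ∘ Sum.inr = y ∘ Sum.inr := by
  refine ⟨fun h => h ▸ ⟨rfl, rfl⟩, fun h => funext fun q => ?_⟩
  rcases q with i | i
  · exact congrFun h.1 i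
  · exact congrFun h.2 i

theorem pauli_eq_tensorOp (v : Frame Qubit) :
    pauli v = tensorOp (pauli (dataFrame v)) (pauli (ancFrame v)) := by
  ext x y
  simp only [tensorOp, of_apply, pauli_apply, qubit_ext_iff (x := x), dataFrame, ancFrame]
  have h1 : v.2 ⬝ᵥ y = (v.2 ∘ Sum.inl) ⬝ᵥ (y ∘ Sum.inl) + (v.2 ∘ Sum.inr) ⬝ᵥ (y ∘ Sum.inr) := by
    simp [dotProduct, Fintype.sum_sum_type]
  have h2 : (y + v.1) ∘ Sum.inl = y ∘ Sum.inl + v.1 ∘ Sum.inl := rfl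
  have h3 : (y + v.1) ∘ Sum.inr = y ∘ Sum.inr + v.1 ∘ Sum.inr := rfl
  rw [h1, h2, h3, sgn_add]
  by_cases ha : x ∘ Sum.inl = y ∘ Sum.inl + v.1 ∘ Sum.inl <;>
    by_cases hb : x ∘ Sum.inr = y ∘ Sum.inr + v.1 ∘ Sum.inr <;> simp [ha, hb]

theorem pauli_mul_tensorAnc {κ : Type} (v : Frame Qubit) (M : Op (Fin 15) κ)
    (A : Op (Fin 2) (Fin 2)) : pauli v * tensorAnc M A =
      tensorAnc (pauli (dataFrame v) * M) (pauli (ancFrame v) * A) := by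
  rw [pauli_eq_tensorOp, tensorOp_mul_tensorAnc]

/-! ## A criterion for fault tolerance -/

theorem list_prod_mul {α m n : Type} [Fintype m] [DecidableEq m] {f : α → Matrix m m ℂ}
    {c : α → ℂ} {M : Matrix m n ℂ} (l : List α) (h : ∀ a ∈ l, f a * M = c a • M) :
    (l.map f).prod * M = (l.map c).prod • M := by
  induction l with
  | nil => simp
  | cons a l ih =>
    rw [List.map_cons, List.prod_cons, List.map_cons, List.prod_cons, Matrix.mul_assoc,
      ih fun b hb => h b (List.mem_cons_of_mem _ hb), Matrix.mul_smul, h a List.mem_cons_self,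
      smul_smul, mul_comm]

theorem half_projector_mul {m n : Type} [Fintype m] [DecidableEq m] {S : Matrix m m ℂ}
    {M : Matrix m n ℂ} {s t : Bit} (h : S * M = sgn t • M) :
    ((1 / 2 : ℂ) • (1 + sgn s • S)) * M = (if s = t then (1 : ℂ) else 0) • M := by
  rw [Matrix.smul_mul, Matrix.add_mul, Matrix.one_mul, Matrix.smul_mul, h, smul_smul]
  have : M + (sgn s * sgn t) • M = (1 + sgn s * sgn t) • M := by rw [add_smul, one_smul]
  rw [this, smul_smul]
  congr 1
  rcases bit_cases s with rfl | rfl <;> rcases bit_cases t with rfl | rfl <;> norm_num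

theorem pauliX_check_mul_encoder (i : Fin 4) : pauli (checks i, 0) * encoder = encoder :=
  pauli_mul_encoder_of_stab (w := (checks i, 0)) (checks_row i) ⟨mulVec_zero _, mulVec_zero _⟩

theorem pauliZ_check_mul_encoder (i : Fin 4) : pauli (0, checks i) * encoder = encoder :=
  pauli_mul_encoder_of_stab (w := (0, checks i)) ⟨mulVec_zero _, mulVec_zero _⟩ (checks_row i)

/-- A state with the Pauli error `v` is an eigenvector of every stabilizer: the `X` stabilizers see
the `Z` part of `v`, and the `Z` stabilizers its `X` part. The projector is therefore `1` or `0` on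
it. -/
theorem syndromeProj_mul {κ : Type} (s : Syndrome) (v : Frame (Fin 15))
    (L : Matrix (Fin 7 → Bit) κ ℂ) :
    syndromeProj s * (pauli v * (encoder * L)) =
      (if s = (checks *ᵥ v.2, checks *ᵥ v.1) then (1 : ℂ) else 0) •
        (pauli v * (encoder * L)) := by
  have hX : ∀ i, stabX i * (pauli v * (encoder * L)) =
      sgn ((checks *ᵥ v.2) i) • (pauli v * (encoder * L)) := by
    intro i
    have e : symp (checks i, 0) v = (checks *ᵥ v.2) i := by
      rw [symp, zero_dotProduct, add_zero]
      rfl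
    rw [stabX, pauliOp_eq_pauli, ← Matrix.mul_assoc, pauli_comm, e, Matrix.smul_mul, Matrix.mul_assoc,
      ← Matrix.mul_assoc _ encoder, pauliX_check_mul_encoder]
  have hZ : ∀ i, stabZ i * (pauli v * (encoder * L)) =
      sgn ((checks *ᵥ v.1) i) • (pauli v * (encoder * L)) := by
    intro i
    have e : symp (0, checks i) v = (checks *ᵥ v.1) i := by
      rw [symp, zero_dotProduct, zero_add]
      rfl
    rw [stabZ, pauliOp_eq_pauli, ← Matrix.mul_assoc, pauli_comm, e, Matrix.smul_mul, Matrix.mul_assoc,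
      ← Matrix.mul_assoc _ encoder, pauliZ_check_mul_encoder]
  rw [syndromeProj, Matrix.mul_assoc, List.ofFn_eq_map, List.ofFn_eq_map,
    list_prod_mul _ fun i _ => half_projector_mul (hZ i), Matrix.mul_smul,
    list_prod_mul _ fun i _ => half_projector_mul (hX i), smul_smul]
  congr 1
  have hprod : ∀ a b : Fin 4 → Bit,
      ((List.finRange 4).map fun i => if a i = b i then (1 : ℂ) else 0).prod =
        if a = b then 1 else 0 := by
    intro a b
    split_ifs with h
    · subst h; simp
    · obtain ⟨i, hi⟩ := Function.ne_iff.1 h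
      exact List.prod_eq_zero (List.mem_map.2 ⟨i, List.mem_finRange i, if_neg hi⟩)
  rw [hprod, hprod]
  by_cases h1 : s.1 = checks *ᵥ v.2 <;> by_cases h2 : s.2 = checks *ᵥ v.1 <;>
    simp [Prod.ext_iff, h1, h2]

/-- The correction is any possible error compatible with the record and the syndrome. It differs
from the actual error by an operator with trivial syndrome and trivial logical parities, that is, by
a stabilizer. Executions of amplitude zero need no condition. -/
theorem faultTolerant_of_errors {p : Proc Qubit} {U : Op (Fin 15) (Fin 15)}
    {L : Op (Fin 7) (Fin 7)} (hU : U * encoder = encoder * L)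
    (errors : List Bit → Frame (Fin 15) → Prop)
    (h0 : ∀ r K, Run 0 p r K → ∃ A, K * tensorAnc encoder 1 = tensorAnc (U * encoder) A)
    (h1 : ∀ n r K, n ≤ 1 → Run n p r K → K * tensorAnc encoder 1 = 0 ∨ ∃ v A, errors r v ∧
      K * tensorAnc encoder 1 = tensorAnc (pauli v * (U * encoder)) A)
    (hc : ∀ r v w, errors r v → errors r w → checks *ᵥ v.1 = checks *ᵥ w.1 →
      checks *ᵥ v.2 = checks *ᵥ w.2 →
        logicals *ᵥ (v + w).1 = 0 ∧ logicals *ᵥ (v + w).2 = 0) :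
    FaultTolerant p U := by
  classical
  let D : List Bit → Syndrome → Recovery := fun r s =>
    if h : ∃ v, errors r v ∧ s = (checks *ᵥ v.2, checks *ᵥ v.1) then h.choose else 0
  have hD : ∀ r s (h : ∃ v, errors r v ∧ s = (checks *ᵥ v.2, checks *ᵥ v.1)),
      D r s = h.choose := fun r s h => dif_pos h
  refine ⟨h0, D, fun n r K hn hK s => ?_⟩
  rcases h1 n r K hn hK with hz | ⟨v, A, hv, hKv⟩
  · refine ⟨0, ?_⟩
    rw [Matrix.mul_assoc, hz, Matrix.mul_zero, tensorAnc_zero]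
  · rw [Matrix.mul_assoc, hKv, Matrix.mul_assoc, onData_mul_tensorAnc, onData_mul_tensorAnc, hU,
      syndromeProj_mul]
    by_cases hs : s = (checks *ᵥ v.2, checks *ᵥ v.1)
    · have hex : ∃ v, errors r v ∧ s = (checks *ᵥ v.2, checks *ᵥ v.1) := ⟨v, hv, hs⟩
      rw [hD r s hex, if_pos hs, one_smul]
      obtain ⟨hw, hws⟩ := hex.choose_spec
      set w := hex.choose
      rw [hs, Prod.mk.injEq] at hws
      obtain ⟨e1, e2⟩ := hc r w v hw hv hws.2.symm hws.1.symm
      have c1 : checks *ᵥ (w + v).1 = 0 := by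
        rw [Prod.fst_add, mulVec_add, hws.2, bits_add_self]
      have c2 : checks *ᵥ (w + v).2 = 0 := by
        rw [Prod.snd_add, mulVec_add, hws.1, bits_add_self]
      rw [pauliOp_eq_pauli, ← Matrix.mul_assoc, pauli_mul, Matrix.smul_mul, ← Matrix.mul_assoc,
        pauli_mul_encoder_of_stab ⟨c1, e1⟩ ⟨c2, e2⟩, smul_tensorAnc]
      exact ⟨_, rfl⟩
    · refine ⟨0, ?_⟩
      rw [if_neg hs, zero_smul, Matrix.mul_zero, tensorAnc_zero, ← tensorAnc_zero 0]
      ext x y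
      simp [tensorAnc]

/-! ## Sequences of one-qubit gates and permutations -/

/-- The product of the operators of a sequence of gates. -/
noncomputable def gatesOp {ι : Type} [Fintype ι] [DecidableEq ι] : List (Gate ι) → Op ι ι
  | [] => 1
  | g :: l => gatesOp l * g.op

/-- `g` has no two-qubit faults and takes one-qubit errors to one-qubit errors. -/
def PreservesLocal (g : Gate Qubit) : Prop :=
  (∀ P, ¬ g.Fault P) ∧ ∀ q a b, ∃ (q' : Qubit) (a' b' : Bit) (c : ℂ),
    g.op * pauliAt q a b = c • (pauliAt q' a' b' * g.op)

theorem gatesOp_mul_pauliAt (l : List (Gate Qubit)) (hl : ∀ g ∈ l, PreservesLocal g)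
    (q : Qubit) (a b : Bit) : ∃ (q' : Qubit) (a' b' : Bit) (c : ℂ),
      gatesOp l * pauliAt q a b = c • (pauliAt q' a' b' * gatesOp l) := by
  induction l generalizing q a b with
  | nil => exact ⟨q, a, b, 1, by simp [gatesOp]⟩
  | cons g l ih =>
    obtain ⟨q', a', b', c, h⟩ := (hl g List.mem_cons_self).2 q a b
    obtain ⟨q'', a'', b'', c', h'⟩ := ih (fun g hg => hl g (List.mem_cons_of_mem _ hg)) q' a' b'
    refine ⟨q'', a'', b'', c * c', ?_⟩
    rw [gatesOp, Matrix.mul_assoc, h, Matrix.mul_smul, ← Matrix.mul_assoc, h', Matrix.smul_mul,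
      smul_smul, Matrix.mul_assoc]

theorem run_gates_zero (l : List (Gate Qubit)) {r : List Bit} {K : Op Qubit Qubit}
    (h : Run 0 (gates l .done) r K) : K = gatesOp l := by
  induction l generalizing r K with
  | nil => cases h; rfl
  | cons g l ih =>
    cases h with
    | gate h => rw [ih h]; rfl

/-- With no two-qubit faults available, a fault can be moved to the end of the sequence and is still
supported on one qubit there. -/
theorem run_gates_one (l : List (Gate Qubit)) (hl : ∀ g ∈ l, PreservesLocal g) {r : List Bit}
    {K : Op Qubit Qubit} (h : Run 1 (gates l .done) r K) :
    ∃ (q : Qubit) (a b : Bit) (c : ℂ), K = c • (pauliAt q a b * gatesOp l) := by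
  induction l generalizing r K with
  | nil =>
    cases h with
    | restFault q a b h =>
      rw [run_gates_zero [] h]
      exact ⟨q, a, b, 1, by simp [gatesOp]⟩
  | cons g l ih =>
    cases h with
    | gate h =>
      obtain ⟨q, a, b, c, rfl⟩ := ih (fun g hg => hl g (List.mem_cons_of_mem _ hg)) h
      exact ⟨q, a, b, c, by rw [Matrix.smul_mul, Matrix.mul_assoc, gatesOp]⟩
    | gateFault hf _ => exact absurd hf ((hl g List.mem_cons_self).1 _)
    | restFault q a b h =>
      rw [run_gates_zero (g :: l) h]
      exact gatesOp_mul_pauliAt (g :: l) hl q a b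

theorem faultTolerant_of_preservesLocal {l : List (Gate Qubit)} {U : Op (Fin 15) (Fin 15)}
    {L : Op (Fin 7) (Fin 7)} (hU : U * encoder = encoder * L)
    (hl : ∀ g ∈ l, PreservesLocal g) (hop : gatesOp l = onData U) :
    FaultTolerant (gates l .done) U := by
  have hz : ∀ r K, Run 0 (gates l .done) r K →
      K * tensorAnc encoder 1 = tensorAnc (U * encoder) 1 := fun r K h => by
    rw [run_gates_zero l h, hop, onData_mul_tensorAnc]
  refine faultTolerant_of_errors hU
    (fun _ v => ∃ (q : Fin 15) (a b : Bit), v = (Pi.single q a, Pi.single q b))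
    (fun r K h => ⟨1, hz r K h⟩) (fun n r K hn h => Or.inr ?_) ?_
  · have hcase : n = 0 ∨ n = 1 := by omega
    rcases hcase with rfl | rfl
    · refine ⟨0, 1, ⟨0, 0, 0, by rw [Pi.single_zero]; rfl⟩, ?_⟩
      rw [hz r K h, pauli_zero, Matrix.one_mul]
    · obtain ⟨q, a, b, c, rfl⟩ := run_gates_one l hl h
      rw [hop, Matrix.smul_mul, Matrix.mul_assoc, onData_mul_tensorAnc, pauliAt_eq,
        pauli_mul_tensorAnc, tensorAnc_smul]
      refine ⟨_, _, ?_, rfl⟩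
      rcases q with q | q
      · refine ⟨q, a, b, Prod.ext (funext fun i => ?_) (funext fun i => ?_)⟩ <;>
          simp [dataFrame, Pi.single_apply]
      · refine ⟨0, 0, 0, Prod.ext (funext fun i => ?_) (funext fun i => ?_)⟩ <;>
          simp [dataFrame, Pi.single_apply]
  · rintro r v w ⟨q, a, b, rfl⟩ ⟨q', a', b', rfl⟩ h1 h2
    -- The columns of `checks` are distinct and nonzero, so a one-qubit `X` or `Z` error is
    -- determined by its syndrome. The two parts are treated separately.
    have key : ∀ (q q' : Fin 15) (a a' : Bit),
        checks *ᵥ Pi.single q a = checks *ᵥ Pi.single q' a' →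
          (Pi.single q a : Fin 15 → Bit) = Pi.single q' a' := by
      decide +kernel
    have e1 := key q q' a a' h1
    have e2 := key q q' b b' h2
    rw [e1, e2, frame_add_self]
    exact ⟨mulVec_zero _, mulVec_zero _⟩

theorem localOp_mul_pauli {ι : Type} [Fintype ι] [DecidableEq ι] {u : Op (Fin 1) (Fin 1)} {q : ι}
    {v : Frame ι} {a b : Bit} {c : ℂ} (h : u * pauli (fun _ => v.1 q, fun _ => v.2 q) =
      c • (pauli (fun _ => a, fun _ => b) * u)) :
    localOp u q * pauli v =
      c • (pauli (Function.update v.1 q a, Function.update v.2 q b) * localOp u q) := by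
  ext x y
  rw [mul_pauli_apply, Matrix.smul_apply, pauli_mul_apply]
  simp only [localOp, of_apply]
  have hxy : ∀ i, i ≠ q → (x i = (y + v.1) i ↔ (x + Function.update v.1 q a) i = y i) := by
    intro i hi
    rw [Pi.add_apply, Pi.add_apply, Function.update_of_ne hi]
    constructor
    · intro e; rw [e, add_assoc, bit_add_self, add_zero]
    · intro e; rw [← e, add_assoc, bit_add_self, add_zero]
  by_cases hx : ∀ i, i ≠ q → x i = (y + v.1) i
  · rw [if_pos hx, if_pos fun i hi => (hxy i hi).1 (hx i hi)]
    have hu := congrFun (congrFun h fun _ => x q) fun _ => y q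
    rw [mul_pauli_apply, Matrix.smul_apply, pauli_mul_apply] at hu
    have hd1 : v.2 ⬝ᵥ y = v.2 q * y q + ∑ i ∈ Finset.univ.erase q, v.2 i * y i :=
      (Finset.add_sum_erase _ _ (Finset.mem_univ q)).symm
    have hd2 : Function.update v.2 q b ⬝ᵥ (x + Function.update v.1 q a) =
        b * (x q + a) + ∑ i ∈ Finset.univ.erase q, v.2 i * y i := by
      rw [dotProduct, ← Finset.add_sum_erase _ _ (Finset.mem_univ q)]
      congr 1
      · simp
      · refine Finset.sum_congr rfl fun i hi => ?_
        have hi' := Finset.ne_of_mem_erase hi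
        rw [Function.update_of_ne hi', (hxy i hi').1 (hx i hi')]
    simp only [dotProduct, Fin.sum_univ_one, Pi.add_def, smul_eq_mul] at hu
    rw [hd1, hd2, sgn_add, sgn_add]
    simp only [Pi.add_apply, Function.update_self, smul_eq_mul]
    linear_combination sgn (∑ i ∈ Finset.univ.erase q, v.2 i * y i) * hu
  · rw [if_neg hx, if_neg fun h' => hx fun i hi => (hxy i hi).2 (h' i hi)]
    simp

theorem preservesLocal_loc {u : Matrix.unitaryGroup (Fin 1 → Bit) ℂ}
    (hu : u ∈ cliffordGroup (Fin 1)) (q : Qubit) :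
    PreservesLocal (.loc (u : Op (Fin 1) (Fin 1)) q) := by
  refine ⟨fun P hP => (by cases hP), fun q' a b => ?_⟩
  by_cases h : q' = q
  · subst h
    obtain ⟨w, c, hw⟩ := mem_cliffordGroup_iff.1 hu (fun _ => a, fun _ => b)
    have hw' : w = (fun _ => w.1 0, fun _ => w.2 0) := by
      refine Prod.ext (funext fun i => ?_) (funext fun i => ?_) <;>
        rw [Subsingleton.elim i 0]
    refine ⟨q', w.1 0, w.2 0, c, ?_⟩
    have := localOp_mul_pauli (q := q') (v := (Pi.single q' a, Pi.single q' b))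
      (a := w.1 0) (b := w.2 0) (by simpa only [Pi.single_eq_same, ← hw'] using hw)
    simpa only [Gate.op, pauliAt_eq, Pi.single, Function.update_idem] using this
  · refine ⟨q', a, b, 1, ?_⟩
    have h0 : pauli ((fun _ => 0, fun _ => 0) : Frame (Fin 1)) = 1 := pauli_zero
    have := localOp_mul_pauli (u := (u : Op (Fin 1) (Fin 1))) (q := q)
      (v := (Pi.single q' a, Pi.single q' b)) (a := 0) (b := 0) (c := 1)
      (by simp [Pi.single_eq_of_ne (Ne.symm h), h0])
    rw [Function.update_eq_self_iff.2 (Pi.single_eq_of_ne (Ne.symm h) _).symm,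
      Function.update_eq_self_iff.2 (Pi.single_eq_of_ne (Ne.symm h) _).symm] at this
    exact this

theorem localOp_mul_apply {ι : Type} [Fintype ι] [DecidableEq ι] (u : Op (Fin 1) (Fin 1)) (q : ι)
    (M : Op ι ι) (x y : ι → Bit) :
    (localOp u q * M) x y =
      ∑ b : Bit, u (fun _ => x q) (fun _ => b) * M (Function.update x q b) y := by
  rw [Matrix.mul_apply]
  symm
  refine Fintype.sum_of_injective (fun b => Function.update x q b)
    (Function.update_injective x q) _ _ (fun z hz => ?_) fun b => ?_
  · have : ¬ ∀ i, i ≠ q → x i = z i := fun h => hz ⟨z q, by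
      funext i
      by_cases hi : i = q
      · subst hi; simp
      · simp [hi, h i hi]⟩
    simp [localOp, this]
  · have : ∀ i, i ≠ q → x i = Function.update x q b i := fun i hi => by
      rw [Function.update_of_ne hi]
    simp only [localOp, of_apply]
    rw [if_pos this, Function.update_self]

theorem prod_localOp_apply {ι : Type} [Fintype ι] [DecidableEq ι] (u : Op (Fin 1) (Fin 1))
    (l : List ι) (hl : l.Nodup) (x y : ι → Bit) :
    (l.map (localOp u)).prod x y = if ∀ i, i ∉ l → x i = y i then
      (l.map fun i => u (fun _ => x i) (fun _ => y i)).prod else 0 := by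
  induction l generalizing x with
  | nil =>
    simp [Matrix.one_apply, funext_iff]
  | cons q l ih =>
    obtain ⟨hq, hl⟩ := List.nodup_cons.1 hl
    rw [List.map_cons, List.prod_cons, localOp_mul_apply, Finset.sum_eq_single (y q)]
    · rw [ih hl]
      have e : (∀ i, i ∉ l → Function.update x q (y q) i = y i) ↔
          ∀ i, i ∉ q :: l → x i = y i := by
        constructor
        · intro h i hi
          rw [List.mem_cons, not_or] at hi
          have := h i hi.2
          rwa [Function.update_of_ne hi.1] at this
        · intro h i hi
          by_cases hiq : i = q
          · subst hiq; simp
          · rw [Function.update_of_ne hiq]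
            exact h i (by simp [hiq, hi])
      have e' : (l.map fun i => u (fun _ => Function.update x q (y q) i) (fun _ => y i)) =
          l.map fun i => u (fun _ => x i) (fun _ => y i) := by
        refine List.map_congr_left fun i hi => ?_
        rw [Function.update_of_ne fun h : i = q => hq (h ▸ hi)]
      by_cases h : ∀ i, i ∉ q :: l → x i = y i
      · rw [if_pos (e.2 h), if_pos h, e', List.map_cons, List.prod_cons]
      · rw [if_neg fun h' => h (e.1 h'), if_neg h, mul_zero]
    · intro b _ hb
      rw [ih hl, if_neg, mul_zero]
      intro h
      have := h q hq
      rw [Function.update_self] at this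
      exact hb this
    · simp

theorem prod_localOp_eq {ι : Type} [Fintype ι] [DecidableEq ι] (u : Op (Fin 1) (Fin 1))
    (l : List ι) (hl : l.Nodup) (hmem : ∀ i, i ∈ l) :
    (l.map (localOp u)).prod = transversalOp u := by
  ext x y
  rw [prod_localOp_apply u l hl, if_pos fun i hi => absurd (hmem i) hi, transversalOp, of_apply,
    ← List.prod_toFinset _ hl]
  congr 1
  ext i
  simp [hmem]

theorem localOp_inl (u : Op (Fin 1) (Fin 1)) (q : Fin 15) :
    (localOp u (Sum.inl q) : Op Qubit Qubit) = onData (localOp u q) := by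
  ext x y
  simp only [localOp, onData, of_apply, Matrix.one_apply, Function.comp_apply]
  have e : (∀ i : Qubit, i ≠ Sum.inl q → x i = y i) ↔
      (∀ i, i ≠ q → x (Sum.inl i) = y (Sum.inl i)) ∧ x ∘ Sum.inr = y ∘ Sum.inr := by
    constructor
    · exact fun h => ⟨fun i hi => h _ fun h' => hi (Sum.inl_injective h'),
        funext fun i => h _ Sum.inr_ne_inl⟩
    · rintro ⟨h1, h2⟩ (i | i) hi
      · exact h1 i fun h => hi (congrArg _ h)
      · exact congrFun h2 i
  simp only [e]
  by_cases h1 : ∀ i, i ≠ q → x (Sum.inl i) = y (Sum.inl i) <;>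
    by_cases h2 : x ∘ Sum.inr = y ∘ Sum.inr
  · rw [if_pos ⟨h1, h2⟩, if_pos h1, if_pos h2, mul_one]
  · rw [if_neg fun h => h2 h.2, if_neg h2, mul_zero]
  · rw [if_neg fun h => h1 h.1, if_neg h1, zero_mul]
  · rw [if_neg fun h => h2 h.2, if_neg h2, mul_zero]

theorem onData_one : onData 1 = 1 := by
  ext x y
  simp only [onData, of_apply, Matrix.one_apply, qubit_ext_iff (x := x)]
  by_cases h1 : x ∘ Sum.inl = y ∘ Sum.inl <;> by_cases h2 : x ∘ Sum.inr = y ∘ Sum.inr <;>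
    simp [h1, h2]

/-- The list is reversed because later gates multiply on the left. -/
theorem gatesOp_loc (u : Op (Fin 1) (Fin 1)) (l : List (Fin 15)) :
    gatesOp (l.map fun q => Gate.loc u (Sum.inl q : Qubit)) =
      onData (l.reverse.map (localOp u)).prod := by
  induction l with
  | nil => simp [gatesOp, onData_one]
  | cons q l ih =>
    rw [List.map_cons, gatesOp, ih, Gate.op, localOp_inl, onData_mul]
    simp

theorem exists_logical_of_mem {U : Op (Fin 15) (Fin 15)}
    (hU : U ∈ Matrix.unitaryGroup (Fin 15 → Bit) ℂ)
    (h : (⟨U, hU⟩ : Matrix.unitaryGroup (Fin 15 → Bit) ℂ) ∈ generators) :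
    ∃ L : Op (Fin 7) (Fin 7), U * encoder = encoder * L := by
  obtain ⟨L, -, hL⟩ := exists_logical_clifford h
  exact ⟨L, hL⟩

theorem faultTolerant_transversal {u : Matrix.unitaryGroup (Fin 1 → Bit) ℂ}
    (hu : u ∈ cliffordGroup (Fin 1)) :
    FaultTolerant (transversalProc (u : Op (Fin 1) (Fin 1)))
      (transversalOp (u : Op (Fin 1) (Fin 1))) := by
  obtain ⟨L, hL⟩ := exists_logical_of_mem (transversalOp_mem_unitary u) (Or.inl ⟨u, hu, rfl⟩)
  refine faultTolerant_of_preservesLocal hL (fun g hg => ?_) ?_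
  · obtain ⟨q, -, rfl⟩ := List.mem_map.1 hg
    exact preservesLocal_loc hu _
  · rw [gatesOp_loc, prod_localOp_eq u _ (List.nodup_reverse.2 (List.nodup_finRange 15))]
    simp

theorem permOp_sumCongr (σ : Equiv.Perm (Fin 15)) :
    (permOp (Equiv.sumCongr σ (Equiv.refl (Fin 2))) : Op Qubit Qubit) = onData (permOp σ) := by
  ext x y
  simp only [permOp, onData, of_apply, Matrix.one_apply, qubit_ext_iff (x := x)]
  have h1 : (y ∘ (Equiv.sumCongr σ (Equiv.refl (Fin 2))).symm) ∘ Sum.inl =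
      (y ∘ Sum.inl) ∘ σ.symm := rfl
  have h2 : (y ∘ (Equiv.sumCongr σ (Equiv.refl (Fin 2))).symm) ∘ Sum.inr = y ∘ Sum.inr := rfl
  rw [h1, h2]
  by_cases h1 : x ∘ Sum.inl = (y ∘ Sum.inl) ∘ σ.symm <;>
    by_cases h2 : x ∘ Sum.inr = y ∘ Sum.inr <;> simp [h1, h2]

theorem preservesLocal_relabel (σ : Equiv.Perm Qubit) : PreservesLocal (.relabel σ) := by
  refine ⟨fun P hP => (by cases hP), fun q a b => ⟨σ q, a, b, 1, ?_⟩⟩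
  have h : ∀ a : Bit, (Pi.single q a : Qubit → Bit) ∘ σ.symm = Pi.single (σ q) a := by
    intro a
    funext i
    simp [Pi.single_apply, Equiv.symm_apply_eq]
  rw [Gate.op, pauliAt_eq, permOp_mul_pauli, one_smul, h, h, pauliAt_eq]

theorem faultTolerant_perm {σ : Equiv.Perm (Fin 15)}
    (hσ : σ ∈ ({σ₁, σ₂, σ₃} : Set (Equiv.Perm (Fin 15)))) :
    FaultTolerant (permProc σ) (permOp σ) := by
  obtain ⟨L, hL⟩ := exists_logical_of_mem (permOp_mem_unitary σ) (Or.inr (Or.inl ⟨σ, hσ, rfl⟩))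
  refine faultTolerant_of_preservesLocal hL (fun g hg => ?_) ?_
  · rw [List.mem_singleton.1 hg]
    exact preservesLocal_relabel _
  · simp only [gatesOp, Gate.op, Matrix.one_mul]
    exact permOp_sumCongr σ

/-! ## Propagation of Pauli errors -/

section Propagation

variable {ι : Type} [Fintype ι] [DecidableEq ι]

/-- The Pauli operator `X^a Z^b` on qubit `q`. -/
def frameAt (q : ι) (a b : Bit) : Frame ι := (Pi.single q a, Pi.single q b)

theorem pauliAt_eq_pauli (q : ι) (a b : Bit) : pauliAt q a b = pauli (frameAt q a b) := rfl

theorem frameAt_zero (q : ι) : frameAt q 0 0 = 0 := by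
  rw [frameAt, Pi.single_zero]
  rfl

theorem frameAt_add (q : ι) (a b a' b' : Bit) :
    frameAt q a b + frameAt q a' b' = frameAt q (a + a') (b + b') := by
  simp only [frameAt, Prod.mk_add_mk, Pi.single_add]

/-- The Pauli operator measured in a basis. -/
def basisFrame : Basis → ι → Bit → Frame ι
  | .Z, q, a => frameAt q 0 a
  | .X, q, a => frameAt q a 0

/-- The Pauli operator that exchanges the two states of a basis. -/
def flipFrame : Basis → ι → Bit → Frame ι
  | .Z, q, a => frameAt q a 0
  | .X, q, a => frameAt q 0 a

/-- The change of the outcome of a measurement caused by a Pauli error. -/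
def flip : Basis → ι → Frame ι → Bit
  | .Z, q, v => v.1 q
  | .X, q, v => v.2 q

theorem symp_basisFrame (b : Basis) (q : ι) (v : Frame ι) :
    symp (basisFrame b q 1) v = flip b q v := by
  cases b <;> simp [symp, basisFrame, flip, frameAt]

theorem measOp_eq (b : Basis) (q : ι) (m : Bit) :
    measOp b q m = (1 / 2 : ℂ) • (1 + sgn m • pauli (basisFrame b q 1)) := by
  cases b <;> rfl

theorem prepOp_eq (b : Basis) (q : ι) (m : Bit) :
    prepOp b q m = pauli (flipFrame b q m) * measOp b q m := by
  cases b <;> rfl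

/-- An error that anticommutes with the measured operator exchanges the two projectors; otherwise it
passes through unchanged. -/
theorem measOp_mul_pauli (b : Basis) (q : ι) (m : Bit) (v : Frame ι) :
    measOp b q m * pauli v = pauli v * measOp b q (m + flip b q v) := by
  rw [measOp_eq, measOp_eq, Matrix.smul_mul, Matrix.mul_smul, Matrix.add_mul, Matrix.mul_add,
    Matrix.one_mul, Matrix.mul_one, Matrix.smul_mul, Matrix.mul_smul, pauli_comm,
    symp_basisFrame, smul_smul, sgn_add]

theorem basisFrame_mul_measOp (b : Basis) (q : ι) (m : Bit) :
    pauli (basisFrame b q 1) * measOp b q m = sgn m • measOp b q m := by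
  have h : pauli (basisFrame b q 1) * pauli (basisFrame b q 1) = (1 : Op ι ι) := by
    rw [pauli_mul_self]
    cases b <;> simp [basisFrame, frameAt]
  rw [measOp_eq, Matrix.mul_smul, Matrix.mul_add, Matrix.mul_one, Matrix.mul_smul, h,
    smul_comm (sgn m)]
  congr 1
  rw [smul_add, smul_smul, sgn_mul_self, one_smul, add_comm]

theorem measOp_mul_of_stab {m : Type} {Ψ : Matrix (ι → Bit) m ℂ} {b : Basis} {q : ι}
    (h : pauli (basisFrame b q 1) * Ψ = Ψ) (s : Bit) :
    measOp b q s * Ψ = if s = 0 then Ψ else 0 := by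
  rw [measOp_eq, half_projector_mul (t := 0) (by rw [h, sgn_zero, one_smul])]
  split_ifs <;> simp

/-- The error after qubit `q` is reset. -/
def clear (q : ι) (v : Frame ι) : Frame ι := v + frameAt q (v.1 q) (v.2 q)

/-- A preparation erases the error on its qubit: the flipping part changes which unrecorded outcome
occurs, and the remaining part is diagonal in the basis and is absorbed by the projector as a sign.
-/
theorem prepOp_mul_pauli (b : Basis) (q : ι) (m : Bit) (v : Frame ι) :
    ∃ c : ℂ, prepOp b q m * pauli v =
      c • (pauli (clear q v) * prepOp b q (m + flip b q v)) := by
  obtain ⟨s, hs⟩ : ∃ s : Bit, clear q v + flipFrame b q (m + flip b q v) =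
      (flipFrame b q m + v) + basisFrame b q s := by
    cases b
    · refine ⟨v.1 q, ?_⟩
      simp only [clear, flipFrame, basisFrame, flip]
      rw [add_assoc, frameAt_add, add_comm (frameAt q 0 m), add_assoc, frameAt_add]
      congr 2
      · rw [add_zero, zero_add]
      · rw [add_comm m, ← add_assoc, bit_add_self, zero_add, add_zero]
    · refine ⟨v.2 q, ?_⟩
      simp only [clear, flipFrame, basisFrame, flip]
      rw [add_assoc, frameAt_add, add_comm (frameAt q m 0), add_assoc, frameAt_add]
      congr 2
      · rw [add_comm m, ← add_assoc, bit_add_self, zero_add, add_zero]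
      · rw [add_zero, zero_add]
  set M : Op ι ι := measOp b q (m + flip b q v) with hM
  have h1 : prepOp b q m * pauli v =
      sgn ((flipFrame b q m).2 ⬝ᵥ v.1) • (pauli (flipFrame b q m + v) * M) := by
    rw [prepOp_eq, Matrix.mul_assoc, measOp_mul_pauli, ← Matrix.mul_assoc, pauli_mul,
      Matrix.smul_mul]
  have hbM : ∃ t : Bit, pauli (basisFrame b q s) * M = sgn t • M := by
    rcases bit_cases s with rfl | rfl
    · refine ⟨0, ?_⟩
      have h0 : basisFrame b q 0 = 0 := by cases b <;> exact frameAt_zero q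
      rw [h0, pauli_zero, Matrix.one_mul, sgn_zero, one_smul]
    · exact ⟨_, basisFrame_mul_measOp b q _⟩
  obtain ⟨t, ht⟩ := hbM
  have h2 : pauli (flipFrame b q m + v) * pauli (basisFrame b q s) =
      sgn ((flipFrame b q m + v).2 ⬝ᵥ (basisFrame b q s).1) •
        pauli (flipFrame b q m + v + basisFrame b q s) := pauli_mul _ _
  have h3 : pauli (clear q v) * pauli (flipFrame b q (m + flip b q v)) =
      sgn ((clear q v).2 ⬝ᵥ (flipFrame b q (m + flip b q v)).1) •
        pauli (flipFrame b q m + v + basisFrame b q s) := by rw [pauli_mul, hs]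
  generalize sgn ((flipFrame b q m + v).2 ⬝ᵥ (basisFrame b q s).1) = s2 at h2
  have h4 : pauli (flipFrame b q m + v) * M = (sgn t * s2) •
      (pauli (flipFrame b q m + v + basisFrame b q s) * M) := by
    have := congrArg (· * M) h2
    simp only [Matrix.mul_assoc, ht, Matrix.smul_mul, Matrix.mul_smul] at this
    rw [mul_smul, ← this, smul_smul, sgn_mul_self, one_smul]
  have hs3 := sgn_mul_self ((clear q v).2 ⬝ᵥ (flipFrame b q (m + flip b q v)).1)
  generalize sgn ((clear q v).2 ⬝ᵥ (flipFrame b q (m + flip b q v)).1) = s3 at h3 hs3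
  have h5 : pauli (flipFrame b q m + v + basisFrame b q s) * M = s3 •
      (pauli (clear q v) * prepOp b q (m + flip b q v)) := by
    rw [prepOp_eq, ← Matrix.mul_assoc, h3, Matrix.smul_mul, smul_smul, hs3, one_smul]
  rw [h1, h4, h5, smul_smul, smul_smul]
  exact ⟨_, rfl⟩

/-- The propagation of a Pauli error through a gate. Pauli gates are counted as errors. -/
def push : Gate ι → Frame ι → Frame ι
  | .cz i j, v => (v.1, v.2 + (Pi.single j (v.1 i) + Pi.single i (v.1 j)))
  | .cnot c t, v => (v.1 + Pi.single t (v.1 c), v.2 + Pi.single c (v.2 t))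
  | .pauli q a b, v => v + frameAt q a b
  | .loc _ _, v => v
  | .relabel _, v => v

/-- The operator of a gate, where Pauli gates are omitted. -/
noncomputable def idealOp : Gate ι → Op ι ι
  | .cz i j => czOp i j
  | .cnot c t => cnotOp c t
  | _ => 1

/-- The gates through which Pauli errors are propagated. -/
def Propagates : Gate ι → Prop
  | .cz _ _ => True
  | .cnot c t => c ≠ t
  | .pauli _ _ _ => True
  | _ => False

theorem czOp_mul_pauli (i j : ι) (v : Frame ι) : czOp i j * pauli v =
    sgn (v.1 i * v.1 j) • (pauli (push (.cz i j) v) * czOp i j) := by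
  ext x y
  have hp : (push (.cz i j) v).1 = v.1 := rfl
  rw [czOp, Matrix.smul_apply, Matrix.diagonal_mul, Matrix.mul_diagonal, pauli_apply, pauli_apply,
    hp]
  by_cases h : x = y + v.1
  · rw [if_pos h, if_pos h, h]
    simp only [push, Pi.add_apply, add_dotProduct, single_dotProduct, smul_eq_mul]
    rw [mul_comm (sgn (_ + _)), ← mul_assoc, ← sgn_add, mul_comm (sgn _ * sgn _), ← sgn_add,
      ← sgn_add]
    congr 1
    ring
  · rw [if_neg h, if_neg h]
    simp

theorem cnotOp_mul_pauli {c t : ι} (hct : c ≠ t) (v : Frame ι) :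
    cnotOp c t * pauli v = pauli (push (.cnot c t) v) * cnotOp c t := by
  ext x y
  rw [mul_pauli_apply, pauli_mul_apply]
  simp only [cnotOp, of_apply, push]
  have e : x = y + v.1 + Pi.single t ((y + v.1) c) ↔
      x + (v.1 + Pi.single t (v.1 c)) = y + Pi.single t (y c) := by
    rw [Pi.add_apply, Pi.single_add]
    constructor
    · rintro rfl
      rw [show y + v.1 + (Pi.single t (y c) + Pi.single t (v.1 c)) +
        (v.1 + Pi.single t (v.1 c)) = y + Pi.single t (y c) + (v.1 + v.1) +
          (Pi.single t (v.1 c) + Pi.single t (v.1 c)) by abel]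
      simp
    · intro h
      rw [show y + v.1 + (Pi.single t (y c) + Pi.single t (v.1 c)) =
        (y + Pi.single t (y c)) + (v.1 + Pi.single t (v.1 c)) by abel, ← h]
      simp
  by_cases h : x = y + v.1 + Pi.single t ((y + v.1) c)
  · rw [if_pos h, if_pos (e.1 h), e.1 h, one_mul, mul_one]
    congr 1
    simp only [add_dotProduct, dotProduct_add, single_dotProduct, dotProduct_single,
      Pi.add_apply, Pi.single_eq_of_ne hct.symm, add_zero]
    rw [add_assoc, bit_add_self, add_zero]
  · rw [if_neg h, if_neg fun h' => h (e.2 h'), zero_mul, mul_zero]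

/-- A Pauli gate goes entirely into the error, so the ideal state never sees it. This keeps the
ideal state independent of corrections that depend on outcomes. -/
theorem op_mul_pauli {g : Gate ι} (hg : Propagates g) (v : Frame ι) :
    ∃ c : ℂ, g.op * pauli v = c • (pauli (push g v) * idealOp g) := by
  cases g with
  | cz i j => exact ⟨_, czOp_mul_pauli i j v⟩
  | cnot c t => exact ⟨1, by rw [one_smul]; exact cnotOp_mul_pauli hg v⟩
  | pauli q a b =>
    refine ⟨sgn ((frameAt q a b).2 ⬝ᵥ v.1), ?_⟩
    rw [Gate.op, pauliAt_eq_pauli, pauli_mul, idealOp, Matrix.mul_one, push, add_comm v]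
    all_goals simp
  | loc u q => exact hg.elim
  | relabel σ => exact hg.elim

/-! ### Executions -/

/-- `Det p Ψ Q`: in every execution of `p` without faults (and without its Pauli gates) on the
state `Ψ`, all measurements have the outcome `0` with certainty, and the final state satisfies `Q`;
this holds for every choice of the branches in which the procedure continues. -/
def Det {m : Type} : Proc ι → Matrix (ι → Bit) m ℂ → (Matrix (ι → Bit) m ℂ → Prop) → Prop
  | .done, Ψ, Q => Q Ψ
  | .gate g k, Ψ, Q => Propagates g ∧ Det k (idealOp g * Ψ) Q
  | .prep b q k, Ψ, Q => ∀ s, Det k (prepOp b q s * Ψ) Q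
  | .meas b q k, Ψ, Q => pauli (basisFrame b q 1) * Ψ = Ψ ∧ ∀ s, Det (k s) Ψ Q

/-- The measurement record and the final error of an execution that starts with the error `v` and
has no further faults. -/
def trace : Proc ι → Frame ι → List Bit × Frame ι
  | .done, v => ([], v)
  | .gate g k, v => trace k (push g v)
  | .prep _ q k, v => trace k (clear q v)
  | .meas b q k, v =>
    (flip b q v :: (trace (k (flip b q v)) v).1, (trace (k (flip b q v)) v).2)

/-- The Pauli errors on the qubits of a two-qubit gate. -/
def GateError : Gate ι → Frame ι → Prop
  | .cz i j, e => ∃ a b a' b', e = frameAt i a b + frameAt j a' b'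
  | .cnot c t, e => ∃ a b a' b', e = frameAt c a b + frameAt t a' b'
  | _, _ => False

/-- `Faulty p v r w`: an execution that starts with the error `v` and has one fault can have the
measurement record `r` and the final error `w`. -/
def Faulty : Proc ι → Frame ι → List Bit → Frame ι → Prop
  | .done, v, r, w => r = [] ∧ ∃ q a b, w = v + frameAt q a b
  | .gate g k, v, r, w =>
    (∃ e, GateError g e ∧ trace k (push g v + e) = (r, w)) ∨ Faulty k (push g v) r w
  | .prep _ q k, v, r, w => Faulty k (clear q v) r w
  | .meas b q k, v, r, w =>
    (∃ a a', trace (.meas b q k) (v + frameAt q a a') = (r, w)) ∨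
      ∃ r', r = flip b q v :: r' ∧ Faulty (k (flip b q v)) v r' w

/-- The ideal state gives outcome `0` at every measurement, so with the error `v` only the outcome
`flip b q v` has nonzero amplitude. It selects the branch, and `Det` covers that branch because it
quantifies over all continuations. -/
theorem run_zero_sound {m : Type} {p : Proc ι} {n : ℕ} {r : List Bit} {K : Op ι ι}
    (h : Run n p r K) (hn : n = 0) {Ψ : Matrix (ι → Bit) m ℂ}
    {Q : Matrix (ι → Bit) m ℂ → Prop} (hd : Det p Ψ Q) (v : Frame ι) :
    K * (pauli v * Ψ) = 0 ∨ ∃ (c : ℂ) (w : Frame ι) (Ψ' : Matrix (ι → Bit) m ℂ),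
      Q Ψ' ∧ trace p v = (r, w) ∧ K * (pauli v * Ψ) = c • (pauli w * Ψ') := by
  induction h generalizing Ψ v with
  | done =>
    right
    exact ⟨1, v, Ψ, hd, rfl, by rw [Matrix.one_mul, one_smul]⟩
  | gate h ih =>
    obtain ⟨c, hc⟩ := op_mul_pauli hd.1 v
    have e := congrArg (· * Ψ) hc
    simp only [Matrix.smul_mul, Matrix.mul_assoc] at e
    rcases ih hn hd.2 (push _ v) with h0 | ⟨c', w, Ψ', hQ, ht, hK⟩
    · left
      rw [Matrix.mul_assoc, e, Matrix.mul_smul, h0, smul_zero]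
    · right
      refine ⟨c * c', w, Ψ', hQ, ht, ?_⟩
      rw [Matrix.mul_assoc, e, Matrix.mul_smul, hK, smul_smul]
  | @prep n b q k r K s h ih =>
    obtain ⟨c, hc⟩ := prepOp_mul_pauli b q s v
    have e := congrArg (· * Ψ) hc
    simp only [Matrix.smul_mul, Matrix.mul_assoc] at e
    rcases ih hn (hd (s + flip b q v)) (clear q v) with h0 | ⟨c', w, Ψ', hQ, ht, hK⟩
    · left
      rw [Matrix.mul_assoc, e, Matrix.mul_smul, h0, smul_zero]
    · right
      refine ⟨c * c', w, Ψ', hQ, ht, ?_⟩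
      rw [Matrix.mul_assoc, e, Matrix.mul_smul, hK, smul_smul]
  | @meas n b q k r K s h ih =>
    have e : measOp b q s * (pauli v * Ψ) = if s + flip b q v = 0 then pauli v * Ψ else 0 := by
      rw [← Matrix.mul_assoc, measOp_mul_pauli, Matrix.mul_assoc, measOp_mul_of_stab hd.1]
      split_ifs <;> simp
    by_cases hs : s + flip b q v = 0
    · have hs' : s = flip b q v := CharTwo.add_eq_zero.1 hs
      rcases ih hn (hd.2 s) v with h0 | ⟨c', w, Ψ', hQ, ht, hK⟩
      · left
        rw [Matrix.mul_assoc, e, if_pos hs, h0]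
      · right
        refine ⟨c', w, Ψ', hQ, ?_, by rw [Matrix.mul_assoc, e, if_pos hs, hK]⟩
        rw [trace, ← hs', ht]
    · left
      rw [Matrix.mul_assoc, e, if_neg hs, Matrix.mul_zero]
  | gateFault _ _ _ => omega
  | restFault _ _ _ _ _ => omega

/-- A one-qubit error before a gate either does not meet the gate, and stays a one-qubit error, or
becomes an error on the qubits of that gate. -/
theorem push_add_frameAt (g : Gate ι) (v : Frame ι) (q : ι) (a b : Bit) :
    push g (v + frameAt q a b) = push g v + frameAt q a b ∨
      ∃ e, GateError g e ∧ push g (v + frameAt q a b) = push g v + e := by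
  cases g with
  | cz i j =>
    have h : push (.cz i j) (v + frameAt q a b) = push (.cz i j) v + (frameAt q a b +
        (frameAt j 0 ((Pi.single q a : ι → Bit) i) + frameAt i 0 ((Pi.single q a : ι → Bit) j))) := by
      refine Prod.ext ?_ ?_
      · simp [push, frameAt]
      · simp only [push, frameAt, Prod.fst_add, Prod.snd_add, Pi.add_apply, Pi.single_add]
        abel
    by_cases hi : q = i
    · subst hi
      refine Or.inr ⟨_, ⟨a, b + (Pi.single q a : ι → Bit) j, 0,
        (Pi.single q a : ι → Bit) q, ?_⟩, h⟩
      rw [add_comm (frameAt j _ _), ← add_assoc, frameAt_add, add_zero]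
    · by_cases hj : q = j
      · subst hj
        refine Or.inr ⟨_, ⟨0, (Pi.single q a : ι → Bit) q, a,
          b + (Pi.single q a : ι → Bit) i, ?_⟩, h⟩
        rw [← add_assoc, frameAt_add, add_zero, add_comm]
      · left
        rw [h, Pi.single_eq_of_ne (Ne.symm hi), Pi.single_eq_of_ne (Ne.symm hj), frameAt_zero,
          frameAt_zero, add_zero, add_zero]
  | cnot c t =>
    have h : push (.cnot c t) (v + frameAt q a b) = push (.cnot c t) v + (frameAt q a b +
        (frameAt t ((Pi.single q a : ι → Bit) c) 0 + frameAt c 0 ((Pi.single q b : ι → Bit) t))) := by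
      refine Prod.ext ?_ ?_
      · simp only [push, frameAt, Prod.fst_add, Pi.add_apply, Pi.single_add, Pi.single_zero]
        abel
      · simp only [push, frameAt, Prod.snd_add, Pi.add_apply, Pi.single_add, Pi.single_zero]
        abel
    by_cases hi : q = c
    · subst hi
      refine Or.inr ⟨_, ⟨a, b + (Pi.single q b : ι → Bit) t,
        (Pi.single q a : ι → Bit) q, 0, ?_⟩, h⟩
      rw [add_comm (frameAt t _ _), ← add_assoc, frameAt_add, add_zero]
    · by_cases hj : q = t
      · subst hj
        refine Or.inr ⟨_, ⟨0, (Pi.single q b : ι → Bit) q,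
          a + (Pi.single q a : ι → Bit) c, b, ?_⟩, h⟩
        rw [← add_assoc, frameAt_add, add_zero, add_comm]
      · left
        rw [h, Pi.single_eq_of_ne (Ne.symm hi), Pi.single_eq_of_ne (Ne.symm hj), frameAt_zero,
          frameAt_zero, add_zero, add_zero]
  | pauli q' a' b' =>
    left
    simp only [push]
    abel
  | loc u q => exact Or.inl rfl
  | relabel σ => exact Or.inl rfl

theorem clear_add_frameAt_self (q : ι) (v : Frame ι) (a b : Bit) :
    clear q (v + frameAt q a b) = clear q v := by
  have h : clear q (v + frameAt q a b) =
      v + (frameAt q (v.1 q) (v.2 q) + (frameAt q a b + frameAt q a b)) := by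
    simp only [clear, Prod.fst_add, Prod.snd_add, Pi.add_apply, ← frameAt_add]
    simp only [frameAt, Pi.single_eq_same]
    abel
  rw [h, frame_add_self, add_zero, clear]

theorem clear_add_frameAt_of_ne {q q' : ι} (h : q' ≠ q) (v : Frame ι) (a b : Bit) :
    clear q (v + frameAt q' a b) = clear q v + frameAt q' a b := by
  have h1 : (v + frameAt q' a b).1 q = v.1 q := by simp [frameAt, Pi.single_eq_of_ne h.symm]
  have h2 : (v + frameAt q' a b).2 q = v.2 q := by simp [frameAt, Pi.single_eq_of_ne h.symm]
  rw [clear, h1, h2, clear]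
  abel

/-- A one-qubit fault can be delayed until a two-qubit gate touches its qubit, where it counts as a
gate fault, until its qubit is measured, or until the end. Hence `Faulty` lists idle faults only in
the last two places. -/
theorem faulty_of_trace (p : Proc ι) : ∀ {v w : Frame ι} {r : List Bit} (q : ι) (a b : Bit),
    trace p (v + frameAt q a b) = (r, w) → Faulty p v r w := by
  induction p with
  | done =>
    intro v w r q a b h
    obtain ⟨h1, h2⟩ := Prod.mk.inj h
    exact ⟨h1.symm, q, a, b, h2.symm⟩
  | gate g k ih =>
    intro v w r q a b h
    rw [trace] at h
    rcases push_add_frameAt g v q a b with e | ⟨e, he, he'⟩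
    · rw [e] at h
      exact Or.inr (ih q a b h)
    · rw [he'] at h
      exact Or.inl ⟨e, he, h⟩
  | prep b q k ih =>
    intro v w r q' a b' h
    rw [trace] at h
    by_cases hq : q' = q
    · subst hq
      rw [clear_add_frameAt_self] at h
      -- The preparation erases the fault; the rest is covered as an execution with a trivial fault.
      exact ih q' 0 0 (by rwa [frameAt_zero, add_zero])
    · rw [clear_add_frameAt_of_ne hq] at h
      exact ih q' a b' h
  | meas b q k ih =>
    intro v w r q' a b' h
    by_cases hq : q' = q
    · subst hq
      exact Or.inl ⟨a, b', h⟩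
    · right
      have hf : flip b q (v + frameAt q' a b') = flip b q v := by
        cases b <;> simp [flip, frameAt, Pi.single_eq_of_ne (Ne.symm hq)]
      rw [trace, hf] at h
      obtain ⟨h1, h2⟩ := Prod.mk.inj h
      exact ⟨_, h1.symm, ih _ q' a b' (Prod.ext rfl h2)⟩

theorem fault_mul_pauli {g : Gate ι} {P : Op ι ι} (h : g.Fault P) (v : Frame ι) :
    ∃ (e : Frame ι) (c : ℂ), GateError g e ∧ P * pauli v = c • pauli (v + e) := by
  have key : ∀ (i j : ι) (a b a' b' : Bit), ∃ c : ℂ, pauliAt₂ i j a b a' b' * pauli v =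
      c • pauli (v + (frameAt i a b + frameAt j a' b')) := by
    intro i j a b a' b'
    rw [pauliAt₂, pauliAt_eq_pauli, pauliAt_eq_pauli, pauli_mul, Matrix.smul_mul, pauli_mul,
      smul_smul, add_comm v]
    exact ⟨_, rfl⟩
  cases h with
  | cz i j a b a' b' =>
    obtain ⟨c, hc⟩ := key i j a b a' b'
    exact ⟨_, c, ⟨a, b, a', b', rfl⟩, hc⟩
  | cnot i j a b a' b' =>
    obtain ⟨c, hc⟩ := key i j a b a' b'
    exact ⟨_, c, ⟨a, b, a', b', rfl⟩, hc⟩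

/-- Up to the fault the frame is propagated as without faults. After it, `run_zero_sound` applies
with the modified error, and a fault at rest is turned into a listed one by `faulty_of_trace`. -/
theorem run_one_sound {m : Type} {p : Proc ι} {n : ℕ} {r : List Bit} {K : Op ι ι}
    (h : Run n p r K) (hn : n = 1) {Ψ : Matrix (ι → Bit) m ℂ}
    {Q : Matrix (ι → Bit) m ℂ → Prop} (hd : Det p Ψ Q) (v : Frame ι) :
    K * (pauli v * Ψ) = 0 ∨ ∃ (c : ℂ) (w : Frame ι) (Ψ' : Matrix (ι → Bit) m ℂ),
      Q Ψ' ∧ Faulty p v r w ∧ K * (pauli v * Ψ) = c • (pauli w * Ψ') := by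
  induction h generalizing Ψ v with
  | done => omega
  | gate h ih =>
    obtain ⟨c, hc⟩ := op_mul_pauli hd.1 v
    have e := congrArg (· * Ψ) hc
    simp only [Matrix.smul_mul, Matrix.mul_assoc] at e
    rcases ih hn hd.2 (push _ v) with h0 | ⟨c', w, Ψ', hQ, ht, hK⟩
    · left
      rw [Matrix.mul_assoc, e, Matrix.mul_smul, h0, smul_zero]
    · right
      refine ⟨c * c', w, Ψ', hQ, Or.inr ht, ?_⟩
      rw [Matrix.mul_assoc, e, Matrix.mul_smul, hK, smul_smul]
  | @prep n b q k r K s h ih =>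
    obtain ⟨c, hc⟩ := prepOp_mul_pauli b q s v
    have e := congrArg (· * Ψ) hc
    simp only [Matrix.smul_mul, Matrix.mul_assoc] at e
    rcases ih hn (hd (s + flip b q v)) (clear q v) with h0 | ⟨c', w, Ψ', hQ, ht, hK⟩
    · left
      rw [Matrix.mul_assoc, e, Matrix.mul_smul, h0, smul_zero]
    · right
      refine ⟨c * c', w, Ψ', hQ, ht, ?_⟩
      rw [Matrix.mul_assoc, e, Matrix.mul_smul, hK, smul_smul]
  | @meas n b q k r K s h ih =>
    have e : measOp b q s * (pauli v * Ψ) = if s + flip b q v = 0 then pauli v * Ψ else 0 := by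
      rw [← Matrix.mul_assoc, measOp_mul_pauli, Matrix.mul_assoc, measOp_mul_of_stab hd.1]
      split_ifs <;> simp
    by_cases hs : s + flip b q v = 0
    · have hs' : s = flip b q v := CharTwo.add_eq_zero.1 hs
      rcases ih hn (hd.2 s) v with h0 | ⟨c', w, Ψ', hQ, ht, hK⟩
      · left
        rw [Matrix.mul_assoc, e, if_pos hs, h0]
      · right
        refine ⟨c', w, Ψ', hQ, Or.inr ⟨r, by rw [hs'], ?_⟩, by
          rw [Matrix.mul_assoc, e, if_pos hs, hK]⟩
        rwa [← hs']
    · left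
      rw [Matrix.mul_assoc, e, if_neg hs, Matrix.mul_zero]
  | @gateFault n g k r K P hP h ih =>
    obtain ⟨c, hc⟩ := op_mul_pauli hd.1 v
    obtain ⟨e, c', he, hPe⟩ := fault_mul_pauli hP (push g v)
    have e1 : P * g.op * (pauli v * Ψ) =
        (c * c') • (pauli (push g v + e) * (idealOp g * Ψ)) := by
      rw [← Matrix.mul_assoc, Matrix.mul_assoc P, hc, Matrix.mul_smul, ← Matrix.mul_assoc P, hPe,
        Matrix.smul_mul]
      simp only [Matrix.smul_mul, smul_smul, Matrix.mul_assoc]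
    rcases run_zero_sound h (by omega) hd.2 (push g v + e) with h0 | ⟨c'', w, Ψ', hQ, ht, hK⟩
    · left
      rw [Matrix.mul_assoc, e1, Matrix.mul_smul, h0, smul_zero]
    · right
      refine ⟨c * c' * c'', w, Ψ', hQ, Or.inl ⟨e, he, ht⟩, ?_⟩
      rw [Matrix.mul_assoc, e1, Matrix.mul_smul, hK, smul_smul]
  | @restFault n p r K q a b h ih =>
    have e1 : pauliAt q a b * (pauli v * Ψ) =
        sgn ((frameAt q a b).2 ⬝ᵥ v.1) • (pauli (v + frameAt q a b) * Ψ) := by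
      rw [pauliAt_eq_pauli, ← Matrix.mul_assoc, pauli_mul, Matrix.smul_mul, add_comm v]
    rcases run_zero_sound h (by omega) hd (v + frameAt q a b) with h0 | ⟨c', w, Ψ', hQ, ht, hK⟩
    · left
      rw [Matrix.mul_assoc, e1, Matrix.mul_smul, h0, smul_zero]
    · right
      refine ⟨sgn ((frameAt q a b).2 ⬝ᵥ v.1) * c', w, Ψ', hQ, faulty_of_trace p q a b ht, ?_⟩
      rw [Matrix.mul_assoc, e1, Matrix.mul_smul, hK, smul_smul]

end Propagation

/-! ## The round-robin procedure without faults -/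

section Networks

variable {ι : Type} [Fintype ι] [DecidableEq ι]

/-- The operator that maps `|y⟩` to `|f y⟩`. -/
noncomputable def funOp (f : (ι → Bit) → ι → Bit) : Op ι ι :=
  Matrix.of fun x y => if x = f y then 1 else 0

theorem funOp_mul (f g : (ι → Bit) → ι → Bit) : funOp f * funOp g = funOp (f ∘ g) := by
  ext x y
  simp [funOp, Matrix.mul_apply]

theorem funOp_id : (funOp id : Op ι ι) = 1 := by
  ext x y
  simp [funOp, Matrix.one_apply]

theorem funOp_mul_apply {m : Type} {f : (ι → Bit) → ι → Bit} (hf : Function.Involutive f)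
    (Ψ : Matrix (ι → Bit) m ℂ) (x : ι → Bit) (y : m) : (funOp f * Ψ) x y = Ψ (f x) y := by
  have h : ∀ z, x = f z ↔ z = f x := fun z =>
    ⟨fun h => by rw [h, hf], fun h => by rw [h, hf]⟩
  simp [funOp, Matrix.mul_apply, h]

/-- The action of a `CNOT` gate on bit strings. -/
def cnotFun (c t : ι) (y : ι → Bit) : ι → Bit := y + Pi.single t (y c)

theorem cnotOp_eq (c t : ι) : cnotOp c t = funOp (cnotFun c t) := rfl

theorem cnotOp_apply (c t : ι) (x y : ι → Bit) :
    cnotOp c t x y = if x = cnotFun c t y then 1 else 0 := rfl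

theorem cnotFun_involutive {c t : ι} (h : c ≠ t) : Function.Involutive (cnotFun c t) := by
  intro y
  rw [cnotFun, cnotFun, Pi.add_apply, Pi.single_eq_of_ne h, add_zero, bits_add_add_cancel]

theorem cnotOp_mul_self {c t : ι} (h : c ≠ t) : cnotOp c t * cnotOp c t = 1 := by
  rw [cnotOp_eq, funOp_mul, (cnotFun_involutive h).comp_self, funOp_id]

theorem cnotOp_cancel {m : Type} {c t : ι} (h : c ≠ t) (Ψ : Matrix (ι → Bit) m ℂ) :
    cnotOp c t * (cnotOp c t * Ψ) = Ψ := by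
  rw [← Matrix.mul_assoc, cnotOp_mul_self h, Matrix.one_mul]

theorem cnotOp_comm {c t c' t' : ι} (h : c ≠ t') (h' : c' ≠ t) :
    cnotOp c t * cnotOp c' t' = cnotOp c' t' * cnotOp c t := by
  simp only [cnotOp_eq, funOp_mul]
  congr 1
  funext y
  simp only [Function.comp_apply, cnotFun, Pi.add_apply, Pi.single_eq_of_ne h,
    Pi.single_eq_of_ne h', add_zero]
  abel

theorem cnotOp_left_comm {m : Type} {c t c' t' : ι} (h : c ≠ t') (h' : c' ≠ t)
    (Ψ : Matrix (ι → Bit) m ℂ) :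
    cnotOp c t * (cnotOp c' t' * Ψ) = cnotOp c' t' * (cnotOp c t * Ψ) := by
  rw [← Matrix.mul_assoc, cnotOp_comm h h', Matrix.mul_assoc]

theorem cnotOp_mul_diagonal {c t : ι} (D : (ι → Bit) → ℂ) :
    cnotOp c t * diagonal D = of fun x y => if x = cnotFun c t y then D y else 0 := by
  ext x y
  rw [Matrix.mul_diagonal, cnotOp_apply, of_apply, ite_mul, one_mul, zero_mul]

theorem czOp_mul_cnotOp {c t i j : ι} (hi : i ≠ t) (hj : j ≠ t) :
    czOp i j * cnotOp c t = cnotOp c t * czOp i j := by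
  rw [czOp, cnotOp_mul_diagonal]
  ext x y
  rw [Matrix.diagonal_mul]
  rw [cnotOp_apply, of_apply]
  split_ifs with h
  · rw [h, mul_one, cnotFun, Pi.add_apply, Pi.add_apply, Pi.single_eq_of_ne hi,
      Pi.single_eq_of_ne hj, add_zero, add_zero]
  · rw [mul_zero]

/-- The `CZ` gadget without faults acts as a `CZ` gate. -/
theorem gadget_eq {a c t : ι} (hac : a ≠ c) (hct : c ≠ t) :
    cnotOp a c * (czOp a t * (czOp c t * cnotOp a c)) = czOp c t := by
  have h : czOp a t * (czOp c t * cnotOp a c) = cnotOp a c * czOp c t := by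
    rw [czOp, czOp, cnotOp_mul_diagonal]
    ext x y
    rw [Matrix.diagonal_mul, Matrix.diagonal_mul, cnotOp_apply, of_apply]
    split_ifs with h
    · rw [h, mul_one, ← sgn_add, cnotFun]
      simp only [Pi.add_apply, Pi.single_eq_of_ne hac, Pi.single_eq_of_ne hct.symm,
        Pi.single_eq_same, add_zero]
      congr 1
      rw [add_mul, add_comm (y c * y t), ← add_assoc, bit_add_self, zero_add]
    · rw [mul_zero, mul_zero]
  rw [h, ← Matrix.mul_assoc, cnotOp_mul_self hac, Matrix.one_mul]

/-! ### Paulis and preparations on other qubits -/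

theorem symp_frameAt (q : ι) (a b : Bit) (v : Frame ι) :
    symp (frameAt q a b) v = a * v.2 q + b * v.1 q := by
  simp [symp, frameAt]

theorem basisFrame_eq (b : Basis) (q : ι) : ∃ a a' : Bit, basisFrame b q 1 = frameAt q a a' := by
  cases b <;> exact ⟨_, _, rfl⟩

theorem flipFrame_eq (b : Basis) (q : ι) (m : Bit) :
    ∃ a a' : Bit, flipFrame b q m = frameAt q a a' := by
  cases b <;> exact ⟨_, _, rfl⟩

theorem commute_prepOp {q : ι} {N : Op ι ι}
    (h : ∀ a a', Commute N (pauli (frameAt q a a'))) (b : Basis) (s : Bit) :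
    Commute N (prepOp b q s) := by
  obtain ⟨a, a', e⟩ := basisFrame_eq b q
  obtain ⟨a₂, a₂', e₂⟩ := flipFrame_eq b q s
  rw [prepOp_eq, measOp_eq, e, e₂]
  exact (h _ _).mul_right (((Commute.one_right N).add_right ((h _ _).smul_right _)).smul_right _)

theorem commute_pauli_frameAt {q q' : ι} (h : q ≠ q') (a b a' b' : Bit) :
    Commute (pauli (frameAt q a b)) (pauli (frameAt q' a' b')) := by
  rw [Commute, SemiconjBy, pauli_comm, symp_frameAt]
  simp [frameAt, Pi.single_eq_of_ne h]

theorem commute_cnotOp_frameAt {q c t : ι} (hct : c ≠ t) (hc : q ≠ c) (ht : q ≠ t) (a b : Bit) :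
    Commute (cnotOp c t) (pauli (frameAt q a b)) := by
  rw [Commute, SemiconjBy, cnotOp_mul_pauli hct]
  simp [push, frameAt, Pi.single_eq_of_ne hc.symm, Pi.single_eq_of_ne ht.symm]

theorem commute_czOp_frameAt {q i j : ι} (hi : q ≠ i) (hj : q ≠ j) (a b : Bit) :
    Commute (czOp i j) (pauli (frameAt q a b)) := by
  rw [Commute, SemiconjBy, czOp_mul_pauli]
  simp [push, frameAt, Pi.single_eq_of_ne hi.symm, Pi.single_eq_of_ne hj.symm]

theorem basisFrame_mul_prepOp (b : Basis) (q : ι) (s : Bit) :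
    pauli (basisFrame b q 1) * prepOp b q s = prepOp b q s := by
  have h : flip b q (flipFrame b q s) = s := by
    cases b <;> simp [flip, flipFrame, frameAt]
  rw [prepOp_eq, ← Matrix.mul_assoc, pauli_comm, symp_basisFrame, h, Matrix.smul_mul,
    Matrix.mul_assoc, basisFrame_mul_measOp, Matrix.mul_smul, smul_smul, sgn_mul_self, one_smul]

/-- The qubit `q` is in the state prepared in the basis `b`. -/
def Prepared {m : Type} (b : Basis) (q : ι) (Ψ : Matrix (ι → Bit) m ℂ) : Prop :=
  pauli (basisFrame b q 1) * Ψ = Ψ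

theorem Prepared.mul {m : Type} {b : Basis} {q : ι} {Ψ : Matrix (ι → Bit) m ℂ}
    (h : Prepared b q Ψ) {N : Op ι ι} (hN : ∀ a a', Commute N (pauli (frameAt q a a'))) :
    Prepared b q (N * Ψ) := by
  obtain ⟨a, a', e⟩ := basisFrame_eq b q
  rw [Prepared, e] at h ⊢
  rw [← Matrix.mul_assoc, ← (hN a a').eq, Matrix.mul_assoc, h]

theorem Prepared.cnot {m : Type} {b : Basis} {q c t : ι} {Ψ : Matrix (ι → Bit) m ℂ}
    (h : Prepared b q Ψ) (hct : c ≠ t) (hc : q ≠ c) (ht : q ≠ t) : Prepared b q (cnotOp c t * Ψ) :=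
  h.mul (commute_cnotOp_frameAt hct hc ht)

theorem Prepared.cz {m : Type} {b : Basis} {q i j : ι} {Ψ : Matrix (ι → Bit) m ℂ}
    (h : Prepared b q Ψ) (hi : q ≠ i) (hj : q ≠ j) : Prepared b q (czOp i j * Ψ) :=
  h.mul (commute_czOp_frameAt hi hj)

theorem Prepared.prep {m : Type} {b : Basis} {q : ι} {Ψ : Matrix (ι → Bit) m ℂ}
    (h : Prepared b q Ψ) {q' : ι} (hq : q' ≠ q) (b' : Basis) (s : Bit) :
    Prepared b q (prepOp b' q' s * Ψ) :=
  h.mul fun _ _ => (commute_prepOp (fun _ _ => commute_pauli_frameAt hq.symm _ _ _ _) b' s).symm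

theorem prepared_prepOp {m : Type} (b : Basis) (q : ι) (s : Bit) (Ψ : Matrix (ι → Bit) m ℂ) :
    Prepared b q (prepOp b q s * Ψ) := by
  rw [Prepared, ← Matrix.mul_assoc, basisFrame_mul_prepOp]

/-- Lets the preparation of one ancilla be moved before the coupling of a flag that is open on the
other one. -/
theorem prepOp_mul_cnotOp {m : Type} {q c t : ι} (hct : c ≠ t) (hc : q ≠ c) (ht : q ≠ t)
    (b : Basis) (s : Bit) (Ψ : Matrix (ι → Bit) m ℂ) :
    prepOp b q s * (cnotOp c t * Ψ) = cnotOp c t * (prepOp b q s * Ψ) := by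
  rw [← Matrix.mul_assoc, ← (commute_prepOp (commute_cnotOp_frameAt hct hc ht) b s).eq,
    Matrix.mul_assoc]

end Networks

/-! ### States between the steps -/

theorem tensorAnc_add {κ : Type} (M : Op (Fin 15) κ) (A B : Op (Fin 2) (Fin 2)) :
    tensorAnc M (A + B) = tensorAnc M A + tensorAnc M B := by
  ext x y
  simp only [tensorAnc, Matrix.add_apply, of_apply]
  ring

theorem d_ne_anc (n : ℕ) (i : Fin 2) : d n ≠ anc i := Sum.inl_ne_inr

theorem anc_ne_d (n : ℕ) (i : Fin 2) : anc i ≠ d n := Sum.inr_ne_inl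

theorem anc_ne {i j : Fin 2} (h : i ≠ j) : anc i ≠ anc j := fun e => h (Sum.inr_injective e)

/-- The states of the `17` qubits with an encoded reference system. -/
abbrev State : Type := Matrix (Qubit → Bit) ((Fin 7 → Bit) × (Fin 2 → Bit)) ℂ

/-- The `CZ` gates in `l` have been applied to the encoded state, and the ancilla qubits are not
entangled with the code block. -/
def Closed (l : List (ℕ × ℕ)) (Ψ : State) : Prop :=
  ∃ A, Ψ = tensorAnc (czCircuit l * encoder) A

/-- The `CZ` gates in `l` have been applied to the encoded state, and there is an open flag on
ancilla `a` for the qubit `c`. -/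
def Open (c : ℕ) (a : Fin 2) (l : List (ℕ × ℕ)) (Ψ : State) : Prop :=
  ∃ Φ, Closed l Φ ∧ Prepared .Z (anc a) Φ ∧ Ψ = cnotOp (d c) (anc a) * Φ

theorem Closed.pauli_anc {l : List (ℕ × ℕ)} {Ψ : State} (h : Closed l Ψ) (i : Fin 2) (a b : Bit) :
    Closed l (pauli (frameAt (anc i) a b) * Ψ) := by
  obtain ⟨A, rfl⟩ := h
  rw [pauli_mul_tensorAnc]
  have e : dataFrame (frameAt (anc i) a b) = 0 := by
    refine Prod.ext ?_ ?_ <;> funext q <;> simp [dataFrame, frameAt, anc]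
  rw [e, pauli_zero, Matrix.one_mul]
  exact ⟨_, rfl⟩

theorem Closed.smul {l : List (ℕ × ℕ)} {Ψ : State} (h : Closed l Ψ) (c : ℂ) :
    Closed l (c • Ψ) := by
  obtain ⟨A, rfl⟩ := h
  exact ⟨_, tensorAnc_smul _ _ _⟩

theorem Closed.add {l : List (ℕ × ℕ)} {Ψ Φ : State} (h : Closed l Ψ) (h' : Closed l Φ) :
    Closed l (Ψ + Φ) := by
  obtain ⟨A, rfl⟩ := h
  obtain ⟨B, rfl⟩ := h'
  exact ⟨_, (tensorAnc_add _ _ _).symm⟩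

theorem Closed.prep {l : List (ℕ × ℕ)} {Ψ : State} (h : Closed l Ψ) (b : Basis) (i : Fin 2)
    (s : Bit) : Closed l (prepOp b (anc i) s * Ψ) := by
  obtain ⟨a, a', e⟩ := basisFrame_eq b (anc i)
  obtain ⟨a₂, a₂', e₂⟩ := flipFrame_eq b (anc i) s
  rw [prepOp_eq, measOp_eq, e, e₂, Matrix.mul_assoc, Matrix.smul_mul, Matrix.add_mul,
    Matrix.smul_mul, Matrix.one_mul]
  exact ((h.add ((h.pauli_anc i a a').smul _)).smul _).pauli_anc i _ _

theorem czOp_inl (i j : Fin 15) : (czOp (Sum.inl i) (Sum.inl j) : Op Qubit Qubit) =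
    onData (czOp i j) := by
  ext x y
  simp only [czOp, onData, of_apply, Matrix.diagonal_apply, Matrix.one_apply,
    qubit_ext_iff (x := x), Function.comp_apply]
  split_ifs <;> simp_all

theorem Closed.cz {l : List (ℕ × ℕ)} {Ψ : State} (h : Closed l Ψ) (c t : ℕ) :
    Closed ((c, t) :: l) (czOp (d c) (d t) * Ψ) := by
  obtain ⟨A, rfl⟩ := h
  refine ⟨A, ?_⟩
  rw [d, d, czOp_inl, onData_mul_tensorAnc, ← Matrix.mul_assoc]
  simp only [czCircuit, List.map_cons, List.prod_cons]

/-- A circuit of `CZ` gates depends only on its phase polynomial: the order of the gates is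
irrelevant, and repeated gates cancel. -/
theorem Closed.congr {l l' : List (ℕ × ℕ)} {Ψ : State} (h : Closed l Ψ)
    (hl : ∀ x, czPhase l x = czPhase l' x) : Closed l' Ψ := by
  obtain ⟨A, rfl⟩ := h
  refine ⟨A, ?_⟩
  rw [czCircuit_eq, czCircuit_eq, funext hl]

theorem Open.close {c : ℕ} {a : Fin 2} {l : List (ℕ × ℕ)} {Ψ : State} (h : Open c a l Ψ) :
    Closed l (cnotOp (d c) (anc a) * Ψ) ∧ Prepared .Z (anc a) (cnotOp (d c) (anc a) * Ψ) := by
  obtain ⟨Φ, hΦ, hp, rfl⟩ := h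
  rw [cnotOp_cancel (d_ne_anc c a)]
  exact ⟨hΦ, hp⟩

/-! ### The blocks of the procedure -/

theorem det_gates_cons {m : Type} {g : Gate Qubit} {l : List (Gate Qubit)} {k : Proc Qubit}
    {Ψ : Matrix (Qubit → Bit) m ℂ} {Q : Matrix (Qubit → Bit) m ℂ → Prop} :
    Det (gates (g :: l) k) Ψ Q ↔ Propagates g ∧ Det (gates l k) (idealOp g * Ψ) Q := Iff.rfl

theorem gates_append (l l' : List (Gate Qubit)) (k : Proc Qubit) :
    gates (l ++ l') k = gates l (gates l' k) := List.foldr_append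

theorem det_pauli {α : Type} (l : List α) (q : α → Qubit) (a b : α → Bit) {k : Proc Qubit}
    {m : Type} {Ψ : Matrix (Qubit → Bit) m ℂ} {Q : Matrix (Qubit → Bit) m ℂ → Prop}
    (h : Det k Ψ Q) : Det (gates (l.map fun i => .pauli (q i) (a i) (b i)) k) Ψ Q := by
  induction l with
  | nil => exact h
  | cons i l ih =>
    rw [List.map_cons, det_gates_cons]
    refine ⟨trivial, ?_⟩
    rw [idealOp, Matrix.one_mul]
    · exact ih
    all_goals simp

theorem det_czGates {c : ℕ} {ts : List ℕ} {l : List (ℕ × ℕ)} {k : Proc Qubit} {Ψ : State}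
    {Q : State → Prop} (h : Closed l Ψ)
    (hk : ∀ Ψ', Closed ((ts.map fun t => (c, t)).reverse ++ l) Ψ' → Det k Ψ' Q) :
    Det (gates (czGates c ts) k) Ψ Q := by
  induction ts generalizing l Ψ with
  | nil => exact hk _ h
  | cons t ts ih =>
    rw [czGates, List.map_cons, det_gates_cons]
    refine ⟨trivial, ih (h.cz c t) fun Ψ' h' => hk Ψ' ?_⟩
    rwa [List.map_cons, List.reverse_cons, List.append_assoc, List.singleton_append]

/-- The parity of the bits of the qubits in `s`. -/
def parity (s : List (Fin 15)) (y : Qubit → Bit) : Bit := (s.map fun q => y (.inl q)).sum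

/-- The parity of the qubits in `s` is written into ancilla `0`. -/
noncomputable def collect (s : List (Fin 15)) (Ψ : State) : State :=
  s.foldl (fun Φ q => cnotOp (.inl q) (anc 0) * Φ) Ψ

theorem collect_eq (s : List (Fin 15)) (Ψ : State) :
    collect s Ψ = funOp (fun y => y + Pi.single (anc 0) (parity s y)) * Ψ := by
  induction s generalizing Ψ with
  | nil =>
    have e : (fun y : Qubit → Bit => y + Pi.single (anc 0) (parity [] y)) = id := by
      funext y
      simp [parity]
    rw [e, funOp_id, Matrix.one_mul, collect, List.foldl_nil]
  | cons q s ih =>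
    rw [collect, List.foldl_cons, ← collect, ih, cnotOp_eq, ← Matrix.mul_assoc, funOp_mul]
    congr 2
    funext y
    have e : parity s (cnotFun (Sum.inl q) (anc 0) y) = parity s y := by
      simp [parity, cnotFun, anc]
    rw [Function.comp_apply, e, cnotFun, add_assoc, ← Pi.single_add]
    simp [parity]

theorem sum_checkSupport (i : Fin 4) (x : Fin 15 → Bit) :
    ((checkSupport i).map x).sum = checks i ⬝ᵥ x := by
  have h : ∀ l : List (Fin 15), ((l.filter fun q => checks i q = 1).map x).sum =
      (l.map fun q => checks i q * x q).sum := by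
    intro l
    induction l with
    | nil => rfl
    | cons q l ih =>
      rw [List.filter_cons, List.map_cons, List.sum_cons, ← ih]
      rcases bit_cases (checks i q) with h | h
      · simp [h]
      · simp [h]
  rw [checkSupport, h, ← List.ofFn_eq_map, List.sum_ofFn, dotProduct]

theorem pauliZ_check_mul_czCircuit (l : List (ℕ × ℕ)) (i : Fin 4) :
    pauli (0, checks i) * (czCircuit l * encoder) = czCircuit l * encoder := by
  have h : pauli (0, checks i) * czCircuit l = czCircuit l * pauli (0, checks i) := by
    rw [pauli_diagonal, czCircuit_eq, Matrix.diagonal_mul_diagonal, Matrix.diagonal_mul_diagonal]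
    simp only [mul_comm]
  rw [← Matrix.mul_assoc, h, Matrix.mul_assoc, pauliZ_check_mul_encoder]

/-- `CZ` gates commute with `Z` stabilizers, so the amplitude is supported on strings of even parity
for the check, and writing this parity into the ancilla does nothing. -/
theorem collect_of_closed {l : List (ℕ × ℕ)} {Ψ : State} (h : Closed l Ψ) {s : List (Fin 15)}
    {i : Fin 4} (hs : ∀ x : Fin 15 → Bit, (s.map x).sum = checks i ⬝ᵥ x) : collect s Ψ = Ψ := by
  obtain ⟨A, rfl⟩ := h
  have hp : ∀ y b, parity s (y + Pi.single (anc 0) b) = parity s y := by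
    intro y b
    simp [parity, anc]
  have hf : Function.Involutive
      (fun y : Qubit → Bit => y + Pi.single (anc 0) (parity s y)) := by
    intro y
    simp only [hp, bits_add_add_cancel]
  rw [collect_eq]
  ext x y
  rw [funOp_mul_apply hf]
  have e : (x + Pi.single (anc 0) (parity s x)) ∘ Sum.inl = x ∘ Sum.inl := by
    funext q
    simp [anc]
  have hM := congrFun (congrFun (pauliZ_check_mul_czCircuit l i) (x ∘ Sum.inl)) y.1
  rw [pauli_mul_apply] at hM
  have hpx : parity s x = checks i ⬝ᵥ (x ∘ Sum.inl) := hs _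
  rcases bit_cases (parity s x) with h0 | h1
  · rw [h0, Pi.single_zero, add_zero]
  · have hz : (czCircuit l * encoder) (x ∘ Sum.inl) y.1 = 0 := by
      simp only [add_zero] at hM
      rw [← hpx, h1, sgn_one] at hM
      linear_combination (-1 / 2 : ℂ) * hM
    rw [tensorAnc, of_apply, of_apply, e, hz, zero_mul, zero_mul]

/-- The two couplings of the flag cancel, and the eight couplings of the parity ancilla together act
trivially on a closed state. Only the coupling of `q₈` to its flag survives. -/
theorem det_flaggedSyndrome {q₁ q₂ q₃ q₄ q₅ q₆ q₇ q₈ : ℕ} {k : Bit → Bit → Proc Qubit}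
    {l : List (ℕ × ℕ)} {Ψ : State} {Q : State → Prop} (h : Closed l Ψ) (i : Fin 4)
    (hs : ([q₁, q₂, q₃, q₄, q₅, q₆, q₇, q₈].map dat).Perm (checkSupport i))
    (hk : ∀ f m Ψ', Open q₈ 1 l Ψ' → Det (k f m) Ψ' Q) :
    Det (flaggedSyndrome q₁ q₂ q₃ q₄ q₅ q₆ q₇ q₈ k) Ψ Q := by
  have h10 : anc 1 ≠ anc 0 := anc_ne (by decide)
  have h01 : anc 0 ≠ anc 1 := anc_ne (by decide)
  intro s₀ s₁
  have hΨ₀ : Prepared .Z (anc 0) (prepOp .X (anc 1) s₁ * (prepOp .Z (anc 0) s₀ * Ψ)) :=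
    (prepared_prepOp .Z (anc 0) s₀ Ψ).prep h10 _ _
  have hΨ₁ := prepared_prepOp .X (anc 1) s₁ (prepOp .Z (anc 0) s₀ * Ψ)
  have hΨ := (h.prep .Z 0 s₀).prep .X 1 s₁
  generalize prepOp .X (anc 1) s₁ * (prepOp .Z (anc 0) s₀ * Ψ) = Φ at hΨ₀ hΨ₁ hΨ
  have hC := collect_of_closed hΨ fun x => (hs.map x).sum_eq.trans (sum_checkSupport i x)
  have hc : cnotOp (d q₈) (anc 0) * (cnotOp (d q₇) (anc 0) * (cnotOp (d q₆) (anc 0) *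
      (cnotOp (d q₅) (anc 0) * (cnotOp (d q₄) (anc 0) * (cnotOp (d q₃) (anc 0) *
      (cnotOp (d q₂) (anc 0) * (cnotOp (d q₁) (anc 0) * Φ))))))) = Φ := hC
  -- The eight couplings multiply to the identity on `Φ`, so the first seven act like the eighth
  -- alone.
  have hN : cnotOp (anc 1) (anc 0) * (cnotOp (d q₇) (anc 0) * (cnotOp (d q₆) (anc 0) *
      (cnotOp (d q₅) (anc 0) * (cnotOp (d q₄) (anc 0) * (cnotOp (d q₃) (anc 0) *
      (cnotOp (d q₂) (anc 0) * (cnotOp (anc 1) (anc 0) * (cnotOp (d q₁) (anc 0) * Φ)))))))) =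
      cnotOp (d q₈) (anc 0) * Φ := by
    rw [cnotOp_left_comm (d_ne_anc q₂ 0) h10, cnotOp_left_comm (d_ne_anc q₃ 0) h10,
      cnotOp_left_comm (d_ne_anc q₄ 0) h10, cnotOp_left_comm (d_ne_anc q₅ 0) h10,
      cnotOp_left_comm (d_ne_anc q₆ 0) h10, cnotOp_left_comm (d_ne_anc q₇ 0) h10,
      cnotOp_cancel h10, ← cnotOp_cancel (d_ne_anc q₈ 0) (cnotOp (d q₇) (anc 0) * _), hc]
  refine ⟨d_ne_anc _ _, h10, d_ne_anc _ _, d_ne_anc _ _, d_ne_anc _ _, d_ne_anc _ _, d_ne_anc _ _,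
    d_ne_anc _ _, h10, ?_⟩
  simp only [idealOp]
  rw [hN]
  refine ⟨hΨ₁.cnot (d_ne_anc _ _) (anc_ne_d _ _) h10, fun f s₂ => ?_⟩
  rw [prepOp_mul_cnotOp (d_ne_anc _ _) (anc_ne_d _ _) h10]
  have hΦ₀ := hΨ₀.prep h10 .Z s₂
  have hΦ₁ := prepared_prepOp .Z (anc 1) s₂ Φ
  have hΦ := hΨ.prep .Z 1 s₂
  generalize prepOp .Z (anc 1) s₂ * Φ = Φ' at hΦ₀ hΦ₁ hΦ
  refine ⟨d_ne_anc _ _, d_ne_anc _ _, ?_⟩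
  simp only [idealOp]
  rw [cnotOp_left_comm (d_ne_anc _ _) (d_ne_anc _ _), cnotOp_cancel (d_ne_anc _ _)]
  exact ⟨hΦ₀.cnot (d_ne_anc _ _) (anc_ne_d _ _) h01, fun m => hk f m _ ⟨Φ', hΦ, hΦ₁, rfl⟩⟩

theorem det_czGadget {c t : ℕ} (hct : d c ≠ d t) {a a' : Fin 2} (ha : a ≠ a')
    {k : Bit → Proc Qubit} {l : List (ℕ × ℕ)} {Ψ : State} {Q : State → Prop} (h : Open c a' l Ψ)
    (hk : ∀ m Ψ', Open c a' ((c, t) :: l) Ψ' → Det (k m) Ψ' Q) :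
    Det (czGadget c t a k) Ψ Q := by
  obtain ⟨Φ, hΦ, hp, rfl⟩ := h
  intro s
  rw [prepOp_mul_cnotOp (d_ne_anc _ _) (anc_ne_d _ _) (anc_ne ha)]
  refine ⟨anc_ne_d _ _, trivial, trivial, anc_ne_d _ _, ?_⟩
  have hΦ' := hΦ.prep .X a s
  have hp' := hp.prep (anc_ne ha) .X s
  have hX := prepared_prepOp .X (anc a) s Φ
  generalize prepOp .X (anc a) s * Φ = Φ' at hΦ' hp' hX
  have e : cnotOp (anc a) (d c) * (czOp (anc a) (d t) * (czOp (d c) (d t) *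
      (cnotOp (anc a) (d c) * (cnotOp (d c) (anc a') * Φ')))) =
      cnotOp (d c) (anc a') * (czOp (d c) (d t) * Φ') := by
    simp only [← Matrix.mul_assoc]
    rw [Matrix.mul_assoc (cnotOp (anc a) (d c)), Matrix.mul_assoc (cnotOp (anc a) (d c)),
      Matrix.mul_assoc (czOp (anc a) (d t)), gadget_eq (anc_ne_d _ _) hct,
      czOp_mul_cnotOp (d_ne_anc _ _) (d_ne_anc _ _)]
  simp only [idealOp]
  rw [e]
  exact ⟨(hX.cz (anc_ne_d _ _) (anc_ne_d _ _)).cnot (d_ne_anc _ _) (anc_ne_d _ _) (anc_ne ha),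
    fun m => hk m _ ⟨_, hΦ'.cz c t, hp'.cz (anc_ne_d _ _) (anc_ne_d _ _), rfl⟩⟩

/-- The open flag is moved from ancilla `a'` to ancilla `a`. -/
theorem det_moveFlag {c : ℕ} {a a' : Fin 2} (ha : a ≠ a') {k : Bit → Proc Qubit}
    {l : List (ℕ × ℕ)} {Ψ : State} {Q : State → Prop} (h : Open c a' l Ψ)
    (hk : ∀ m Ψ', Open c a l Ψ' → Det (k m) Ψ' Q) :
    Det (.prep .Z (anc a) <| gates [.cnot (d c) (anc a), .cnot (d c) (anc a')] <|
      .meas .Z (anc a') k) Ψ Q := by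
  obtain ⟨Φ, hΦ, hp, rfl⟩ := h
  intro s
  rw [prepOp_mul_cnotOp (d_ne_anc _ _) (anc_ne_d _ _) (anc_ne ha)]
  refine ⟨d_ne_anc _ _, d_ne_anc _ _, ?_⟩
  have hΦ' := hΦ.prep .Z a s
  have hp' := hp.prep (anc_ne ha) .Z s
  have hZ := prepared_prepOp .Z (anc a) s Φ
  generalize prepOp .Z (anc a) s * Φ = Φ' at hΦ' hp' hZ
  simp only [idealOp]
  rw [cnotOp_left_comm (d_ne_anc _ _) (d_ne_anc _ _), cnotOp_cancel (d_ne_anc _ _)]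
  exact ⟨hp'.cnot (d_ne_anc _ _) (anc_ne_d _ _) (anc_ne ha.symm),
    fun m => hk m _ ⟨Φ', hΦ', hZ, rfl⟩⟩

/-- On the ideal state all three `CZ` gates are applied and the last flag is closed before the
branch is chosen, so both continuations start from the same kind of state. -/
theorem det_protectedCZ {c t₁ t₂ t₃ : ℕ} (h₁ : d c ≠ d t₁) (h₂ : d c ≠ d t₂) (h₃ : d c ≠ d t₃)
    {ok bad : Proc Qubit} {l : List (ℕ × ℕ)} {Ψ : State} {Q : State → Prop} (h : Open c 1 l Ψ)
    (hok : ∀ Ψ', Closed ((c, t₃) :: (c, t₂) :: (c, t₁) :: l) Ψ' → Det ok Ψ' Q)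
    (hbad : ∀ Ψ', Closed ((c, t₃) :: (c, t₂) :: (c, t₁) :: l) Ψ' → Det bad Ψ' Q) :
    Det (protectedCZ c t₁ t₂ t₃ ok bad) Ψ Q := by
  have h01 : (0 : Fin 2) ≠ 1 := by decide
  refine det_czGadget h₁ h01 h fun m₁ Ψ₁ H₁ => ?_
  refine det_moveFlag h01 H₁ fun f₁ Ψ₂ H₂ => ?_
  refine det_czGadget h₂ h01.symm H₂ fun m₂ Ψ₃ H₃ => ?_
  refine det_moveFlag h01.symm H₃ fun f₂ Ψ₄ H₄ => ?_
  refine det_czGadget h₃ h01 H₄ fun m₃ Ψ₅ H₅ => ?_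
  refine ⟨d_ne_anc _ _, H₅.close.2, fun f₃ => ?_⟩
  beta_reduce
  split_ifs
  · exact hok _ H₅.close.1
  · exact hbad _ H₅.close.1

/-! ### Error correction -/

theorem det_collect {s : List (Fin 15)} {k : Proc Qubit} {Ψ : State} {Q : State → Prop}
    (h : Det k (collect s Ψ) Q) :
    Det (gates (s.map fun q => .cnot (.inl q) (anc 0)) k) Ψ Q := by
  induction s generalizing Ψ with
  | nil => exact h
  | cons q s ih => exact ⟨Sum.inl_ne_inr, ih h⟩

theorem det_measureStabZ {s : List (Fin 4)} {k : List Bit → Proc Qubit} {l : List (ℕ × ℕ)}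
    {Ψ : State} {Q : State → Prop} (h : Closed l Ψ)
    (hk : ∀ ms Ψ', Closed l Ψ' → Det (k ms) Ψ' Q) : Det (measureStabZ s k) Ψ Q := by
  induction s generalizing k Ψ with
  | nil => exact hk _ _ h
  | cons i s ih =>
    intro b
    have h' := h.prep .Z 0 b
    refine det_collect ?_
    rw [collect_of_closed h' (sum_checkSupport i)]
    exact ⟨prepared_prepOp .Z (anc 0) b Ψ, fun m => ih h' fun ms => hk (m :: ms)⟩

/-- The `X` operators on the qubits in `s`, controlled by ancilla `0`. -/
noncomputable def distribute (s : List (Fin 15)) (Ψ : State) : State :=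
  s.foldl (fun Φ q => cnotOp (anc 0) (.inl q) * Φ) Ψ

theorem det_distribute {s : List (Fin 15)} {k : Proc Qubit} {Ψ : State} {Q : State → Prop}
    (h : Det k (distribute s Ψ) Q) :
    Det (gates (s.map fun q => .cnot (anc 0) (.inl q)) k) Ψ Q := by
  induction s generalizing Ψ with
  | nil => exact h
  | cons q s ih => exact ⟨Sum.inr_ne_inl, ih h⟩

/-- The bit string with ones on the qubits in `s`. -/
def support (s : List (Fin 15)) (b : Bit) : Qubit → Bit :=
  (s.map fun q => (Pi.single (Sum.inl q) b : Qubit → Bit)).sum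

theorem support_anc (s : List (Fin 15)) (b : Bit) : support s b (anc 0) = 0 := by
  induction s with
  | nil => rfl
  | cons q s ih =>
    rw [support, List.map_cons, List.sum_cons, ← support, Pi.add_apply, ih,
      Pi.single_eq_of_ne (by exact Sum.inr_ne_inl), add_zero]

theorem distribute_eq (s : List (Fin 15)) (Ψ : State) :
    distribute s Ψ = funOp (fun y => y + support s (y (anc 0))) * Ψ := by
  induction s generalizing Ψ with
  | nil =>
    have e : (fun y : Qubit → Bit => y + support [] (y (anc 0))) = id := by
      funext y
      simp [support]
    rw [e, funOp_id, Matrix.one_mul, distribute, List.foldl_nil]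
  | cons q s ih =>
    rw [distribute, List.foldl_cons, ← distribute, ih, cnotOp_eq, ← Matrix.mul_assoc, funOp_mul]
    congr 2
    funext y
    have e : cnotFun (anc 0) (Sum.inl q) y (anc 0) = y (anc 0) := by
      simp [cnotFun, anc]
    rw [Function.comp_apply, e, cnotFun, add_assoc]
    simp [support]

theorem support_checkSupport (i : Fin 4) (b : Bit) (q : Fin 15) :
    support (checkSupport i) b (.inl q) = b * checks i q := by
  have h : ∀ l : List (Fin 15), support l b (.inl q) =
      b * (l.map (Pi.single q 1 : Fin 15 → Bit)).sum := by
    intro l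
    induction l with
    | nil => simp [support]
    | cons p l ih =>
      rw [support, List.map_cons, List.sum_cons, ← support, Pi.add_apply, ih, List.map_cons,
        List.sum_cons, mul_add]
      congr 1
      by_cases hq : q = p
      · subst hq
        simp
      · rw [Pi.single_eq_of_ne (by simpa using hq), Pi.single_eq_of_ne (Ne.symm hq), mul_zero]
  rw [h, sum_checkSupport, dotProduct_single, mul_one]

/-- The list of `CZ` gates is required to be empty: this uses invariance under the `X` stabilizers,
and `CZ` gates need not commute with these. -/
theorem distribute_of_closed {Ψ : State} (h : Closed [] Ψ) (i : Fin 4) :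
    distribute (checkSupport i) Ψ = Ψ := by
  obtain ⟨A, rfl⟩ := h
  have hf : Function.Involutive
      (fun y : Qubit → Bit => y + support (checkSupport i) (y (anc 0))) := by
    intro y
    simp only [Pi.add_apply, support_anc, add_zero, bits_add_add_cancel]
  rw [distribute_eq]
  ext x y
  rw [funOp_mul_apply hf, tensorAnc, of_apply, of_apply]
  have e₁ : (x + support (checkSupport i) (x (anc 0))) ∘ Sum.inl =
      x ∘ Sum.inl + x (anc 0) • checks i := by
    funext q
    simp only [Function.comp_apply, Pi.add_apply, support_checkSupport, Pi.smul_apply, smul_eq_mul]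
  have e₂ : (x + support (checkSupport i) (x (anc 0))) ∘ Sum.inr = x ∘ Sum.inr := by
    have h : ∀ (l : List (Fin 15)) (b : Bit) (j : Fin 2), support l b (.inr j) = 0 := by
      intro l b j
      induction l with
      | nil => rfl
      | cons p l ih =>
        rw [support, List.map_cons, List.sum_cons, ← support, Pi.add_apply, ih,
          Pi.single_eq_of_ne Sum.inr_ne_inl, add_zero]
    funext j
    rw [Function.comp_apply, Pi.add_apply, h, add_zero, Function.comp_apply]
  rw [e₁, e₂]
  rcases bit_cases (x (anc 0)) with h0 | h1
  · rw [h0, zero_smul, add_zero]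
  · have hM := congrFun (congrFun (pauliX_check_mul_encoder i) (x ∘ Sum.inl)) y.1
    rw [pauli_mul_apply] at hM
    rw [h1, one_smul, show czCircuit [] = 1 from rfl, Matrix.one_mul, ← hM]
    simp

theorem det_measureStabX {s : List (Fin 4)} {k : List Bit → Proc Qubit} {Ψ : State}
    {Q : State → Prop} (h : Closed [] Ψ)
    (hk : ∀ ms Ψ', Closed [] Ψ' → Det (k ms) Ψ' Q) : Det (measureStabX s k) Ψ Q := by
  induction s generalizing k Ψ with
  | nil => exact hk _ _ h
  | cons i s ih =>
    intro b
    have h' := h.prep .X 0 b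
    refine det_distribute ?_
    rw [distribute_of_closed h' i]
    exact ⟨prepared_prepOp .X (anc 0) b Ψ, fun m => ih h' fun ms => hk (m :: ms)⟩

/-- The correction rule is arbitrary here, because its Pauli gates belong to the error and not to
the ideal state. -/
theorem det_errorCorrection {D : List Bit → Recovery} {k : Proc Qubit} {Ψ : State}
    {Q : State → Prop} (h : Closed [] Ψ) (hk : ∀ Ψ', Closed [] Ψ' → Det k Ψ' Q) :
    Det (errorCorrection D k) Ψ Q :=
  det_measureStabZ h fun _ _ h₁ => det_measureStabX h₁ fun _ _ h₂ => det_pauli _ _ _ _ (hk _ h₂)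

/-! ### The whole procedure -/

theorem Closed.perm {l l' : List (ℕ × ℕ)} {Ψ : State} (h : Closed l Ψ) (hl : l.Perm l') :
    Closed l' Ψ :=
  h.congr fun x => by
    simp only [czPhase]
    exact (hl.map _).sum_eq

theorem Closed.cancel {l l' : List (ℕ × ℕ)} {Ψ : State} (h : Closed l Ψ)
    (hl : l.Perm (l' ++ l')) : Closed [] Ψ :=
  (h.perm hl).congr fun x => by
    simp [czPhase]

theorem det_roundRobinProc (D₁ D₂ : Bit → Bit → List Bit → Recovery) {Ψ : State}
    (h : Closed [] Ψ) : Det (roundRobinProc D₁ D₂) Ψ (Closed roundRobinPairs) := by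
  have hcz : ∀ Ψ, Closed [] Ψ → Det (gates (czGates 4 [5, 6, 7] ++ czGates 8 [9, 10, 11] ++
      czGates 12 [13, 14, 15]) .done) Ψ (Closed roundRobinPairs) := by
    intro Ψ h
    rw [gates_append, gates_append]
    exact det_czGates h fun _ h => det_czGates h fun _ h => det_czGates h fun _ h =>
      h.perm (by decide)
  rw [roundRobinProc]
  refine det_pauli [4, 8, 12] d (fun _ => 0) (fun _ => 1) ?_
  refine det_flaggedSyndrome h 1 (by decide) fun f m Ψ₁ h₁ => ?_
  by_cases hf : ¬ (f = 0 ∧ m = 0)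
  · rw [if_pos hf]
    exact ⟨d_ne_anc _ _, det_errorCorrection h₁.close.1 hcz⟩
  rw [if_neg hf]
  refine det_protectedCZ (t₁ := 5) (t₂ := 6) (t₃ := 7) (by decide) (by decide) (by decide) h₁
    (fun Ψ₂ h₂ => ?_) fun Ψ₂ h₂ => ?_
  swap
  · rw [gates_append]
    exact det_czGates h₂ fun _ h => det_czGates h fun _ h => h.perm (by decide)
  refine det_flaggedSyndrome h₂ 0 (by decide) fun f m Ψ₃ h₃ => ?_
  by_cases hf : ¬ (f = 0 ∧ m = 0)
  · rw [if_pos hf, gates_append]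
    refine ⟨d_ne_anc _ _, ?_⟩
    -- The block from qubit 4 is applied a second time to undo it, since error correction needs the
    -- plain encoded state; all blocks follow afterwards.
    exact det_czGates h₃.close.1 fun _ h =>
      det_errorCorrection (h.cancel (l' := [(4, 5), (4, 6), (4, 7)]) (by decide)) hcz
  rw [if_neg hf]
  refine det_protectedCZ (t₁ := 9) (t₂ := 10) (t₃ := 11) (by decide) (by decide) (by decide) h₃
    (fun Ψ₄ h₄ => ?_) fun Ψ₄ h₄ => ?_
  swap
  · exact det_czGates h₄ fun _ h => h.perm (by decide)
  refine det_flaggedSyndrome h₄ 0 (by decide) fun f m Ψ₅ h₅ => ?_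
  by_cases hf : ¬ (f = 0 ∧ m = 0)
  · rw [if_pos hf, gates_append]
    exact ⟨d_ne_anc _ _, det_czGates h₅.close.1 fun _ h => h.perm (by decide)⟩
  rw [if_neg hf]
  exact det_protectedCZ (t₁ := 13) (t₂ := 14) (t₃ := 15) (by decide) (by decide) (by decide) h₅
    (fun _ h => h.perm (by decide)) fun _ h => h.perm (by decide)

/-! ## Enumeration of the faulty executions

For the enumeration, a Pauli operator on the `17` qubits is represented by a natural number, whose
binary digits `0, …, 16` are the `X` part and whose binary digits `17, …, 33` are the `Z` part. -/

/-- The bit of a Boolean. -/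
def toBit (b : Bool) : Bit := bif b then 1 else 0

theorem toBit_xor (a b : Bool) : toBit (a ^^ b) = toBit a + toBit b := by
  cases a <;> cases b <;> decide

theorem toBit_injective {a b : Bool} (h : toBit a = toBit b) : a = b := by
  revert h
  cases a <;> cases b <;> decide

theorem exists_toBit (a : Bit) : ∃ b, toBit b = a := by
  rcases bit_cases a with rfl | rfl
  exacts [⟨false, rfl⟩, ⟨true, rfl⟩]

/-- Evaluate `n` before `f` is applied. -/
def force {α : Type} (n : ℕ) (f : ℕ → α) : α := Nat.rec (f 0) (fun k _ => f (Nat.succ k)) n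

theorem force_eq {α : Type} (n : ℕ) (f : ℕ → α) : force n f = f n := by
  cases n <;> rfl

/-- The number of a qubit. -/
def index : Qubit → ℕ
  | .inl q => q.val
  | .inr i => 15 + i.val

theorem index_lt (q : Qubit) : index q < 17 := by
  rcases q with q | i <;> simp only [index] <;> omega

theorem index_injective : Function.Injective index := by
  rintro (q | i) (p | j) h <;> simp only [index] at h
  · rw [Fin.ext h]
  · omega
  · omega
  · rw [Fin.ext (by omega : i.val = j.val)]

/-- The Pauli operator with a given number. -/
def decode (v : ℕ) : Frame Qubit :=
  (fun q => toBit (v.testBit (index q)), fun q => toBit (v.testBit (17 + index q)))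

/-- Flip digit `i` of `v` if `b` is true. -/
def flipDigit (b : Bool) (i v : ℕ) : ℕ := bif b then v ^^^ 2 ^ i else v

theorem testBit_flipDigit (b : Bool) (i v j : ℕ) :
    (flipDigit b i v).testBit j = (v.testBit j ^^ (b && decide (i = j))) := by
  cases b <;> simp [flipDigit, Nat.testBit_xor, Nat.testBit_two_pow]

theorem decode_flip_X (b : Bool) (q : Qubit) (v : ℕ) :
    decode (flipDigit b (index q) v) = decode v + frameAt q (toBit b) 0 := by
  refine Prod.ext ?_ ?_ <;> funext p
  · simp only [decode, testBit_flipDigit, toBit_xor, frameAt, Prod.fst_add, Pi.add_apply]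
    congr 1
    by_cases h : p = q
    · subst h
      simp
    · rw [Pi.single_eq_of_ne h, decide_eq_false fun e => h (index_injective e.symm), Bool.and_false]
      rfl
  · have : index q ≠ 17 + index p := by have := index_lt q; omega
    simp [decode, testBit_flipDigit, frameAt, this]

theorem decode_flip_Z (b : Bool) (q : Qubit) (v : ℕ) :
    decode (flipDigit b (17 + index q) v) = decode v + frameAt q 0 (toBit b) := by
  refine Prod.ext ?_ ?_ <;> funext p
  · have : 17 + index q ≠ index p := by have := index_lt p; omega
    simp [decode, testBit_flipDigit, frameAt, this]
  · simp only [decode, testBit_flipDigit, toBit_xor, frameAt, Prod.snd_add, Pi.add_apply]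
    congr 1
    by_cases h : p = q
    · subst h
      simp
    · rw [Pi.single_eq_of_ne h, decide_eq_false fun e => h (index_injective (by omega)),
        Bool.and_false]
      rfl

theorem decode_zero : decode 0 = 0 := by
  refine Prod.ext ?_ ?_ <;> funext p <;> simp [decode, toBit]

/-- Multiply by a Pauli operator on the qubit with number `i`. -/
def addAt (i : ℕ) (a b : Bool) (v : ℕ) : ℕ := flipDigit b (17 + i) (flipDigit a i v)

theorem decode_addAt (q : Qubit) (a b : Bool) (v : ℕ) :
    decode (addAt (index q) a b v) = decode v + frameAt q (toBit a) (toBit b) := by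
  rw [addAt, decode_flip_Z, decode_flip_X, add_assoc, frameAt_add, add_zero, zero_add]

/-- The propagation of a Pauli operator through a gate. -/
def pushNum : Gate Qubit → ℕ → ℕ
  | .cz i j, v => flipDigit (v.testBit (index i)) (17 + index j)
      (flipDigit (v.testBit (index j)) (17 + index i) v)
  | .cnot c t, v => flipDigit (v.testBit (index c)) (index t)
      (flipDigit (v.testBit (17 + index t)) (17 + index c) v)
  | .pauli q a b, v => addAt (index q) (a == 1) (b == 1) v
  | .loc _ _, v => v
  | .relabel _, v => v

theorem decode_pushNum (g : Gate Qubit) (v : ℕ) : decode (pushNum g v) = push g (decode v) := by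
  cases g with
  | cz i j =>
    rw [pushNum, decode_flip_Z, decode_flip_Z, push]
    refine Prod.ext ?_ ?_
    · simp [frameAt]
    · simp only [frameAt, Prod.snd_add, decode]
      abel
  | cnot c t =>
    rw [pushNum, decode_flip_X, decode_flip_Z, push]
    refine Prod.ext ?_ ?_ <;> simp [frameAt, decode]
  | pauli q a b =>
    have h : ∀ a : Bit, toBit (a == 1) = a := by decide
    rw [pushNum, decode_addAt, push, h, h]
  | loc u q => rfl
  | relabel σ => rfl

/-- The digit that a measurement of the qubit with number `i` depends on. -/
def digit : Basis → ℕ → ℕ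
  | .Z, i => i
  | .X, i => 17 + i

theorem flip_decode (b : Basis) (q : Qubit) (v : ℕ) :
    flip b q (decode v) = toBit (v.testBit (digit b (index q))) := by
  cases b <;> rfl

theorem decode_clear (q : Qubit) (v : ℕ) :
    decode (addAt (index q) (v.testBit (index q)) (v.testBit (17 + index q)) v) =
      clear q (decode v) := decode_addAt _ _ _ _

section Enumeration

variable {α : Type} (out : ℕ → ℕ → α)

/-- The result `out r v` of an execution without further faults, with the number `r` of the
measurement record and the number `v` of the final error. -/
def traceNum : Proc Qubit → ℕ → ℕ → α
  | .done, v, r => out r v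
  | .gate g k, v, r => force (pushNum g v) fun v => traceNum k v r
  | .prep _ q k, v, r =>
    force (addAt (index q) (v.testBit (index q)) (v.testBit (17 + index q)) v) fun v =>
      traceNum k v r
  | .meas b q k, v, r =>
    bif v.testBit (digit b (index q)) then force (2 * r + 1) fun r => traceNum (k 1) v r
    else force (2 * r) fun r => traceNum (k 0) v r

/-- All the Pauli operators on the qubit with number `i`, multiplied with a given one. -/
def allAt (i : ℕ) (v : ℕ) : List ℕ :=
  [v, addAt i true false v, addAt i false true v, addAt i true true v]

/-- The results of the executions with one fault. -/
def faultyNum : Proc Qubit → ℕ → ℕ → List α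
  | .done, v, r => (List.range 17).flatMap fun i => (allAt i v).map (out r)
  | .gate (.cz i j) k, v, r => force (pushNum (.cz i j) v) fun v =>
    ((allAt (index i) v).flatMap fun v => (allAt (index j) v).map fun v => traceNum out k v r) ++
      faultyNum k v r
  | .gate (.cnot i j) k, v, r => force (pushNum (.cnot i j) v) fun v =>
    ((allAt (index i) v).flatMap fun v => (allAt (index j) v).map fun v => traceNum out k v r) ++
      faultyNum k v r
  | .gate g k, v, r => force (pushNum g v) fun v => faultyNum k v r
  | .prep _ q k, v, r =>
    force (addAt (index q) (v.testBit (index q)) (v.testBit (17 + index q)) v) fun v =>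
      faultyNum k v r
  | .meas b q k, v, r =>
    ((allAt (index q) v).map fun v => traceNum out (.meas b q k) v r) ++
      bif v.testBit (digit b (index q)) then force (2 * r + 1) fun r => faultyNum (k 1) v r
      else force (2 * r) fun r => faultyNum (k 0) v r

/-- The number of a measurement record. -/
def recordNum (r : ℕ) (l : List Bit) : ℕ := l.foldl (fun r m => 2 * r + m.val) r

/-- The witness `u` is the number carried along by the simulation; decoding commutes with every
elementary operation, and a measurement appends its outcome to the record as a binary digit. -/
theorem traceNum_eq (p : Proc Qubit) : ∀ (v r : ℕ), ∃ u,
    (trace p (decode v)).2 = decode u ∧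
      traceNum out p v r = out (recordNum r (trace p (decode v)).1) u := by
  induction p with
  | done => exact fun v r => ⟨v, rfl, rfl⟩
  | gate g k ih =>
    intro v r
    rw [traceNum, force_eq, trace, ← decode_pushNum]
    exact ih _ _
  | prep b q k ih =>
    intro v r
    rw [traceNum, force_eq, trace, ← decode_clear]
    exact ih _ _
  | meas b q k ih =>
    intro v r
    rw [traceNum, force_eq, force_eq, trace, flip_decode]
    cases v.testBit (digit b (index q))
    · exact ih 0 v (2 * r)
    · exact ih 1 v (2 * r + 1)

theorem exists_mem_allAt (q : Qubit) (a b : Bit) (v : ℕ) :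
    ∃ u ∈ allAt (index q) v, decode u = decode v + frameAt q a b := by
  obtain ⟨a, rfl⟩ := exists_toBit a
  obtain ⟨b, rfl⟩ := exists_toBit b
  refine ⟨addAt (index q) a b v, ?_, decode_addAt q a b v⟩
  cases a <;> cases b <;> simp [allAt]
  simp [addAt, flipDigit]

/-- Only this inclusion is needed: superfluous entries of the list could only make the consistency
check harder to pass. -/
theorem mem_faultyNum (p : Proc Qubit) : ∀ (v r : ℕ) (l : List Bit) (w : Frame Qubit),
    Faulty p (decode v) l w → ∃ u, w = decode u ∧ out (recordNum r l) u ∈ faultyNum out p v r := by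
  have htrace : ∀ (k : Proc Qubit) (v r : ℕ) (l : List Bit) (w : Frame Qubit),
      trace k (decode v) = (l, w) → ∃ u, w = decode u ∧
        out (recordNum r l) u = traceNum out k v r := by
    intro k v r l w h
    obtain ⟨u, h1, h2⟩ := traceNum_eq out k v r
    rw [h] at h1 h2
    exact ⟨u, h1, h2.symm⟩
  have htwo : ∀ (i j : Qubit) (k : Proc Qubit) (v r : ℕ) (l : List Bit) (w : Frame Qubit)
      (a b a' b' : Bit), trace k (decode v + (frameAt i a b + frameAt j a' b')) = (l, w) →
      ∃ u, w = decode u ∧ out (recordNum r l) u ∈ (allAt (index i) v).flatMap fun v =>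
        (allAt (index j) v).map fun v => traceNum out k v r := by
    intro i j k v r l w a b a' b' h
    obtain ⟨u₁, hu₁, e₁⟩ := exists_mem_allAt i a b v
    obtain ⟨u₂, hu₂, e₂⟩ := exists_mem_allAt j a' b' u₁
    rw [← add_assoc, ← e₁, ← e₂] at h
    obtain ⟨u, hw, hu⟩ := htrace k u₂ r l w h
    exact ⟨u, hw, List.mem_flatMap.2 ⟨u₁, hu₁, List.mem_map.2 ⟨u₂, hu₂, hu.symm⟩⟩⟩
  induction p with
  | done =>
    rintro v r l w ⟨rfl, q, a, b, rfl⟩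
    obtain ⟨u, hu, e⟩ := exists_mem_allAt q a b v
    exact ⟨u, e.symm, List.mem_flatMap.2
      ⟨index q, List.mem_range.2 (index_lt q), List.mem_map.2 ⟨u, hu, rfl⟩⟩⟩
  | gate g k ih =>
    intro v r l w h
    rw [Faulty, ← decode_pushNum] at h
    rcases h with ⟨e, he, ht⟩ | h
    · cases g with
      | cz i j =>
        obtain ⟨a, b, a', b', rfl⟩ := he
        obtain ⟨u, hw, hu⟩ := htwo i j k _ r l w a b a' b' ht
        refine ⟨u, hw, ?_⟩
        rw [faultyNum, force_eq]
        exact List.mem_append_left _ hu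
      | cnot i j =>
        obtain ⟨a, b, a', b', rfl⟩ := he
        obtain ⟨u, hw, hu⟩ := htwo i j k _ r l w a b a' b' ht
        refine ⟨u, hw, ?_⟩
        rw [faultyNum, force_eq]
        exact List.mem_append_left _ hu
      | pauli q a b => exact he.elim
      | loc u q => exact he.elim
      | relabel σ => exact he.elim
    · obtain ⟨u, hw, hu⟩ := ih _ r l w h
      refine ⟨u, hw, ?_⟩
      cases g with
      | cz i j =>
        rw [faultyNum, force_eq]
        exact List.mem_append_right _ hu
      | cnot i j =>
        rw [faultyNum, force_eq]
        exact List.mem_append_right _ hu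
      | pauli q a b => rwa [faultyNum, force_eq] <;> simp
      | loc u q => rwa [faultyNum, force_eq] <;> simp
      | relabel σ => rwa [faultyNum, force_eq] <;> simp
  | prep b q k ih =>
    intro v r l w h
    rw [Faulty, ← decode_clear] at h
    rw [faultyNum, force_eq]
    exact ih _ r l w h
  | meas b q k ih =>
    intro v r l w h
    rw [faultyNum, force_eq, force_eq]
    rcases h with ⟨a, a', h⟩ | ⟨l', rfl, h⟩
    · obtain ⟨u₁, hu₁, e₁⟩ := exists_mem_allAt q a a' v
      rw [← e₁] at h
      obtain ⟨u, hw, hu⟩ := htrace _ u₁ r l w h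
      exact ⟨u, hw, List.mem_append_left _ (List.mem_map.2 ⟨u₁, hu₁, hu.symm⟩)⟩
    · rw [flip_decode] at h ⊢
      cases hb : v.testBit (digit b (index q))
      · rw [hb] at h
        obtain ⟨u, hw, hu⟩ := ih 0 v (2 * r) l' w h
        exact ⟨u, hw, List.mem_append_right _ hu⟩
      · rw [hb] at h
        obtain ⟨u, hw, hu⟩ := ih 1 v (2 * r + 1) l' w h
        exact ⟨u, hw, List.mem_append_right _ hu⟩

end Enumeration

/-! ### The correction rules -/

/-- The number with the given binary digits, the most significant one first. -/
def bitsNum (l : List Bit) : ℕ := l.foldl (fun n b => 2 * n + b.val) 0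

/-- The set of the code-block qubits whose numbers, from `1` to `15`, are listed. -/
def indicator (l : List ℕ) (q : Fin 15) : Bit := toBit (l.elem (q.val + 1))

/-- The correction after the measurement of all stabilizers with the outcomes `o`: the one-qubit
operators with the given syndrome, except that the `Z` part is looked up in a table if the flag of
the previous syndrome extraction has been raised. -/
def correctionRule (table : List (ℕ × List ℕ)) (f : Bit) (o : List Bit) : Recovery :=
  (indicator [bitsNum (o.take 4)],
    indicator (bif f == 1 then (table.lookup (bitsNum (o.drop 4))).getD [bitsNum (o.drop 4)]
      else [bitsNum (o.drop 4)]))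

/-- The correction rule of the first error correction. -/
def rule₁ (f _m : Bit) : List Bit → Recovery :=
  correctionRule [(1, [4, 5]), (2, [4, 5, 6, 7, 12, 14]), (7, [4, 5, 6]), (11, [4, 5, 6, 12]),
    (12, [4, 5, 6, 7, 12])] f

/-- The correction rule of the second error correction. -/
def rule₂ (f _m : Bit) : List Bit → Recovery :=
  correctionRule [(1, [8, 9]), (2, [8, 9, 10, 11, 12, 14]), (7, [8, 9, 10, 12]), (11, [8, 9, 10]),
    (12, [8, 9, 10, 11, 12])] f

/-! ### Consistency of the enumerated executions -/

/-- The columns of the parity checks (digits `0` to `3`) and of the logical operators (digits `4`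
to `10`). -/
def columns : List ℕ :=
  [2040, 244, 12, 786, 42, 326, 654, 1041, 393, 1317, 77, 547, 1163, 1607, 31]

/-- The digitwise sum of those columns for which the digits of `v`, from digit `i` on, are `1`. -/
def columnSum : List ℕ → ℕ → ℕ → ℕ
  | [], _, _ => 0
  | c :: l, i, v => (bif v.testBit i then c else 0) ^^^ columnSum l (i + 1) v

/-- The measurement record with the syndrome, and the parities with the logical operators. -/
def result (r v : ℕ) : ℕ × ℕ × ℕ :=
  force (columnSum columns 0 v) fun x => force (columnSum columns 17 v) fun z =>
    (256 * r + (16 * (x % 16) + z % 16), x / 16, z / 16)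

/-- Evaluate the elements of a list before `f` is applied. -/
def forceList {α : Type} (f : List (ℕ × ℕ × ℕ) → α) :
    List (ℕ × ℕ × ℕ) → List (ℕ × ℕ × ℕ) → α
  | [], acc => f acc
  | (k, x, z) :: l, acc => force k fun k => force x fun x => force z fun z =>
    forceList f l ((k, x, z) :: acc)

/-- Elements that agree in the first `n` digits of the first component are equal. -/
def consistent : ℕ → List (ℕ × ℕ × ℕ) → Bool
  | 0, l => match l with
    | [] => true
    | a :: l => l.all fun b => b.2.1 == a.2.1 && b.2.2 == a.2.2
  | n + 1, l => match l with
    | [] => true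
    | [_] => true
    | a :: b :: l => consistent n ((a :: b :: l).filter fun c => c.1.testBit n) &&
        consistent n ((a :: b :: l).filter fun c => !c.1.testBit n)

/-- The finite verification behind the fault tolerance of the procedure. The record number starts
from `1`, so records of different length stay distinct. The longest record has 24 outcomes; with
this leading digit and the 8 syndrome digits the keys have at most 33 digits, so 34 rounds separate
all keys. -/
theorem consistent_results :
    forceList (consistent 34) (faultyNum result (roundRobinProc rule₁ rule₂) 0 1) [] = true := by
  decide +kernel

theorem forceList_eq {α : Type} (f : List (ℕ × ℕ × ℕ) → α) (l acc : List (ℕ × ℕ × ℕ)) :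
    forceList f l acc = f (l.reverse ++ acc) := by
  induction l generalizing acc with
  | nil => rfl
  | cons a l ih =>
    obtain ⟨k, x, z⟩ := a
    rw [forceList, force_eq, force_eq, force_eq, ih, List.reverse_cons, List.append_assoc,
      List.singleton_append]

/-- Elements with equal keys fall on the same side of every split, so they meet in a final class,
where all values were compared with the first one. -/
theorem eq_of_consistent (n : ℕ) : ∀ {l : List (ℕ × ℕ × ℕ)}, consistent n l = true →
    ∀ {a b : ℕ × ℕ × ℕ}, a ∈ l → b ∈ l → a.1 = b.1 → a.2 = b.2 := by
  induction n with
  | zero =>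
    intro l h a b ha hb hab
    match l, h with
    | c :: l, h =>
      have hc : ∀ a ∈ c :: l, a.2 = c.2 := by
        intro a ha
        rcases List.mem_cons.1 ha with rfl | ha
        · rfl
        · have := List.all_eq_true.1 h a ha
          simp only [Bool.and_eq_true, beq_iff_eq] at this
          exact Prod.ext this.1 this.2
      rw [hc a ha, hc b hb]
  | succ n ih =>
    intro l h a b ha hb hab
    match l, h with
    | [c], h => rw [List.mem_singleton.1 ha, List.mem_singleton.1 hb]
    | c :: c' :: l, h =>
      obtain ⟨h1, h2⟩ := (Bool.and_eq_true _ _).mp h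
      cases hn : a.1.testBit n
      · refine ih h2 (List.mem_filter.2 ⟨ha, ?_⟩) (List.mem_filter.2 ⟨hb, ?_⟩) hab
        · rw [hn]; rfl
        · rw [← hab, hn]; rfl
      · exact ih h1 (List.mem_filter.2 ⟨ha, hn⟩) (List.mem_filter.2 ⟨hb, by rw [← hab, hn]⟩) hab

/-- The number is `2^20 + 2^24 + 2^28`, the digits of `Z` on qubits 4, 8, 12: these gates were
counted as errors and are all that remains without faults. -/
theorem trace_roundRobinProc :
    (trace (roundRobinProc rule₁ rule₂) 0).2 = decode 286261248 := by
  obtain ⟨u, h1, h2⟩ := traceNum_eq (fun _ v => v) (roundRobinProc rule₁ rule₂) 0 1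
  rw [decode_zero] at h1
  exact h1.trans (congrArg decode (h2.symm.trans (by decide +kernel)))

/-! ### Reading syndromes and logical parities from digit sums -/

theorem toBit_columnSum (l : List ℕ) (n i v k : ℕ) (hn : n = l.length) :
    toBit ((columnSum l i v).testBit k) =
      ∑ j : Fin n, toBit ((l.getD j 0).testBit k) * toBit (v.testBit (i + j)) := by
  induction l generalizing n i with
  | nil =>
    subst hn
    simp [columnSum, toBit]
  | cons c l ih =>
    obtain rfl : n = l.length + 1 := hn
    rw [columnSum, Nat.testBit_xor, toBit_xor, ih _ _ rfl, Fin.sum_univ_succ]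
    congr 1
    · change _ = toBit (c.testBit k) * toBit (v.testBit i)
      cases v.testBit i
      · rw [cond_false, Nat.zero_testBit]
        exact (mul_zero _).symm
      · exact (mul_one _).symm
    · simp only [Fin.val_succ, Nat.add_assoc, Nat.add_comm 1]
      rfl

theorem sum_columns {a : Fin 15 → Bit} {k : ℕ}
    (h : ∀ j : Fin 15, a j = toBit ((columns.getD j 0).testBit k)) (i v : ℕ) :
    toBit ((columnSum columns i v).testBit k) = a ⬝ᵥ fun j => toBit (v.testBit (i + j)) := by
  rw [toBit_columnSum columns 15 _ _ _ rfl, dotProduct]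
  exact Finset.sum_congr rfl fun j _ => by rw [h]

theorem checks_columns :
    checks = Matrix.of fun (i : Fin 4) (j : Fin 15) =>
      toBit ((columns.getD j 0).testBit i) := by
  decide +kernel

theorem logicals_columns :
    logicals = Matrix.of fun (i : Fin 7) (j : Fin 15) =>
      toBit ((columns.getD j 0).testBit (4 + i)) := by
  decide +kernel

/-- The lowest four digits of a column sum are the parities with `checks`, so equal syndromes give
equal keys in `result`. -/
theorem columnSum_mod_eq {i v w : ℕ}
    (h : (checks *ᵥ fun j => toBit (v.testBit (i + j.val))) =
      checks *ᵥ fun j => toBit (w.testBit (i + j.val))) :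
    columnSum columns i v % 16 = columnSum columns i w % 16 := by
  refine Nat.eq_of_testBit_eq fun k => ?_
  rw [show 16 = 2 ^ 4 from rfl, Nat.testBit_mod_two_pow, Nat.testBit_mod_two_pow]
  by_cases hk : k < 4
  · congr 1
    refine toBit_injective ?_
    have e := congrFun (congrFun checks_columns ⟨k, hk⟩)
    rw [sum_columns e, sum_columns e]
    exact congrFun h ⟨k, hk⟩
  · rw [decide_eq_false hk, Bool.false_and, Bool.false_and]

/-- The digits from the fifth on are the parities with `logicals`; equal values in `result`
therefore mean logically equivalent errors. -/
theorem logicals_mulVec_eq {i v w : ℕ}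
    (h : columnSum columns i v / 16 = columnSum columns i w / 16) :
    (logicals *ᵥ fun j => toBit (v.testBit (i + j.val))) =
      logicals *ᵥ fun j => toBit (w.testBit (i + j.val)) := by
  funext k
  have e := congrFun (congrFun logicals_columns k)
  have h' := congrArg (fun n => toBit (n.testBit k)) h
  simp only [show 16 = 2 ^ 4 from rfl, Nat.testBit_div_two_pow] at h'
  rw [Nat.add_comm, sum_columns e, sum_columns e] at h'
  exact h'

theorem dataFrame_decode (v : ℕ) : dataFrame (decode v) =
    (fun j => toBit (v.testBit (0 + j.val)), fun j => toBit (v.testBit (17 + j.val))) := by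
  refine Prod.ext ?_ rfl
  funext j
  change _ = toBit (v.testBit (0 + j.val))
  rw [Nat.zero_add]
  rfl

/-- Two executions with at most one fault that have the same measurement record and the same
syndrome have equivalent errors. -/
theorem logicals_mulVec_of_faulty {r : List Bit} {v w : Frame Qubit}
    (hv : Faulty (roundRobinProc rule₁ rule₂) 0 r v)
    (hw : Faulty (roundRobinProc rule₁ rule₂) 0 r w)
    (h1 : checks *ᵥ (dataFrame v).1 = checks *ᵥ (dataFrame w).1)
    (h2 : checks *ᵥ (dataFrame v).2 = checks *ᵥ (dataFrame w).2) :
    logicals *ᵥ (dataFrame v).1 = logicals *ᵥ (dataFrame w).1 ∧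
      logicals *ᵥ (dataFrame v).2 = logicals *ᵥ (dataFrame w).2 := by
  rw [← decode_zero] at hv hw
  obtain ⟨a, rfl, ha⟩ := mem_faultyNum result _ 0 1 r v hv
  obtain ⟨b, rfl, hb⟩ := mem_faultyNum result _ 0 1 r w hw
  have hc := consistent_results
  rw [forceList_eq, List.append_nil] at hc
  rw [dataFrame_decode, dataFrame_decode] at h1 h2 ⊢
  have hres : ∀ v, result (recordNum 1 r) v = (256 * recordNum 1 r +
      (16 * (columnSum columns 0 v % 16) + columnSum columns 17 v % 16),
      columnSum columns 0 v / 16, columnSum columns 17 v / 16) := by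
    intro v
    rw [result, force_eq, force_eq]
  have h := eq_of_consistent 34 hc (List.mem_reverse.2 ha) (List.mem_reverse.2 hb) (by
    rw [hres, hres, columnSum_mod_eq h1, columnSum_mod_eq h2])
  rw [hres, hres] at h
  exact ⟨logicals_mulVec_eq (congrArg Prod.fst h), logicals_mulVec_eq (congrArg Prod.snd h)⟩

/-! ### Fault tolerance -/

/-- The `Z` operators of the round-robin circuit. -/
def roundRobinFrame : Frame (Fin 15) :=
  frameAt (dat 4) 0 1 + frameAt (dat 8) 0 1 + frameAt (dat 12) 0 1

theorem roundRobin_eq_pauli_mul :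
    roundRobin = pauli roundRobinFrame * czCircuit roundRobinPairs := by
  have h : roundRobin = czCircuit roundRobinPairs *
    (pauliAt (dat 4) 0 1 * pauliAt (dat 8) 0 1 * pauliAt (dat 12) 0 1) := rfl
  have hz : ∀ (q : Fin 15) (b : Bit), (frameAt q 0 b).1 = 0 := fun q b => Pi.single_zero q
  have hp : pauli roundRobinFrame =
      pauliAt (dat 4) 0 1 * pauliAt (dat 8) 0 1 * pauliAt (dat 12) 0 1 := by
    rw [pauliAt_eq_pauli, pauliAt_eq_pauli, pauliAt_eq_pauli, pauli_mul, hz, dotProduct_zero,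
      sgn_zero, one_smul, pauli_mul, hz, dotProduct_zero, sgn_zero, one_smul, roundRobinFrame]
  have hf : roundRobinFrame = (0, roundRobinFrame.2) := by
    refine Prod.ext ?_ rfl
    rw [roundRobinFrame, Prod.fst_add, Prod.fst_add, hz, hz, hz, add_zero, add_zero]
  rw [h, ← hp, hf, pauli_diagonal, czCircuit_eq, Matrix.diagonal_mul_diagonal,
    Matrix.diagonal_mul_diagonal]
  simp only [mul_comm]

/-- The ideal state lacks the three `Z` gates of the circuit, so the error relative to the target
state is the tracked frame plus `roundRobinFrame`. -/
theorem tensorAnc_eq_of_closed {w : Frame Qubit} {Ψ : State} (h : Closed roundRobinPairs Ψ)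
    (c : ℂ) : ∃ A, c • (pauli w * Ψ) =
      tensorAnc (pauli (dataFrame w + roundRobinFrame) * (roundRobin * encoder)) A := by
  obtain ⟨A, rfl⟩ := h
  generalize hs : sgn ((dataFrame w + roundRobinFrame).2 ⬝ᵥ roundRobinFrame.1) = s
  have hss : s * s = 1 := by rw [← hs, sgn_mul_self]
  have e : pauli (dataFrame w) =
      s • (pauli (dataFrame w + roundRobinFrame) * pauli roundRobinFrame) := by
    rw [pauli_mul, frame_add_add_cancel, hs, smul_smul, hss, one_smul]
  rw [pauli_mul_tensorAnc, e, roundRobin_eq_pauli_mul, Matrix.smul_mul, smul_tensorAnc,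
    tensorAnc_smul]
  simp only [Matrix.mul_assoc]
  exact ⟨_, rfl⟩

theorem faultTolerant_roundRobin : FaultTolerant (roundRobinProc rule₁ rule₂) roundRobin := by
  obtain ⟨L, hL⟩ := exists_logical_of_mem roundRobin_mem_unitary (Or.inr (Or.inr rfl))
  obtain ⟨Φ, hΦ⟩ : ∃ Φ : State, tensorAnc encoder 1 = Φ := ⟨_, rfl⟩
  have hd : Det (roundRobinProc rule₁ rule₂) Φ (Closed roundRobinPairs) :=
    det_roundRobinProc rule₁ rule₂
      ⟨1, by rw [show czCircuit [] = 1 from rfl, Matrix.one_mul, hΦ]⟩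
  have hone : tensorAnc encoder 1 = pauli (0 : Frame Qubit) * Φ := by
    rw [pauli_zero, Matrix.one_mul, hΦ]
  refine faultTolerant_of_errors hL (fun r v => ∃ w, Faulty (roundRobinProc rule₁ rule₂) 0 r w ∧
    v = dataFrame w + roundRobinFrame) ?_ ?_ ?_
  · intro r K hK
    rw [hone]
    rcases run_zero_sound hK rfl hd 0 with h | ⟨c, w, Ψ', hΨ', ht, h⟩
    · exact ⟨0, by rw [h, tensorAnc_zero]⟩
    · obtain ⟨A, hA⟩ := tensorAnc_eq_of_closed (w := w) hΨ' c
      refine ⟨A, ?_⟩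
      -- Without faults the tracked error consists of the three `Z` gates only and cancels against
      -- `roundRobinFrame`.
      have hw : dataFrame w + roundRobinFrame = 0 := by
        have := trace_roundRobinProc
        rw [ht] at this
        rw [show w = _ from this]
        decide +kernel
      rw [h, hA, hw, pauli_zero, Matrix.one_mul]
  · intro n r K hn hK
    rw [hone]
    have key : K * (pauli (0 : Frame Qubit) * Φ) = 0 ∨ ∃ (c : ℂ) (w : Frame Qubit) (Ψ' : State),
        Closed roundRobinPairs Ψ' ∧ Faulty (roundRobinProc rule₁ rule₂) 0 r w ∧
          K * (pauli (0 : Frame Qubit) * Φ) = c • (pauli w * Ψ') := by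
      rcases Nat.le_one_iff_eq_zero_or_eq_one.1 hn with rfl | rfl
      · rcases run_zero_sound hK rfl hd 0 with h | ⟨c, w, Ψ', hΨ', ht, h⟩
        · exact Or.inl h
        -- An execution without faults is included among the faulty ones as one with a trivial
        -- fault.
        · exact Or.inr ⟨c, w, Ψ', hΨ', faulty_of_trace _ (anc 0) 0 0
            (by rwa [frameAt_zero, add_zero]), h⟩
      · exact run_one_sound hK rfl hd 0
    rcases key with h | ⟨c, w, Ψ', hΨ', hf, h⟩
    · exact Or.inl h
    · obtain ⟨A, hA⟩ := tensorAnc_eq_of_closed (w := w) hΨ' c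
      exact Or.inr ⟨_, A, ⟨w, hf, rfl⟩, h.trans hA⟩
  · rintro r _ _ ⟨v, hv, rfl⟩ ⟨w, hw, rfl⟩ h1 h2
    rw [Prod.fst_add, Prod.fst_add, mulVec_add, mulVec_add] at h1
    rw [Prod.snd_add, Prod.snd_add, mulVec_add, mulVec_add] at h2
    obtain ⟨e1, e2⟩ := logicals_mulVec_of_faulty hv hw (add_right_cancel h1) (add_right_cancel h2)
    have e : dataFrame v + roundRobinFrame + (dataFrame w + roundRobinFrame) =
        dataFrame v + dataFrame w := by
      rw [add_add_add_comm, frame_add_self, add_zero]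
    rw [e, Prod.fst_add, Prod.snd_add, mulVec_add, mulVec_add, e1, e2, bits_add_self,
      bits_add_self]
    exact ⟨rfl, rfl⟩

end Hamming15

/-- The two-ancilla fault-tolerant Clifford group on the `[[15,7,3]]` Hamming code. -/
theorem mainTheorem1 :
    IsEncoder encoder ∧
    (∀ U ∈ generators, ∃ L ∈ cliffordGroup (Fin 7),
      (U : Op (Fin 15) (Fin 15)) * encoder = encoder * (L : Op (Fin 7) (Fin 7))) ∧
    {L : Matrix.unitaryGroup (Fin 7 → Bit) ℂ | ∃ U ∈ Subgroup.closure generators,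
      (U : Op (Fin 15) (Fin 15)) * encoder = encoder * (L : Op (Fin 7) (Fin 7))} =
        (cliffordGroup (Fin 7) : Set (Matrix.unitaryGroup (Fin 7 → Bit) ℂ)) ∧
    (∀ u ∈ cliffordGroup (Fin 1),
      FaultTolerant (transversalProc (u : Op (Fin 1) (Fin 1)))
        (transversalOp (u : Op (Fin 1) (Fin 1)))) ∧
    (∀ σ ∈ ({σ₁, σ₂, σ₃} : Set (Equiv.Perm (Fin 15))),
      FaultTolerant (permProc σ) (permOp σ)) ∧
    (∃ D₁ D₂ : Bit → Bit → List Bit → Recovery,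
      FaultTolerant (roundRobinProc D₁ D₂) roundRobin) := by
  refine ⟨isEncoder_encoder, fun U hU => exists_logical_clifford hU, ?_,
    fun u hu => faultTolerant_transversal hu, fun σ hσ => faultTolerant_perm hσ,
    _, _, faultTolerant_roundRobin⟩
  rw [← logicalGroup_eq]
  rfl
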